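/- **Setting.** Let $n,r\ge 1$, $\mathcal A=\mathbb Z[t,t^{-1}]$, $q=t^2$, with the ring involution $\overline{t}=t^{-1}$. Let $W$ be the group of permutations $\sigma$ of $\mathbb Z$ with $\sigma(i+r)=\sigma(i)+r$ for all $i$. For $r\ge 2$ and $0\le i\le r-1$ let $s_i\in W$ be given by $s_i(j)=j+1$ if $j\equiv i$, $s_i(j)=j-1$ if $j\equiv i+1$, and $s_i(j)=j$ otherwise (congruences mod $r$); put $S=\{s_0,\dots,s_{r-1}\}$ ($S=\emptyset$ if $r=1$), and let $\rho(j)=j+1$. The length $l(w)$ is the least $k$ such that $w$ is a product of $k$ elements of $S$ and a power of $\rho$; $\le$ denotes the Bruhat order of the extended Coxeter group $W$. Let $\mathcal H$ be the extended affine Hecke algebra, i.e. the $\mathcal A$-algebra with generators $T_w$ ($w\in W$) and relations $T_1=1$, $T_wT_{w'}=T_{ww'}$ if $l(ww')=l(w)+l(w')$, and $(T_s+1)(T_s-q)=0$ for $s\in S$. Its bar involution is $\overline{\sum a_wT_w}=\sum\overline{a_w}\,T_{w^{-1}}^{-1}$. The Kazhdan–Lusztig element $C_w$ is the element of $\mathcal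 H$ with $\overline{C_w}=C_w$ and $C_w=t^{-l(w)}\sum_{y\le w}P_{y,w}(q)T_y$, where $P_{w,w}=1$ and $P_{y,w}\in\mathbb Z[q]$ has degree at most $\frac12(l(w)-l(y)-1)$ for $y<w$. Let $\Lambda$ be the set of sequences $\lambda=(\lambda_i)_{i\in\mathbb Z}$ in $\mathbb N$ with $\lambda_{i+n}=\lambda_i$ and $\lambda_1+\dots+\lambda_n=r$. For $\lambda\in\Lambda$ let $W_\lambda\subseteq W$ be the Young subgroup generated by those $s_i$ ($1\le i\le r-1$) for which $i$ is not a partial sum $\lambda_1+\dots+\lambda_k$ ($0\le k\le n$), let $w_{0,\lambda}$ be its longest element, and $x_\lambda=\sum_{w\in W_\lambda}T_w$. The affine $q$-Schur algebra is $\mathcal S=\mathrm{End}_{\mathcal H}\big(\bigoplus_{\lambda\in\Lambda}x_\lambda\mathcal H\big)$ (endomorphisms of right $\mathcal H$-modules). Let $\mathcal D_{\lambda\mu}$ be the set of minimal length representatives of the double cosets in $W_\lambda\backslash W/W_\mu$, and let $w^+$ be the longest element of $W_\lambda wW_\mu$ for $w\in\mathcal D_{\lambda\mu}$. Let $\phi_{\lambda,\mu}^w\in\mathcal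 S$ be given by $\phi_{\lambda,\mu}^w(x_\nu h)=\delta_{\mu\nu}\sum_{x\in W_\lambda wW_\mu}T_xh\in x_\lambda\mathcal H$ ($\nu\in\Lambda$, $h\in\mathcal H$). Let $\mathcal B$ be the set of triples $B=(\lambda,w,\mu)$ with $\lambda,\mu\in\Lambda$, $w\in\mathcal D_{\lambda\mu}$; write $\phi_B=\phi^w_{\lambda,\mu}$ and $$\theta_B=t^{l(w_{0,\mu})}\sum_{z\in\mathcal D_{\lambda\mu}}\alpha_{z,w}\,\phi_{\lambda,\mu}^z,\qquad\text{where}\quad C_{w^+}=\sum_{z\in\mathcal D_{\lambda\mu}}\alpha_{z,w}\sum_{x\in W_\lambda zW_\mu}T_x\quad(\alpha_{z,w}\in\mathcal A).$$ **Proposition.** (0) These objects are well defined: $(T_w)_{w\in W}$ is an $\mathcal A$-basis of $\mathcal H$; each $C_w$, each $\phi_B$ and each finitely supported family $(\alpha_{z,w})_z$ as above exists and is unique; and there is exactly one additive map $\overline{\phantom{x}}:\mathcal S\to\mathcal S$ with $\overline{af}=\overline a\,\overline f$ for $a\in\mathcal A$, $f\in\mathcal S$, such that for all $B=(\lambda,w,\mu)\in\mathcal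 B$ the endomorphism $\overline{\phi_B}$ vanishes on $x_\nu\mathcal H$ for $\nu\ne\mu$ and $$\overline{\phi_B}(C_{w_{0,\mu}}h)=\overline{\phi_B(C_{w_{0,\mu}})}\,h\in x_\lambda\mathcal H\qquad\text{for all }h\in\mathcal H.$$ (1) The map $\overline{\phantom{x}}$ is an algebra involution of $\mathcal S$: it is additive, $\overline{fg}=\overline f\,\overline g$, $\overline 1=1$, $\overline{af}=\overline a\,\overline f$ for $a\in\mathcal A$, and $\overline{\overline f}=f$. (2) Suppose $n\ge r$, and let $\omega\in\Lambda$ be given by $\omega_i=1$ for $1\le i\le r$ and $\omega_i=0$ for $r<i\le n$. There is an injective multiplicative $\mathcal A$-linear map $\iota:\mathcal H\to\mathcal S$ with $\iota(T_w)=\phi_{\omega,\omega}^w$ for all $w\in W$, and $\overline{\iota(h)}=\iota(\overline h)$ for all $h\in\mathcal H$; that is, the bar map restricts to the usual bar involution on the embedded affine Hecke algebra. (3) $\overline{\theta_B}=\theta_B$ for all $B\in\mathcal B$. -/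

import Mathlib

namespace AffineSchur

/-! ### The extended affine symmetric group -/

/-- The extended affine Weyl group `W` of type `Ã_{r-1}`: all permutations `σ` of `ℤ` such that
`σ (i + r) = σ i + r` for all `i`. -/
def affineSymmetric (r : ℕ) : Subgroup (Equiv.Perm ℤ) where
  carrier := {σ | ∀ i : ℤ, σ (i + r) = σ i + r}
  one_mem' := fun _ => rfl
  mul_mem' := by
    intro a b ha hb i
    rw [Equiv.Perm.mul_apply, Equiv.Perm.mul_apply, hb i, ha (b i)]
  inv_mem' := by
    intro a ha i
    have h : a (a⁻¹ i) = i := a.apply_symm_apply i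
    rw [Equiv.Perm.inv_eq_iff_eq, ha, h]

/-- The group `W`, as a type. -/
abbrev W (r : ℕ) : Type := affineSymmetric r

variable {r : ℕ}

/-- `IsSimple i s` says that `s` is the permutation `s_i`, which sends `j` to `j + 1` for
`j ≡ i`, to `j - 1` for `j ≡ i + 1`, and fixes all other `j` (congruences modulo `r`).
It depends on `i` modulo `r` only, and no `s` satisfies it when `r = 1`. -/
def IsSimple (i : ℤ) (s : W r) : Prop :=
  (∀ j : ℤ, j ≡ i [ZMOD r] → s.1 j = j + 1) ∧
  (∀ j : ℤ, j ≡ i + 1 [ZMOD r] → s.1 j = j - 1) ∧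
  (∀ j : ℤ, ¬ j ≡ i [ZMOD r] → ¬ j ≡ i + 1 [ZMOD r] → s.1 j = j)

/-- The set `S = {s_0, …, s_{r-1}}` of simple reflections (empty for `r = 1`). -/
def simples (r : ℕ) : Set (W r) := {s | ∃ i : ℤ, IsSimple i s}

/-- The shift `ρ : t ↦ t + 1`. -/
def rho (r : ℕ) : W r :=
  ⟨Equiv.addRight (1 : ℤ), fun i => by simp only [Equiv.coe_addRight]; ring⟩

/-- `w` is the product of a word of length `k` in the simple reflections and a power of `ρ`. -/
def HasWord (w : W r) (k : ℕ) : Prop :=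
  ∃ L : List (W r), (∀ s ∈ L, s ∈ simples r) ∧ L.length = k ∧ ∃ a : ℤ, w = L.prod * rho r ^ a

/-- The length function of the extended Coxeter group `W`: the length of `w' ρ ^ a`, with `w'` in
the subgroup generated by `S`, is the Coxeter length of `w'`. -/
noncomputable def length (w : W r) : ℕ := sInf {k | HasWord w k}

/-- The reflections of `W`: the conjugates of the simple reflections. -/
def IsReflection (x : W r) : Prop := ∃ g : W r, ∃ s ∈ simples r, x = g * s * g⁻¹

/-- The Bruhat order `y ≤ w` on `W`: the reflexive and transitive closure of the relation
`y < y x` for `x` a reflection with `l(y) < l(y x)`. -/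
def BruhatLE (y w : W r) : Prop :=
  Relation.ReflTransGen (fun u v : W r => ∃ x, IsReflection x ∧ v = u * x ∧ length u < length v) y w

/-- `x` is an element of maximal length of the set `X`. -/
def IsLongest (X : Set (W r)) (x : W r) : Prop := x ∈ X ∧ ∀ y ∈ X, length y ≤ length x

/-- `x` is an element of minimal length of the set `X`. -/
def IsShortest (X : Set (W r)) (x : W r) : Prop := x ∈ X ∧ ∀ y ∈ X, length x ≤ length y

/-- The element of maximal length of `X`; it is used for double cosets of finite parabolic
subgroups, in which there is exactly one such element. -/
noncomputable def longest (X : Set (W r)) : W r := Classical.epsilon (IsLongest X)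

/-! ### Facts on lengths that the bar involution of the Hecke algebra needs -/

theorem rho_zpow_apply (a j : ℤ) : ((rho r ^ a : W r)).1 j = j + a := by
  have h1 : ∀ (n : ℕ) (j : ℤ), ((rho r ^ n : W r)).1 j = j + n := by
    intro n
    induction n with
    | zero => intro j; simp
    | succ n ih =>
      intro j
      rw [pow_succ]
      change (rho r ^ n : W r).1 (j + 1) = _
      rw [ih]; push_cast; ring
  obtain ⟨n, rfl | rfl⟩ := a.eq_nat_or_neg
  · rw [zpow_natCast]; exact h1 n j
  · rw [zpow_neg, zpow_natCast]
    change ((rho r ^ n : W r).1)⁻¹ j = _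
    rw [Equiv.Perm.inv_eq_iff_eq, h1]; ring

theorem IsSimple.mul_self {i : ℤ} {s : W r} (h : IsSimple i s) : s * s = 1 := by
  obtain ⟨h1, h2, h3⟩ := h
  apply Subtype.ext
  ext j
  change s.1 (s.1 j) = j
  by_cases c1 : j ≡ i [ZMOD r]
  · rw [h1 j c1, h2 _ (c1.add_right 1)]; ring
  by_cases c2 : j ≡ i + 1 [ZMOD r]
  · have : j - 1 ≡ i [ZMOD r] := by simpa using c2.sub_right 1
    rw [h2 j c2, h1 _ this]; ring
  rw [h3 j c1 c2, h3 j c1 c2]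

theorem inv_of_simple {s : W r} (h : s ∈ simples r) : s⁻¹ = s := by
  obtain ⟨i, hi⟩ := h
  exact inv_eq_of_mul_eq_one_left hi.mul_self

theorem simple_conj {s : W r} (h : s ∈ simples r) (a : ℤ) :
    rho r ^ a * s * (rho r ^ a)⁻¹ ∈ simples r := by
  obtain ⟨i, h1, h2, h3⟩ := h
  have key : ∀ j, (rho r ^ a * s * (rho r ^ a)⁻¹ : W r).1 j = s.1 (j - a) + a := by
    intro j
    rw [← zpow_neg]
    change (rho r ^ a : W r).1 (s.1 ((rho r ^ (-a) : W r).1 j)) = _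
    rw [rho_zpow_apply, rho_zpow_apply]; rfl
  have sh : ∀ j b : ℤ, j ≡ b + a [ZMOD r] ↔ j - a ≡ b [ZMOD r] := by
    intro j b
    constructor
    · intro hj; simpa using hj.sub_right a
    · intro hj; simpa using hj.add_right a
  refine ⟨i + a, ?_, ?_, ?_⟩
  · intro j hj
    rw [key, h1 _ ((sh _ _).1 hj)]; ring
  · intro j hj
    rw [add_right_comm] at hj
    rw [key, h2 _ ((sh _ _).1 hj)]; ring
  · intro j hj hj'
    rw [add_right_comm] at hj'
    rw [key, h3 _ (fun h => hj ((sh _ _).2 h)) (fun h => hj' ((sh _ _).2 h))]; ring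

theorem HasWord.inv {w : W r} {k : ℕ} (h : HasWord w k) : HasWord w⁻¹ k := by
  obtain ⟨L, hL, hk, a, rfl⟩ := h
  refine ⟨(L.reverse.map fun s => MulAut.conj (rho r ^ (-a)) s), ?_, by simpa using hk, -a, ?_⟩
  · intro s hs
    simp only [List.mem_map, List.mem_reverse] at hs
    obtain ⟨s', hs', rfl⟩ := hs
    exact simple_conj (hL s' hs') (-a)
  · have : L.map (fun s => s⁻¹) = L := by
      conv_rhs => rw [← List.map_id L]
      exact List.map_congr_left fun s hs => inv_of_simple (hL s hs)
    have h2 : L.reverse.prod = L.prod⁻¹ := by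
      rw [List.prod_inv_reverse, this]
    have h3 : (L.reverse.map fun s => MulAut.conj (rho r ^ (-a)) s).prod =
        MulAut.conj (rho r ^ (-a)) L.reverse.prod := by
      rw [map_list_prod]
    rw [h3, h2, MulAut.conj_apply, mul_inv_rev, zpow_neg]
    group

theorem length_inv (w : W r) : length w⁻¹ = length w := by
  unfold length
  congr 1
  ext k
  exact ⟨fun h => by simpa using h.inv, fun h => h.inv⟩

theorem length_one : length (1 : W r) = 0 :=
  Nat.sInf_eq_zero.2 (Or.inl ⟨[], by simp, rfl, 0, by simp⟩)

theorem length_simple {s : W r} (h : s ∈ simples r) : length s = 1 := by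
  have h1 : HasWord s 1 := ⟨[s], by simpa using h, rfl, 0, by simp⟩
  have h2 : length s ≤ 1 := Nat.sInf_le h1
  have h3 : length s ≠ 0 := by
    intro h0
    have : HasWord s (length s) := Nat.sInf_mem (s := {k | HasWord s k}) ⟨1, h1⟩
    rw [h0] at this
    obtain ⟨L, -, hL, a, ha⟩ := this
    obtain ⟨i, hi1, hi2, -⟩ := h
    have e : ∀ j, s.1 j = j + a := by
      intro j
      rw [ha, List.length_eq_zero_iff.1 hL, List.prod_nil, one_mul, rho_zpow_apply]
    have e1 := hi1 i rfl
    have e2 := hi2 (i + 1) rfl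
    rw [e] at e1 e2
    omega
  omega

/-- An element of positive length is a simple reflection times an element of smaller length. -/
theorem exists_simple_mul {w : W r} (h : length w ≠ 0) :
    ∃ s ∈ simples r, ∃ v : W r, w = s * v ∧ length w = length s + length v := by
  have hne : {k | HasWord w k}.Nonempty := by
    by_contra hc
    rw [Set.not_nonempty_iff_eq_empty] at hc
    exact h (by unfold length; rw [hc]; exact Nat.sInf_empty)
  obtain ⟨L, hL, hk, a, ha⟩ : HasWord w (length w) := Nat.sInf_mem hne
  cases L with
  | nil => exact absurd hk.symm h
  | cons s L =>
    have hs : s ∈ simples r := hL s (by simp)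
    refine ⟨s, hs, L.prod * rho r ^ a, by rw [ha, List.prod_cons, mul_assoc], ?_⟩
    rw [length_simple hs]
    have hv : HasWord (L.prod * rho r ^ a : W r) L.length :=
      ⟨L, fun s hs => hL s (by simp [hs]), rfl, a, rfl⟩
    have h1 : length (L.prod * rho r ^ a : W r) ≤ L.length := Nat.sInf_le hv
    obtain ⟨L', hL', hk', a', ha'⟩ : HasWord (L.prod * rho r ^ a : W r) _ :=
      Nat.sInf_mem (s := {k | HasWord _ k}) ⟨_, hv⟩
    have h2 : length w ≤ length (L.prod * rho r ^ a : W r) + 1 := by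
      refine Nat.sInf_le ⟨s :: L', ?_, ?_, a', ?_⟩
      · intro x hx
        rcases List.mem_cons.1 hx with rfl | hx
        · exact hs
        · exact hL' x hx
      · rw [List.length_cons, hk']; rfl
      · rw [List.prod_cons, mul_assoc, ← ha', ha, List.prod_cons, mul_assoc]
    rw [List.length_cons] at hk
    omega

/-! ### The extended affine Hecke algebra and its bar involution -/

/-- The ring `𝒜 = ℤ[t, t⁻¹]`, with its involution `LaurentPolynomial.invert` (`t ↦ t⁻¹`). -/
abbrev A : Type := LaurentPolynomial ℤ

/-- The power `t ^ k` in `𝒜`. -/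
noncomputable abbrev tpow (k : ℤ) : A := LaurentPolynomial.T k

/-- The parameter `q = t ^ 2`. -/
noncomputable abbrev q : A := tpow 2

/-- The defining relations of the extended affine Hecke algebra on the generators `T_w`, `w ∈ W`:
`T_1 = 1`, `T_w T_{w'} = T_{w w'}` if `l(w w') = l(w) + l(w')`, and `(T_s + 1) (T_s - q) = 0`. -/
inductive HeckeRel (r : ℕ) : FreeAlgebra A (W r) → FreeAlgebra A (W r) → Prop
  | one : HeckeRel r (FreeAlgebra.ι A 1) 1
  | mul (w w' : W r) (h : length (w * w') = length w + length w') :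
      HeckeRel r (FreeAlgebra.ι A w * FreeAlgebra.ι A w') (FreeAlgebra.ι A (w * w'))
  | quad (s : W r) (hs : s ∈ simples r) :
      HeckeRel r ((FreeAlgebra.ι A s + 1) * (FreeAlgebra.ι A s - algebraMap A _ q)) 0

/-- The extended affine Hecke algebra over `𝒜`. -/
def Hecke (r : ℕ) : Type := RingQuot (HeckeRel r)

noncomputable instance : Ring (Hecke r) := inferInstanceAs (Ring (RingQuot (HeckeRel r)))

noncomputable instance : Algebra A (Hecke r) :=
  inferInstanceAs (Algebra A (RingQuot (HeckeRel r)))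

/-- The quotient map from the free algebra. -/
noncomputable def heckeMk (r : ℕ) : FreeAlgebra A (W r) →ₐ[A] Hecke r :=
  RingQuot.mkAlgHom A (HeckeRel r)

/-- The standard generator `T_w`. -/
noncomputable def T (w : W r) : Hecke r := heckeMk r (FreeAlgebra.ι A w)

theorem heckeMk_rel {x y : FreeAlgebra A (W r)} (h : HeckeRel r x y) :
    heckeMk r x = heckeMk r y :=
  RingQuot.mkAlgHom_rel A h

theorem T_one : T (1 : W r) = 1 := by
  have := heckeMk_rel (HeckeRel.one (r := r))
  rwa [map_one] at this

theorem T_mul {w w' : W r} (h : length (w * w') = length w + length w') :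
    T w * T w' = T (w * w') := by
  have := heckeMk_rel (HeckeRel.mul w w' h)
  rwa [map_mul] at this

theorem T_quad {s : W r} (h : s ∈ simples r) :
    (T s + 1) * (T s - algebraMap A (Hecke r) q) = 0 := by
  have := heckeMk_rel (HeckeRel.quad s h)
  rw [map_mul, map_add, map_sub, map_one, map_zero, AlgHom.commutes] at this
  exact this

theorem q_mul_inv : q * tpow (-2) = 1 := by
  rw [← LaurentPolynomial.T_add]; exact LaurentPolynomial.T_zero

theorem isUnit_T_simple {s : W r} (h : s ∈ simples r) : IsUnit (T s) := by
  have h1 := T_quad h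
  set c := algebraMap A (Hecke r) q with hc
  set d := algebraMap A (Hecke r) (tpow (-2)) with hd
  have hcd : c * d = 1 := by rw [hc, hd, ← map_mul, q_mul_inv, map_one]
  have hx : Commute c (T s) := Algebra.commutes _ _
  have hdx : Commute d (T s) := Algebra.commutes _ _
  have h2 : T s * (T s - c + 1) = c := by
    have : T s * (T s - c + 1) = (T s + 1) * (T s - c) + c := by noncomm_ring
    rw [this, h1, zero_add]
  have h3 : Commute (T s) (T s - c + 1) :=
    ((Commute.refl _).sub_right hx.symm).add_right (Commute.one_right _)
  refine isUnit_iff_exists.2 ⟨(T s - c + 1) * d, ?_, ?_⟩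
  · rw [← mul_assoc, h2, hcd]
  · rw [mul_assoc, hdx.eq, ← mul_assoc, ← h3.eq, h2, hcd]

theorem isUnit_T (w : W r) : IsUnit (T w) := by
  induction hn : length w using Nat.strong_induction_on generalizing w with
  | _ n ih =>
    by_cases h0 : length w = 0
    · have e : ∀ v : W r, length v = 0 → T v * T v⁻¹ = 1 := by
        intro v hv
        rw [T_mul, mul_inv_cancel, T_one]
        rw [mul_inv_cancel, length_one, length_inv, hv]
      refine isUnit_iff_exists.2 ⟨T w⁻¹, e w h0, ?_⟩
      simpa using e w⁻¹ (by rw [length_inv, h0])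
    · obtain ⟨s, hs, v, hv, hl⟩ := exists_simple_mul h0
      have h1 := length_simple hs
      have h2 := ih (length v) (by omega) v rfl
      rw [hv] at hl ⊢
      rw [← T_mul hl]
      exact (isUnit_T_simple hs).mul h2

/-- The homomorphism from the free algebra which is `t ↦ t⁻¹` on scalars and sends the generator
of `w` to `T_{w⁻¹}⁻¹`. -/
noncomputable def freeBar (r : ℕ) : FreeAlgebra A (W r) →+* Hecke r :=
  (MonoidAlgebra.liftNCRingHom
    ((algebraMap A (Hecke r)).comp
      ((LaurentPolynomial.invert : A ≃ₐ[ℤ] A) : A →+* A))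
    (FreeMonoid.lift fun w : W r => Ring.inverse (T w⁻¹))
    (fun a _ => Algebra.commutes (LaurentPolynomial.invert a) _)).comp
  ((FreeAlgebra.equivMonoidAlgebraFreeMonoid :
    FreeAlgebra A (W r) ≃ₐ[A] _) : FreeAlgebra A (W r) →+* MonoidAlgebra A (FreeMonoid (W r)))

theorem freeBar_ι (w : W r) : freeBar r (FreeAlgebra.ι A w) = Ring.inverse (T w⁻¹) := by
  simp only [freeBar, FreeAlgebra.equivMonoidAlgebraFreeMonoid, RingHom.comp_apply,
    RingHom.coe_coe, AlgEquiv.ofAlgHom_apply, FreeAlgebra.lift_ι_apply, MonoidAlgebra.of_apply]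
  exact (MonoidAlgebra.liftNCRingHom_single _ _ _ _ _).trans (by simp)

theorem freeBar_algebraMap (a : A) :
    freeBar r (algebraMap A _ a) = algebraMap A _ (LaurentPolynomial.invert a) := by
  simp only [freeBar, RingHom.comp_apply, RingHom.coe_coe, AlgEquiv.commutes,
    MonoidAlgebra.coe_algebraMap, Function.comp_apply]
  exact (MonoidAlgebra.liftNCRingHom_single _ _ _ _ _).trans (by simp)

theorem freeBar_rel {x y : FreeAlgebra A (W r)} (h : HeckeRel r x y) :
    freeBar r x = freeBar r y := by
  have inv_of : ∀ {a b : Hecke r}, IsUnit a → a * b = 1 → Ring.inverse a = b := by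
    intro a b ha hab
    calc Ring.inverse a = Ring.inverse a * (a * b) := by rw [hab, mul_one]
      _ = b := Ring.inverse_mul_cancel_left _ _ ha
  induction h with
  | one => rw [freeBar_ι, inv_one, T_one, Ring.inverse_one, map_one]
  | mul w w' h =>
    have hl : length (w'⁻¹ * w⁻¹) = length w'⁻¹ + length w⁻¹ := by
      rw [← mul_inv_rev, length_inv, length_inv, length_inv, h, add_comm]
    rw [map_mul, freeBar_ι, freeBar_ι, freeBar_ι, mul_inv_rev, ← T_mul hl]
    refine (inv_of ((isUnit_T _).mul (isUnit_T _)) ?_).symm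
    rw [mul_assoc, Ring.mul_inverse_cancel_left _ _ (isUnit_T _),
      Ring.mul_inverse_cancel _ (isUnit_T _)]
  | quad s hs =>
    have hu := isUnit_T_simple hs
    have hq := T_quad hs
    rw [map_mul, map_add, map_sub, map_one, map_zero, freeBar_ι, freeBar_algebraMap,
      LaurentPolynomial.invert_T, inv_of_simple hs]
    set c := algebraMap A (Hecke r) q with hc
    set d := algebraMap A (Hecke r) (tpow (-2)) with hd
    set u := Ring.inverse (T s) with hu'
    have hcd : d * c = 1 := by rw [hc, hd, ← map_mul, mul_comm, q_mul_inv, map_one]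
    have hdx : ∀ y, d * y = y * d := fun y => Algebra.commutes _ y
    have e1 : u * T s = 1 := Ring.inverse_mul_cancel _ hu
    have e2 : T s * u = 1 := Ring.mul_inverse_cancel _ hu
    have e3 : u * ((T s + 1) * (T s - c)) * u * d = -((u + 1) * (u - d)) := by
      have a1 : u * ((T s + 1) * (T s - c)) * u
          = (u * T s + u) * (T s * u - c * u) := by noncomm_ring
      have a2 : c * u * d = u := by
        rw [mul_assoc, ← hdx, ← mul_assoc, hc, hd, ← map_mul, q_mul_inv, map_one, one_mul]
      rw [a1, e1, e2, mul_assoc, sub_mul, a2]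
      noncomm_ring
    rw [hq, mul_zero, zero_mul, zero_mul] at e3
    exact neg_eq_zero.1 e3.symm

/-- The bar involution of the Hecke algebra, `∑ a_w T_w ↦ ∑ \bar{a_w} T_{w⁻¹}⁻¹`. -/
noncomputable def heckeBar (r : ℕ) : Hecke r →+* Hecke r :=
  RingQuot.lift ⟨freeBar r, fun _ _ h => freeBar_rel h⟩

theorem heckeBar_heckeMk (x : FreeAlgebra A (W r)) : heckeBar r (heckeMk r x) = freeBar r x := by
  have h : heckeMk r x = RingQuot.mkRingHom (HeckeRel r) x := by
    rw [← RingQuot.mkAlgHom_coe A]; rfl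
  rw [h]
  exact RingQuot.lift_mkRingHom_apply _ _ _

theorem heckeBar_T (w : W r) : heckeBar r (T w) = Ring.inverse (T w⁻¹) := by
  rw [T, heckeBar_heckeMk, freeBar_ι, T]

theorem heckeBar_algebraMap (a : A) :
    heckeBar r (algebraMap A _ a) = algebraMap A _ (LaurentPolynomial.invert a) := by
  rw [← AlgHom.commutes (heckeMk r), heckeBar_heckeMk, freeBar_algebraMap]

/-! ### The Kazhdan-Lusztig basis of the Hecke algebra -/

/-- `c` is the Kazhdan-Lusztig element `C_w`: it is fixed by the bar involution and equal to
`q^{-l(w)/2} ∑_{y ≤ w} P_{y,w}(q) T_y`, where `P_{w,w} = 1` and `P_{y,w}` is an integral polynomial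
of degree at most `(l(w) - l(y) - 1) / 2` for `y < w`. The family `(P_{y,w})_y` is `P`. -/
def IsKL (w : W r) (c : Hecke r) : Prop :=
  heckeBar r c = c ∧
  ∃ P : W r →₀ Polynomial ℤ,
    (∀ y ∈ P.support, BruhatLE y w) ∧
    P w = 1 ∧
    (∀ y, BruhatLE y w → y ≠ w → 2 * (P y).natDegree + length y + 1 ≤ length w) ∧
    c = tpow (-(length w : ℤ)) • P.sum fun y p => Polynomial.aeval q p • T y

/-- The Kazhdan-Lusztig element `C_w`. -/
noncomputable def klC (w : W r) : Hecke r := Classical.epsilon (IsKL w)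

/-! ### The affine `q`-Schur algebra -/

/-- The set `Λ(n, r)` of `n`-periodic sequences of natural numbers with `λ_1 + ⋯ + λ_n = r`. -/
def Lam (n r : ℕ) : Type :=
  {lam : ℤ → ℕ // (∀ i, lam (i + n) = lam i) ∧ ∑ i ∈ Finset.Icc (1 : ℤ) n, lam i = r}

noncomputable instance (n r : ℕ) : DecidableEq (Lam n r) := Classical.decEq _

variable {n : ℕ}

/-- The set `I(λ)` of those `s_i`, `1 ≤ i ≤ r - 1`, for which `i` is not a partial sum
`λ_1 + ⋯ + λ_k`. -/
def youngSimples (lam : Lam n r) : Set (W r) :=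
  {s | ∃ i : ℤ, 1 ≤ i ∧ i < r ∧ IsSimple i s ∧
    ∀ k : ℤ, 0 ≤ k → k ≤ n → ((∑ j ∈ Finset.Icc 1 k, lam.1 j : ℕ) : ℤ) ≠ i}

/-- The standard Young subgroup `W_λ` of `W`. -/
def young (lam : Lam n r) : Subgroup (W r) := Subgroup.closure (youngSimples lam)

/-- The double coset `W_λ w W_μ`. -/
def dcoset (lam mu : Lam n r) (w : W r) : Set (W r) :=
  DoubleCoset.doubleCoset w (young lam) (young mu)

/-- The set `𝒟_{λμ}` of the representatives of minimal length of the double cosets in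
`W_λ \ W / W_μ`. -/
def minReps (lam mu : Lam n r) : Set (W r) := {w | IsShortest (dcoset lam mu w) w}

/-- `∑_{x ∈ X} T_x` for a finite subset `X` of `W`. -/
noncomputable def sumT (X : Set (W r)) : Hecke r := ∑ᶠ x ∈ X, T x

/-- `x_λ = ∑_{w ∈ W_λ} T_w`. -/
noncomputable def xElt (lam : Lam n r) : Hecke r := sumT (young lam : Set (W r))

/-- The right ideal `x_λ H` of the Hecke algebra `H`. -/
noncomputable def xH (lam : Lam n r) : Submodule (Hecke r)ᵐᵒᵖ (Hecke r) :=
  Submodule.span (Hecke r)ᵐᵒᵖ {xElt lam}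

/-- The right `H`-module `⨁_λ x_λ H`. -/
abbrev TensorSpace (n r : ℕ) : Type := DirectSum (Lam n r) fun lam => xH lam

/-- The affine `q`-Schur algebra: the endomorphism algebra of the right `H`-module
`⨁_λ x_λ H`. -/
abbrev Schur (n r : ℕ) : Type := Module.End (Hecke r)ᵐᵒᵖ (TensorSpace n r)

/-- The element `m` of the summand `x_λ H`, as an element of `⨁_λ x_λ H`. -/
noncomputable abbrev incl (lam : Lam n r) (m : xH lam) : TensorSpace n r :=
  DirectSum.of (fun lam : Lam n r => xH lam) lam m

/-- The element `x_λ` of `x_λ H`. -/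
noncomputable def xGen (lam : Lam n r) : xH lam :=
  ⟨xElt lam, Submodule.mem_span_singleton_self _⟩

/-- `f` is the endomorphism `φ_{λμ}^w`:
it sends `x_ν h` to `δ_{μν} ∑_{x ∈ W_λ w W_μ} T_x h` in the summand `x_λ H`. -/
def IsPhi (lam mu : Lam n r) (w : W r) (f : Schur n r) : Prop :=
  ∀ (nu : Lam n r) (h : Hecke r) (kappa : Lam n r),
    ((f (incl nu (MulOpposite.op h • xGen nu)) kappa : xH kappa) : Hecke r) =
      if nu = mu ∧ kappa = lam then sumT (dcoset lam mu w) * h else 0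

/-- The endomorphism `φ_{λμ}^w`. For `w ∈ 𝒟_{λμ}` these are the standard basis elements. -/
noncomputable def phi (lam mu : Lam n r) (w : W r) : Schur n r :=
  Classical.epsilon (IsPhi lam mu w)

/-- The longest element `w⁺` of `W_λ w W_μ`. -/
noncomputable def wPlus (lam mu : Lam n r) (w : W r) : W r := longest (dcoset lam mu w)

/-- The longest element `w_{0,μ}` of `W_μ`. -/
noncomputable def wZero (mu : Lam n r) : W r := longest (young mu : Set (W r))

/-- The coefficients `z ↦ α_{z,w}` of `C_{w⁺} = ∑_{z ∈ 𝒟_{λμ}} α_{z,w} T_{W_λ z W_μ}`. -/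
def IsAlpha (lam mu : Lam n r) (w : W r) (al : minReps lam mu →₀ A) : Prop :=
  klC (wPlus lam mu w) = al.sum fun z a => a • sumT (dcoset lam mu z)

/-- The family of coefficients `z ↦ α_{z,w}`. -/
noncomputable def alpha (lam mu : Lam n r) (w : W r) : minReps lam mu →₀ A :=
  Classical.epsilon (IsAlpha lam mu w)

/-- The Kazhdan-Lusztig basis element
`θ_B = t^{l(w_{0,μ})} ∑_{z ∈ 𝒟_{λμ}} α_{z,w} φ_{λμ}^z` for `B = (λ, w, μ)`, `w ∈ 𝒟_{λμ}`. -/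
noncomputable def theta (lam mu : Lam n r) (w : W r) : Schur n r :=
  tpow (length (wZero mu)) • (alpha lam mu w).sum fun z a => a • phi lam mu z

/-- `β` is the bar map of the affine `q`-Schur algebra: it is additive and semilinear for
`t ↦ t⁻¹`, and for `w ∈ 𝒟_{λμ}` the endomorphism `β(φ_{λμ}^w)` sends `C_{w_{0,μ}} h` to the element
`\overline{φ_{λμ}^w(C_{w_{0,μ}})} h` of `x_λ H`, and it kills `x_ν H` for `ν ≠ μ`. -/
structure IsSchurBar (β : Schur n r → Schur n r) : Prop where
  map_add : ∀ f g, β (f + g) = β f + β g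
  map_smul : ∀ (a : A) f, β (a • f) = LaurentPolynomial.invert a • β f
  map_phi : ∀ (lam mu : Lam n r), ∀ w ∈ minReps lam mu,
    ∀ c : xH mu, (c : Hecke r) = klC (wZero mu) → ∀ (h : Hecke r) (kappa : Lam n r),
      ((β (phi lam mu w) (incl mu (MulOpposite.op h • c)) kappa : xH kappa) : Hecke r) =
        if kappa = lam then
          heckeBar r ((phi lam mu w (incl mu c) lam : xH lam) : Hecke r) * h
        else 0
  map_phi_of_ne : ∀ (lam mu : Lam n r), ∀ w ∈ minReps lam mu,
    ∀ nu : Lam n r, nu ≠ mu → ∀ m : xH nu, β (phi lam mu w) (incl nu m) = 0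

/-- The element `ω = (…, 1^r, 0^{n-r}, …)` of `Λ(n, r)`, for `r ≤ n`. -/
def omega (h : r ≤ n) : Lam n r :=
  ⟨fun i : ℤ => if (i - 1) % (n : ℤ) < (r : ℤ) then 1 else 0, by
    constructor
    · intro i
      beta_reduce
      rw [show i + (n : ℤ) - 1 = i - 1 + n by ring, Int.add_emod_right]
    · have h1 : ∀ i ∈ Finset.Icc (1 : ℤ) n,
          (if (i - 1) % (n : ℤ) < (r : ℤ) then 1 else 0) = if i ≤ (r : ℤ) then 1 else 0 := by
        intro i hi
        rw [Finset.mem_Icc] at hi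
        rw [Int.emod_eq_of_lt (by omega) (by omega)]
        congr 1
        exact propext (by omega)
      rw [Finset.sum_congr rfl h1, ← Finset.card_filter]
      have h2 : (Finset.Icc (1 : ℤ) n).filter (fun i => i ≤ (r : ℤ)) = Finset.Icc 1 (r : ℤ) := by
        ext i
        simp only [Finset.mem_filter, Finset.mem_Icc]
        omega
      rw [h2, Int.card_Icc]
      omega⟩

end AffineSchur

open AffineSchur

namespace AffineSchur

variable {r : ℕ}

/-! ### Affine transpositions -/

/-! The bar map of the affine `q`-Schur algebra is conjugation by a semilinear involution of the
module `⨁ x_λ H`. The element `C_{w_{0,λ}}` is bar invariant and equals `t^{-l(w_{0,λ})} x_λ`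
(`klC_wZero`), so the bar of `H` multiplies `x_λ` by a power of `t` and preserves `x_λ H`.
Conjugation by it (`schurBar`) is multiplicative, semilinear and of order two for formal reasons.

An endomorphism that lives in one block `x_μ H → x_λ H` is encoded by the image `d` of `x_μ`
(`IsBlock`), and conjugation replaces `d` by `t^{2 l(w_{0,μ})}` times its bar (`IsBlock.schurBar`).
The rest is read off from this rule: the formula that characterizes the bar of `φ_B`; the invariance
of `θ_B`, whose block element is `t^{l(w_{0,μ})} C_{w⁺}`; and the compatibility with `H`, where `x_ω
= 1` and the power of `t` is trivial. The map is unique because the `φ_B` span (`mem_span_phiSet`).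

Most of the work is to show that the objects exist. Reflections are affine transpositions, and the
one exchanging `a < b` shortens `w` exactly when `w b < w a` (`IsSwap.length_mul_lt_iff`); this
rests on the exchange property and replaces Coxeter theory. The `T_w` are independent because `H`
acts on the free module on `W` by operators that commute with the right multiplications, and such an
operator is determined by its value at the identity (`CommutesRight.ext`). The `C_w` come from the
classical induction, `C_s C_v` minus corrections (`IsKLCoef.exists_simple_mul`), and are unique
because the bar is triangular for the length. Finally, `T_s x = q x` says that the coefficients of
`x` agree at `y` and `s y` (`simple_mul_eq_iff`), so two-sided eigenvectors are combinations of
double coset sums; this gives the `α_{z,w}` and the span. -/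

theorem apply_add_mul (g : W r) (j k : ℤ) : g.1 (j + k * r) = g.1 j + k * r := by
  induction k using Int.induction_on with
  | zero => simp
  | succ k ih =>
    rw [show j + ((k : ℤ) + 1) * r = j + k * r + r by ring, g.2, ih]; ring
  | pred k ih =>
    have := g.2 (j + (-(k : ℤ) - 1) * r)
    rw [show j + (-(k : ℤ) - 1) * r + r = j + (-(k : ℤ)) * r by ring, ih] at this
    linarith

theorem apply_eq_of_modEq (g : W r) {a b : ℤ} (h : a ≡ b [ZMOD r]) : g.1 a = g.1 b + (a - b) := by
  obtain ⟨k, hk⟩ := h.symm.dvd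
  have : a = b + k * r := by linarith
  rw [this, apply_add_mul]; ring

theorem apply_modEq (g : W r) {a b : ℤ} (h : a ≡ b [ZMOD r]) : g.1 a ≡ g.1 b [ZMOD r] := by
  rw [apply_eq_of_modEq g h]
  have := (h.sub_right b).add_left (g.1 b)
  simpa using this

theorem mul_apply (g h : W r) (j : ℤ) : (g * h).1 j = g.1 (h.1 j) := rfl

theorem inv_apply_self (g : W r) (j : ℤ) : (g⁻¹).1 (g.1 j) = j := g.1.symm_apply_apply j

theorem apply_inv_self (g : W r) (j : ℤ) : g.1 ((g⁻¹).1 j) = j := g.1.apply_symm_apply j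

theorem W_ext {g h : W r} (H : ∀ j, g.1 j = h.1 j) : g = h := Subtype.ext (Equiv.ext H)

theorem apply_modEq_iff (g : W r) {a b : ℤ} : g.1 a ≡ g.1 b [ZMOD r] ↔ a ≡ b [ZMOD r] := by
  refine ⟨fun h => ?_, apply_modEq g⟩
  have := apply_modEq g⁻¹ h
  rwa [inv_apply_self, inv_apply_self] at this

/-- `x` is the affine transposition exchanging `a + k r` and `b + k r` for all `k`. -/
def IsSwap (a b : ℤ) (x : W r) : Prop :=
  (∀ j : ℤ, j ≡ a [ZMOD r] → x.1 j = j + (b - a)) ∧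
  (∀ j : ℤ, j ≡ b [ZMOD r] → x.1 j = j - (b - a)) ∧
  (∀ j : ℤ, ¬ j ≡ a [ZMOD r] → ¬ j ≡ b [ZMOD r] → x.1 j = j)

theorem IsSimple.isSwap {i : ℤ} {s : W r} (h : IsSimple i s) : IsSwap i (i + 1) s := by
  have e : i + 1 - i = 1 := by ring
  unfold IsSwap
  rw [e]
  exact h

theorem IsSimple.isSwap_of_modEq {i c : ℤ} {s : W r} (h : IsSimple i s) (hc : c ≡ i [ZMOD r]) :
    IsSwap c (c + 1) s := by
  have e : c + 1 - c = 1 := by ring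
  unfold IsSwap
  rw [e]
  refine ⟨fun j hj => h.1 j (hj.trans hc), fun j hj => h.2.1 j (hj.trans (hc.add_right 1)),
    fun j h1 h2 => h.2.2 j (fun h3 => h1 (h3.trans hc.symm))
      (fun h3 => h2 (h3.trans (hc.add_right 1).symm))⟩

namespace IsSwap

variable {a b : ℤ} {x y : W r}

theorem eq (hx : IsSwap a b x) (hy : IsSwap a b y) : x = y := by
  apply W_ext
  intro j
  by_cases h1 : j ≡ a [ZMOD r]
  · rw [hx.1 j h1, hy.1 j h1]
  by_cases h2 : j ≡ b [ZMOD r]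
  · rw [hx.2.1 j h2, hy.2.1 j h2]
  rw [hx.2.2 j h1 h2, hy.2.2 j h1 h2]

theorem symm (hx : IsSwap a b x) : IsSwap b a x := by
  refine ⟨fun j hj => ?_, fun j hj => ?_, fun j h1 h2 => hx.2.2 j h2 h1⟩
  · rw [hx.2.1 j hj]; ring
  · rw [hx.1 j hj]; ring

theorem apply_left (hx : IsSwap a b x) : x.1 a = b := by rw [hx.1 a rfl]; ring

theorem apply_right (hx : IsSwap a b x) : x.1 b = a := by rw [hx.2.1 b rfl]; ring

theorem conj (hx : IsSwap a b x) (g : W r) : IsSwap (g.1 a) (g.1 b) (g * x * g⁻¹) := by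
  have key : ∀ j c, j ≡ g.1 c [ZMOD r] ↔ (g⁻¹).1 j ≡ c [ZMOD r] := by
    intro j c
    rw [← apply_modEq_iff g⁻¹, inv_apply_self]
  refine ⟨fun j hj => ?_, fun j hj => ?_, fun j h1 h2 => ?_⟩
  · have h := (key _ _).1 hj
    rw [mul_apply, mul_apply, hx.1 _ h]
    have h3 : (g⁻¹).1 j + (b - a) ≡ b [ZMOD r] := by
      simpa using h.add_right (b - a)
    rw [apply_eq_of_modEq g h3]
    have h4 := apply_eq_of_modEq g h
    rw [apply_inv_self] at h4
    linarith
  · have h := (key _ _).1 hj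
    rw [mul_apply, mul_apply, hx.2.1 _ h]
    have h3 : (g⁻¹).1 j - (b - a) ≡ a [ZMOD r] := by
      simpa using h.sub_right (b - a)
    rw [apply_eq_of_modEq g h3]
    have h4 := apply_eq_of_modEq g h
    rw [apply_inv_self] at h4
    linarith
  · rw [key] at h1 h2
    rw [mul_apply, mul_apply, hx.2.2 _ h1 h2, apply_inv_self]

theorem mul_self (hx : IsSwap a b x) : x * x = 1 := by
  apply W_ext
  intro j
  rw [mul_apply]
  change _ = j
  by_cases h1 : j ≡ a [ZMOD r]
  · have h3 : j + (b - a) ≡ b [ZMOD r] := by simpa using h1.add_right (b - a)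
    rw [hx.1 j h1, hx.2.1 _ h3]; ring
  by_cases h2 : j ≡ b [ZMOD r]
  · have h3 : j - (b - a) ≡ a [ZMOD r] := by simpa using h2.sub_right (b - a)
    rw [hx.2.1 j h2, hx.1 _ h3]; ring
  rw [hx.2.2 j h1 h2, hx.2.2 j h1 h2]

end IsSwap

/-- Choosing the exchanged pair with `a < b` lets the order of `w a` and `w b` decide whether the
reflection lengthens or shortens `w`. -/
theorem IsReflection.exists_isSwap {x : W r} (hx : IsReflection x) :
    ∃ a b, a < b ∧ IsSwap a b x := by
  obtain ⟨g, s, ⟨i, hi⟩, rfl⟩ := hx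
  have h := hi.isSwap.conj g
  rcases lt_trichotomy (g.1 i) (g.1 (i + 1)) with h1 | h1 | h1
  · exact ⟨_, _, h1, h⟩
  · have := g.1.injective h1; omega
  · exact ⟨_, _, h1, h.symm⟩

theorem IsReflection.conj {x : W r} (hx : IsReflection x) (g : W r) :
    IsReflection (g * x * g⁻¹) := by
  obtain ⟨h, s, hs, rfl⟩ := hx
  exact ⟨g * h, s, hs, by group⟩

theorem isReflection_of_simple {s : W r} (hs : s ∈ simples r) : IsReflection s :=
  ⟨1, s, hs, by group⟩

theorem IsReflection.mul_self {x : W r} (hx : IsReflection x) : x * x = 1 := by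
  obtain ⟨a, b, -, h⟩ := hx.exists_isSwap
  exact h.mul_self

theorem IsReflection.inv {x : W r} (hx : IsReflection x) : x⁻¹ = x :=
  inv_eq_of_mul_eq_one_left hx.mul_self

theorem simple_mul_self {s : W r} (hs : s ∈ simples r) : s * s = 1 :=
  (isReflection_of_simple hs).mul_self

/-- A simple reflection which reverses the order of `c < d` is the transposition of `c` and `d`. -/
theorem isSwap_of_simple_lt {s : W r} (hs : s ∈ simples r) {c d : ℤ} (h : c < d)
    (h' : s.1 d < s.1 c) : IsSwap c d s := by
  obtain ⟨i, hi⟩ := hs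
  -- Since `s` moves integers by at most one, only an adjacent pair can be reversed.
  have lower : ∀ j, j - 1 ≤ s.1 j := by
    intro j
    by_cases h1 : j ≡ i [ZMOD r]
    · rw [hi.1 j h1]; omega
    by_cases h2 : j ≡ i + 1 [ZMOD r]
    · rw [hi.2.1 j h2]
    rw [hi.2.2 j h1 h2]; omega
  by_cases h1 : c ≡ i [ZMOD r]
  · have e1 := hi.1 c h1
    have e2 := lower d
    have : d = c + 1 := by omega
    rw [this]
    exact hi.isSwap_of_modEq h1
  · exfalso
    have e1 : s.1 c ≤ c := by
      by_cases h2 : c ≡ i + 1 [ZMOD r]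
      · rw [hi.2.1 c h2]; omega
      · rw [hi.2.2 c h1 h2]
    have e2 := lower d
    have e3 : s.1 c = s.1 d + 1 ∨ s.1 c = s.1 d := by omega
    have e4 : s.1 c = c := by omega
    omega

/-! ### The exchange property and words -/

/-- The exchange property, for words in the simple reflections. -/
theorem exists_sublist_of_swap {L : List (W r)} (hL : ∀ s ∈ L, s ∈ simples r) {a b : ℤ} {t : W r}
    (hab : a < b) (ht : IsSwap a b t) (h : L.prod.1 b < L.prod.1 a) :
    ∃ L' : List (W r), L'.Sublist L ∧ L'.length + 1 = L.length ∧ L.prod * t = L'.prod := by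
  induction L with
  | nil =>
    change b < a at h
    omega
  | cons s L ih =>
    rw [List.prod_cons, mul_apply, mul_apply] at h
    -- Read from the right, the word first reverses `a < b` at some letter, and this letter is
    -- deleted. If it is the head `s`, then `s` is the conjugate of `t` by the product of the tail.
    rcases lt_or_ge (L.prod.1 b) (L.prod.1 a) with h1 | h1
    · obtain ⟨L', hs, hl, hp⟩ := ih (fun s hs => hL s (by simp [hs])) h1
      exact ⟨s :: L', hs.cons_cons s, by simp [hl], by
        rw [List.prod_cons, List.prod_cons, mul_assoc, hp]⟩
    · have h2 : L.prod.1 a < L.prod.1 b := by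
        refine lt_of_le_of_ne h1 fun e => ?_
        have := L.prod.1.injective e
        omega
      have hs := hL s (by simp)
      have h3 := (isSwap_of_simple_lt hs h2 h).eq (ht.conj L.prod)
      refine ⟨L, List.sublist_cons_self s L, rfl, ?_⟩
      have h4 := simple_mul_self hs
      have h5 : L.prod * t = s * L.prod := by rw [h3]; group
      rw [List.prod_cons, mul_assoc, h5, ← mul_assoc, h4, one_mul]

/-- Moving the window by one replaces `f c` by `f (c + r)`. This allows a sum over a period to start
at any convenient place. -/
theorem sum_range_periodic {f : ℤ → ℤ} (hf : ∀ j, f (j + r) = f j) (c : ℤ) :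
    ∑ k ∈ Finset.range r, f (c + k) = ∑ k ∈ Finset.range r, f k := by
  have step : ∀ c : ℤ, ∑ k ∈ Finset.range r, f (c + 1 + k) = ∑ k ∈ Finset.range r, f (c + k) := by
    intro c
    have h1 := Finset.sum_range_succ (fun k : ℕ => f (c + k)) r
    have h2 := Finset.sum_range_succ' (fun k : ℕ => f (c + k)) r
    rw [h1] at h2
    have h3 : ∀ k : ℕ, f (c + ((k + 1 : ℕ) : ℤ)) = f (c + 1 + k) := fun k => by
      congr 1; push_cast; ring
    simp only [h3, hf, Nat.cast_zero, add_zero] at h2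
    linarith
  induction c using Int.induction_on with
  | zero => simp
  | succ k ih => rw [step, ih]
  | pred k ih =>
    rw [← ih, ← step (-(k : ℤ) - 1)]
    simp

/-- The sum of the squares of the displacements of `w`; it measures how far `w` is from a shift. -/
def displacement (w : W r) : ℤ := ∑ k ∈ Finset.range r, (w.1 k - k) ^ 2

theorem displacement_eq (w : W r) (c : ℤ) :
    displacement w = ∑ k ∈ Finset.range r, (w.1 (c + k) - (c + k)) ^ 2 := by
  have := sum_range_periodic (r := r) (f := fun j => (w.1 j - j) ^ 2)
    (fun j => by rw [w.2]; ring) c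
  exact this.symm

theorem displacement_nonneg (w : W r) : 0 ≤ displacement w :=
  Finset.sum_nonneg fun _ _ => sq_nonneg _

theorem exists_isSimple (hr : 2 ≤ r) (i : ℤ) : ∃ s : W r, IsSimple i s := by
  classical
  let f : ℤ → ℤ := fun j => if j ≡ i [ZMOD r] then j + 1 else if j ≡ i + 1 [ZMOD r] then j - 1 else j
  have h01 : ¬ i + 1 ≡ i [ZMOD r] := by
    intro h
    have := h.symm.dvd
    rw [add_sub_cancel_left] at this
    have := Int.le_of_dvd one_pos this
    omega
  have hf1 : ∀ j, j ≡ i [ZMOD r] → f j = j + 1 := fun j h => if_pos h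
  have hf2 : ∀ j, j ≡ i + 1 [ZMOD r] → f j = j - 1 := fun j h => by
    have h1 : ¬ j ≡ i [ZMOD r] := fun h' => h01 (h.symm.trans h')
    simp only [f, if_neg h1, if_pos h]
  have hf3 : ∀ j, ¬ j ≡ i [ZMOD r] → ¬ j ≡ i + 1 [ZMOD r] → f j = j := fun j h1 h2 => by
    simp only [f, if_neg h1, if_neg h2]
  have hinv : Function.Involutive f := by
    intro j
    by_cases h1 : j ≡ i [ZMOD r]
    · rw [hf1 j h1, hf2 _ (h1.add_right 1)]; ring
    by_cases h2 : j ≡ i + 1 [ZMOD r]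
    · rw [hf2 j h2, hf1 _ (by simpa using h2.sub_right 1)]; ring
    rw [hf3 j h1 h2, hf3 j h1 h2]
  have hm : ∀ j c : ℤ, j + r ≡ c [ZMOD r] ↔ j ≡ c [ZMOD r] := fun j c => by
    simp [Int.ModEq]
  refine ⟨⟨hinv.toPerm, fun j => ?_⟩, hf1, hf2, hf3⟩
  change f (j + r) = f j + r
  by_cases h1 : j ≡ i [ZMOD r]
  · rw [hf1 j h1, hf1 _ ((hm _ _).2 h1)]; ring
  by_cases h2 : j ≡ i + 1 [ZMOD r]
  · rw [hf2 j h2, hf2 _ ((hm _ _).2 h2)]; ring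
  rw [hf3 j h1 h2, hf3 _ (mt (hm _ _).1 h1) (mt (hm _ _).1 h2)]

/-- In the window that starts at `i`, only the first two terms change, and their sum drops by `2 (w
i - w (i + 1))`. -/
theorem displacement_mul_simple_lt (hr : 2 ≤ r) {i : ℤ} {s w : W r} (hs : IsSimple i s)
    (h : w.1 (i + 1) < w.1 i) : displacement (w * s) < displacement w := by
  obtain ⟨m, rfl⟩ : ∃ m, r = m + 2 := ⟨r - 2, by omega⟩
  rw [displacement_eq _ i, displacement_eq w i, Finset.sum_range_succ', Finset.sum_range_succ',
    Finset.sum_range_succ', Finset.sum_range_succ']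
  have e : ∀ k ∈ Finset.range m, ((w * s).1 (i + ((k + 1 + 1 : ℕ) : ℤ)) - (i + ((k + 1 + 1 : ℕ) : ℤ))) ^ 2
      = (w.1 (i + ((k + 1 + 1 : ℕ) : ℤ)) - (i + ((k + 1 + 1 : ℕ) : ℤ))) ^ 2 := by
    intro k hk
    rw [Finset.mem_range] at hk
    rw [mul_apply, hs.2.2]
    · intro hc
      have := hc.symm.dvd
      rw [add_sub_cancel_left] at this
      have := Int.le_of_dvd (by omega) this
      omega
    · intro hc
      have := hc.symm.dvd
      rw [show i + ((k + 1 + 1 : ℕ) : ℤ) - (i + 1) = (k : ℤ) + 1 by push_cast; ring] at this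
      have := Int.le_of_dvd (by omega) this
      omega
  rw [Finset.sum_congr rfl e]
  have e1 : (w * s).1 (i + ((0 : ℕ) : ℤ)) = w.1 (i + 1) := by
    rw [mul_apply, hs.1 _ (by simp)]; simp
  have e2 : (w * s).1 (i + ((0 + 1 : ℕ) : ℤ)) = w.1 i := by
    rw [mul_apply, hs.2.1 _ (by simp)]; simp
  rw [e1, e2]
  simp only [Nat.cast_zero, add_zero, zero_add, Nat.cast_one]
  nlinarith

/-- The function `w j - j` is weakly increasing and periodic, hence constant. -/
theorem eq_rho_zpow_of_forall_lt [NeZero r] {w : W r} (h : ∀ i, w.1 i < w.1 (i + 1)) :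
    ∃ a : ℤ, w = rho r ^ a := by
  have hmono : Monotone fun j => w.1 j - j := monotone_int_of_le_succ fun j => by
    have := h j
    show w.1 j - j ≤ w.1 (j + 1) - (j + 1)
    omega
  have hr : (1 : ℤ) ≤ r := by exact_mod_cast NeZero.one_le
  have hper : ∀ k : ℤ, w.1 (k * r) - k * r = w.1 0 := by
    intro k
    have := apply_add_mul w 0 k
    rw [zero_add] at this
    omega
  refine ⟨w.1 0, W_ext fun j => ?_⟩
  rw [rho_zpow_apply]
  -- Enclose `j` between two multiples of `r`, where the function takes its value at `0`.
  have h1 : j ≤ |j| * r := by nlinarith [le_abs_self j, abs_nonneg j]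
  have h2 : (-|j|) * r ≤ j := by nlinarith [neg_abs_le j, abs_nonneg j]
  have h3 := hmono h1
  have h4 := hmono h2
  simp only [hper] at h3 h4
  omega

/-- Sorting adjacent descents lowers the displacement until a shift remains. The result guarantees
that the infimum defining `length` is attained and is not the default value of an empty set. -/
theorem exists_hasWord [NeZero r] (w : W r) : ∃ k, HasWord w k := by
  induction hn : (displacement w).toNat using Nat.strong_induction_on generalizing w with
  | _ n ih =>
    by_cases h : ∀ i, w.1 i < w.1 (i + 1)
    · obtain ⟨a, ha⟩ := eq_rho_zpow_of_forall_lt h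
      exact ⟨0, [], by simp, rfl, a, by simpa using ha⟩
    · push Not at h
      obtain ⟨i, hi⟩ := h
      have hi' : w.1 (i + 1) < w.1 i := lt_of_le_of_ne hi fun e => by
        have := w.1.injective e; omega
      have hr : 2 ≤ r := by
        by_contra hc
        have h1 : r = 1 := by
          have : 1 ≤ r := NeZero.one_le
          omega
        subst h1
        have := w.2 i
        simp only [Nat.cast_one] at this
        omega
      obtain ⟨s, hs⟩ := exists_isSimple hr i
      have hlt := displacement_mul_simple_lt hr hs hi'
      have h0 := displacement_nonneg (w * s)
      obtain ⟨k, L, hL, hk, a, ha⟩ := ih _ (by omega) (w * s) rfl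
      -- The new letter has to stand to the left of the power of `ρ`, so it is conjugated by that
      -- power.
      refine ⟨k + 1, L ++ [rho r ^ a * s * (rho r ^ a)⁻¹], ?_, by simp [hk], a, ?_⟩
      · intro x hx
        rcases List.mem_append.1 hx with hx | hx
        · exact hL x hx
        · rw [List.mem_singleton.1 hx]
          exact simple_conj ⟨i, hs⟩ a
      · rw [List.prod_append, List.prod_singleton]
        have : w = (w * s) * s := by rw [mul_assoc, hs.mul_self, mul_one]
        rw [this, ha]
        group

theorem length_le_of_hasWord {w : W r} {k : ℕ} (h : HasWord w k) : length w ≤ k := Nat.sInf_le h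

theorem hasWord_length [NeZero r] (w : W r) : HasWord w (length w) :=
  Nat.sInf_mem (s := {k | HasWord w k}) (exists_hasWord w)

theorem HasWord.mul {u v : W r} {k l : ℕ} (hu : HasWord u k) (hv : HasWord v l) :
    HasWord (u * v) (k + l) := by
  obtain ⟨L, hL, rfl, a, rfl⟩ := hu
  obtain ⟨L', hL', rfl, b, rfl⟩ := hv
  refine ⟨L ++ L'.map fun s => MulAut.conj (rho r ^ a) s, ?_, by simp, a + b, ?_⟩
  · intro s hs
    rcases List.mem_append.1 hs with hs | hs
    · exact hL s hs
    · obtain ⟨s', hs', rfl⟩ := List.mem_map.1 hs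
      exact simple_conj (hL' s' hs') a
  · rw [List.prod_append, ← map_list_prod, MulAut.conj_apply, zpow_add]
    group

theorem length_mul_le [NeZero r] (u v : W r) : length (u * v) ≤ length u + length v :=
  length_le_of_hasWord ((hasWord_length u).mul (hasWord_length v))

/-- Apply the exchange property to a shortest word. The power of `ρ` at its end preserves order, so
it carries `a < b` to a pair that the word itself reverses. -/
theorem length_mul_swap_lt [NeZero r] {w t : W r} {a b : ℤ} (hab : a < b) (ht : IsSwap a b t)
    (h : w.1 b < w.1 a) : length (w * t) < length w := by
  obtain ⟨L, hL, hk, m, hm⟩ := hasWord_length w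
  have h1 : (rho r ^ m).1 a < (rho r ^ m).1 b := by
    rw [rho_zpow_apply, rho_zpow_apply]; omega
  have h2 := h
  rw [hm, mul_apply, mul_apply] at h2
  obtain ⟨L', hsub, hlen, hp⟩ := exists_sublist_of_swap hL h1 (ht.conj _) h2
  have : HasWord (w * t) L'.length := by
    refine ⟨L', fun s hs => hL s (hsub.subset hs), rfl, m, ?_⟩
    rw [← hp, hm]; group
  have := length_le_of_hasWord this
  omega

theorem IsSwap.lt_length_mul [NeZero r] {w t : W r} {a b : ℤ} (hab : a < b) (ht : IsSwap a b t)
    (h : w.1 a < w.1 b) : length w < length (w * t) := by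
  have h1 : (w * t).1 b < (w * t).1 a := by
    rwa [mul_apply, mul_apply, ht.apply_left, ht.apply_right]
  have := length_mul_swap_lt hab ht h1
  rwa [mul_assoc, ht.mul_self, mul_one] at this

/-- This turns comparisons of lengths into inequalities between integers; the later facts on
descents rest on it. -/
theorem IsSwap.length_mul_lt_iff [NeZero r] {w t : W r} {a b : ℤ} (hab : a < b)
    (ht : IsSwap a b t) : length (w * t) < length w ↔ w.1 b < w.1 a := by
  refine ⟨fun h => ?_, length_mul_swap_lt hab ht⟩
  by_contra hc
  have h1 : w.1 a < w.1 b := lt_of_le_of_ne (not_lt.1 hc) fun e => by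
    have := w.1.injective e; omega
  have := ht.lt_length_mul hab h1
  omega

theorem IsSwap.lt_length_mul_iff [NeZero r] {w t : W r} {a b : ℤ} (hab : a < b)
    (ht : IsSwap a b t) : length w < length (w * t) ↔ w.1 a < w.1 b := by
  refine ⟨fun h => ?_, ht.lt_length_mul hab⟩
  by_contra hc
  have h1 : w.1 b < w.1 a := lt_of_le_of_ne (not_lt.1 hc) fun e => by
    have := w.1.injective e; omega
  have := length_mul_swap_lt hab ht h1
  omega

/-! ### Lengths and reflections -/

section Length

variable [NeZero r] {s t u v w : W r}

/-- An injective `w` must either preserve or reverse the exchanged pair. This does the work of a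
parity argument. -/
theorem IsReflection.length_mul_ne (ht : IsReflection t) (w : W r) :
    length (w * t) ≠ length w := by
  obtain ⟨a, b, hab, h⟩ := ht.exists_isSwap
  rcases lt_trichotomy (w.1 a) (w.1 b) with h1 | h1 | h1
  · exact (h.lt_length_mul hab h1).ne'
  · have := w.1.injective h1; omega
  · exact (length_mul_swap_lt hab h h1).ne

theorem length_mul_lt_of_not_lt (ht : IsReflection t) (h : ¬ length w < length (w * t)) :
    length (w * t) < length w := by
  have := ht.length_mul_ne w
  omega

/-- If the reflection `t` shortens `u v`, it shortens `v` or its conjugate by `v` shortens `u`. -/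
theorem length_mul_reflection_lt (ht : IsReflection t) (h : length (u * v * t) < length (u * v)) :
    length (v * t) < length v ∨ length (u * (v * t * v⁻¹)) < length u := by
  obtain ⟨a, b, hab, hsw⟩ := ht.exists_isSwap
  rw [hsw.length_mul_lt_iff hab] at h ⊢
  by_cases h1 : v.1 b < v.1 a
  · exact Or.inl h1
  · have h2 : v.1 a < v.1 b := lt_of_le_of_ne (not_lt.1 h1) fun e => by
      have := v.1.injective e; omega
    exact Or.inr (((hsw.conj v).length_mul_lt_iff h2).2 h)

/-- A simple reflection preserves the relation `w < w t` unless `w t = s w`. -/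
theorem simple_mul_lt_or_eq (hs : s ∈ simples r) (ht : IsReflection t)
    (h : length w < length (w * t)) : length (s * w) < length (s * w * t) ∨ s * w = w * t := by
  obtain ⟨a, b, hab, hsw⟩ := ht.exists_isSwap
  rw [hsw.lt_length_mul_iff hab] at h ⊢
  rw [mul_apply, mul_apply]
  by_cases h1 : s.1 (w.1 a) < s.1 (w.1 b)
  · exact Or.inl h1
  · right
    have h2 : s.1 (w.1 b) < s.1 (w.1 a) := lt_of_le_of_ne (not_lt.1 h1) fun e => by
      have := w.1.injective (s.1.injective e); omega
    rw [(isSwap_of_simple_lt hs h h2).eq (hsw.conj w)]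
    group

theorem length_mul_simple (hs : s ∈ simples r) (w : W r) :
    length (w * s) = length w + 1 ∨ length w = length (w * s) + 1 := by
  have h1 := length_mul_le w s
  have h2 := length_mul_le (w * s) s
  rw [mul_assoc, simple_mul_self hs, mul_one] at h2
  rw [length_simple hs] at h1 h2
  have := (isReflection_of_simple hs).length_mul_ne w
  omega

theorem length_simple_mul (hs : s ∈ simples r) (w : W r) :
    length (s * w) = length w + 1 ∨ length w = length (s * w) + 1 := by
  have := length_mul_simple hs w⁻¹
  rwa [length_inv, ← length_inv (w⁻¹ * s), mul_inv_rev, inv_inv, inv_of_simple hs] at this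

theorem length_mul_of_length_eq_zero_left (hu : length u = 0) (w : W r) :
    length (u * w) = length w := by
  have h1 := length_mul_le u w
  have h2 := length_mul_le u⁻¹ (u * w)
  rw [inv_mul_cancel_left, length_inv] at h2
  omega

theorem length_mul_of_length_eq_zero_right (hu : length u = 0) (w : W r) :
    length (w * u) = length w := by
  rw [← length_inv, mul_inv_rev, length_mul_of_length_eq_zero_left (by rw [length_inv, hu]),
    length_inv]

/-- Left and right multiplication by simple reflections have independent effects on the length,
unless they agree. -/
theorem length_simple_mul_mul_lt_iff (hs : s ∈ simples r) (ht : t ∈ simples r)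
    (h : s * w ≠ w * t) :
    length (s * w) < length (s * w * t) ↔ length w < length (w * t) := by
  constructor
  · intro h1
    rcases simple_mul_lt_or_eq hs (isReflection_of_simple ht) h1 with h2 | h2
    · rwa [← mul_assoc, simple_mul_self hs, one_mul] at h2
    · exfalso
      rw [← mul_assoc, simple_mul_self hs, one_mul] at h2
      apply h
      calc s * w = s * w * t * t := by rw [mul_assoc _ t t, simple_mul_self ht, mul_one]
        _ = w * t := by rw [← h2]
  · intro h1
    exact (simple_mul_lt_or_eq hs (isReflection_of_simple ht) h1).resolve_right h

theorem length_mul_simple_mul_lt_iff (hs : s ∈ simples r) (ht : t ∈ simples r)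
    (h : s * w ≠ w * t) :
    length (w * t) < length (s * w * t) ↔ length w < length (s * w) := by
  have := length_simple_mul_mul_lt_iff (w := w⁻¹) ht hs (fun e => h ?_)
  · rw [← length_inv (t * w⁻¹ * s), ← length_inv (t * w⁻¹), ← length_inv (w⁻¹ * s)] at this
    simpa [mul_inv_rev, inv_of_simple hs, inv_of_simple ht, mul_assoc, length_inv] using this
  · have := congrArg (fun x => x⁻¹) e
    simp only [mul_inv_rev, inv_inv, inv_of_simple hs, inv_of_simple ht] at this
    exact this.symm

end Length

/-! ### The Bruhat order -/

section Bruhat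

variable {s u v w y z : W r}

theorem BruhatLE.refl (w : W r) : BruhatLE w w := Relation.ReflTransGen.refl

theorem BruhatLE.trans (h : BruhatLE u v) (h' : BruhatLE v w) : BruhatLE u w :=
  Relation.ReflTransGen.trans h h'

theorem BruhatLE.eq_or_length_lt (h : BruhatLE y w) : y = w ∨ length y < length w := by
  induction h with
  | refl => exact Or.inl rfl
  | tail _ h ih =>
    obtain ⟨x, -, -, hl⟩ := h
    rcases ih with rfl | ih
    · exact Or.inr hl
    · exact Or.inr (ih.trans hl)

/-- A step by `x` on the right of `u` becomes, after inversion, a step by the conjugate `u x u⁻¹`.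
-/
theorem BruhatLE.inv (h : BruhatLE y w) : BruhatLE y⁻¹ w⁻¹ := by
  induction h with
  | refl => exact BruhatLE.refl _
  | @tail u v _ h ih =>
    obtain ⟨x, hx, rfl, hl⟩ := h
    refine Relation.ReflTransGen.tail ih ⟨u * x * u⁻¹, hx.conj u, ?_, ?_⟩
    · rw [mul_inv_rev, hx.inv]; group
    · rwa [length_inv, length_inv]

theorem bruhatLE_simple_mul (hs : s ∈ simples r) (h : length w < length (s * w)) :
    BruhatLE w (s * w) :=
  Relation.ReflTransGen.single ⟨w⁻¹ * s * w, by
    simpa using (isReflection_of_simple hs).conj w⁻¹, by group, h⟩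

/-- The lifting property of the Bruhat order. -/
theorem BruhatLE.simple_mul [NeZero r] (hs : s ∈ simples r) (h : BruhatLE z v)
    (hv : length v < length (s * v)) : BruhatLE (s * z) (s * v) := by
  -- Follow a chain from `z` to `v`. Left multiplication by `s` preserves a step `u < u x` unless `s
  -- u = u x`, and then `s z` is already below the chain. The length hypothesis serves only
  -- afterwards, to pass from `v` up to `s v`.
  have key : ∀ v, BruhatLE z v → BruhatLE (s * z) (s * v) ∨ BruhatLE (s * z) v := by
    intro v h
    induction h with
    | refl => exact Or.inl (BruhatLE.refl _)
    | @tail u v _ h ih =>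
      obtain ⟨x, hx, rfl, hl⟩ := h
      rcases ih with ih | ih
      · rcases simple_mul_lt_or_eq hs hx hl with h1 | h1
        · exact Or.inl (ih.tail ⟨x, hx, by group, by rwa [← mul_assoc]⟩)
        · right; rwa [← h1]
      · exact Or.inr (ih.tail ⟨x, hx, rfl, hl⟩)
  rcases key v h with h1 | h1
  · exact h1
  · exact h1.trans (bruhatLE_simple_mul hs hv)

end Bruhat

/-! ### Parabolic subgroups -/

section Parabolic

variable {I J : Set (W r)} {s t x y z d : W r}

theorem exists_list_of_mem_closure (hI : I ⊆ simples r) (hx : x ∈ Subgroup.closure I) :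
    ∃ L : List (W r), (∀ s ∈ L, s ∈ I) ∧ L.prod = x := by
  induction hx using Subgroup.closure_induction with
  | mem s hs => exact ⟨[s], by simpa using hs, by simp⟩
  | one => exact ⟨[], by simp, rfl⟩
  | mul x y _ _ hx hy =>
    obtain ⟨L, hL, rfl⟩ := hx
    obtain ⟨L', hL', rfl⟩ := hy
    exact ⟨L ++ L', fun s hs => (List.mem_append.1 hs).elim (hL s) (hL' s), by simp⟩
  | inv x _ hx =>
    obtain ⟨L, hL, rfl⟩ := hx
    refine ⟨L.reverse, by simpa using hL, ?_⟩
    have : L.map (fun s => s⁻¹) = L := by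
      conv_rhs => rw [← List.map_id L]
      exact List.map_congr_left fun s hs => inv_of_simple (hI (hL s hs))
    rw [List.prod_inv_reverse, this]

theorem list_prod_mem_closure {L : List (W r)} (hL : ∀ s ∈ L, s ∈ I) :
    L.prod ∈ Subgroup.closure I :=
  Subgroup.list_prod_mem _ fun s hs => Subgroup.subset_closure (hL s hs)

theorem exists_isShortest {X : Set (W r)} (hX : X.Nonempty) : ∃ x, IsShortest X x := by
  obtain ⟨x, hx, hmin⟩ := (measure (length (r := r))).wf.has_min X hX
  exact ⟨x, hx, fun y hy => not_lt.1 (hmin y hy)⟩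

theorem exists_isLongest {X : Set (W r)} (hX : X.Nonempty) (hf : X.Finite) :
    ∃ x, IsLongest X x := by
  obtain ⟨x, hx, hmax⟩ := Set.exists_max_image X length hf hX
  exact ⟨x, hx, hmax⟩

variable [NeZero r]

/-- The exchange property only deletes a letter from a word in `I`. So the parabolic subgroup is
closed downwards in the Bruhat order. -/
theorem mul_reflection_mem_closure (hI : I ⊆ simples r) (hx : x ∈ Subgroup.closure I)
    (ht : IsReflection t) (h : length (x * t) < length x) : x * t ∈ Subgroup.closure I := by
  obtain ⟨L, hL, rfl⟩ := exists_list_of_mem_closure hI hx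
  obtain ⟨a, b, hab, hsw⟩ := ht.exists_isSwap
  rw [hsw.length_mul_lt_iff hab] at h
  obtain ⟨L', hsub, -, hp⟩ := exists_sublist_of_swap (fun s hs => hI (hL s hs)) hab hsw h
  rw [hp]
  exact list_prod_mem_closure fun s hs => hL s (hsub.subset hs)

theorem BruhatLE.mem_closure (hI : I ⊆ simples r) (h : BruhatLE y x)
    (hx : x ∈ Subgroup.closure I) : y ∈ Subgroup.closure I := by
  induction h with
  | refl => exact hx
  | @tail u v _ h ih =>
    obtain ⟨t, ht, rfl, hl⟩ := h
    apply ih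
    have e : u * t * t = u := by rw [mul_assoc, ht.mul_self, mul_one]
    have := mul_reflection_mem_closure hI hx ht (by rwa [e])
    rwa [e] at this

/-- A nontrivial element of a parabolic subgroup has a right descent in it. -/
theorem exists_descent_of_mem_closure (hI : I ⊆ simples r) (hx : x ∈ Subgroup.closure I)
    (h1 : x ≠ 1) : ∃ s ∈ I, length (x * s) < length x := by
  obtain ⟨L, hL, rfl⟩ := exists_list_of_mem_closure hI hx
  -- The word need not be reduced. If its last letter is not a descent, exchange applied to the rest
  -- of the word produces a word two letters shorter for the same element.
  induction hn : L.length using Nat.strong_induction_on generalizing L with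
  | _ n ih =>
    rcases List.eq_nil_or_concat L with rfl | ⟨L', s, rfl⟩
    · exact absurd rfl h1
    · rw [List.concat_eq_append] at *
      have hs : s ∈ I := hL s (by simp)
      have hL' : ∀ s ∈ L', s ∈ I := fun s hs => hL s (by simp [hs])
      have hp : (L' ++ [s]).prod = L'.prod * s := by simp
      by_cases hlt : length ((L' ++ [s]).prod * s) < length (L' ++ [s]).prod
      · exact ⟨s, hs, hlt⟩
      · obtain ⟨a, b, hab, hsw⟩ := (isReflection_of_simple (hI hs)).exists_isSwap
        rw [hp, mul_assoc, simple_mul_self (hI hs), mul_one] at hlt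
        have hlt' : length (L'.prod * s) < length L'.prod := by
          have := (isReflection_of_simple (hI hs)).length_mul_ne L'.prod
          omega
        rw [hsw.length_mul_lt_iff hab] at hlt'
        obtain ⟨L'', hsub, hlen, hp'⟩ :=
          exists_sublist_of_swap (fun s hs => hI (hL' s hs)) hab hsw hlt'
        have e : (L' ++ [s]).prod = L''.prod := by rw [hp, hp']
        rw [List.length_append, List.length_singleton] at hn
        have hL'' : ∀ s ∈ L'', s ∈ I := fun s hs => hL' s (hsub.subset hs)
        rw [e] at h1 ⊢
        exact ih L''.length (by omega) L'' hL'' (list_prod_mem_closure hL'') h1 rfl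

/-- If `d` is shortest in `d W_I`, lengths add in the products of `d` by elements of `W_I`. -/
theorem length_mul_of_shortest (hI : I ⊆ simples r)
    (hd : ∀ y ∈ Subgroup.closure I, length d ≤ length (d * y)) (hx : x ∈ Subgroup.closure I) :
    length (d * x) = length d + length x := by
  induction hn : length x using Nat.strong_induction_on generalizing x with
  | _ n ih =>
    by_cases h1 : x = 1
    · subst h1; rw [length_one] at hn; rw [mul_one]; omega
    · obtain ⟨s, hs, hlt⟩ := exists_descent_of_mem_closure hI hx h1
      have hsm := Subgroup.subset_closure (k := I) hs
      have hs' := hI hs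
      have hy : x * s ∈ Subgroup.closure I := mul_mem hx hsm
      have ih' := ih _ (by omega) hy rfl
      have hxs : x * s * s = x := by rw [mul_assoc, simple_mul_self hs', mul_one]
      have hle := length_mul_le d x
      rcases length_mul_simple hs' x with h2 | h2
      · omega
      rcases length_mul_simple hs' (d * (x * s)) with h3 | h3
      · rw [mul_assoc, hxs] at h3
        omega
      · exfalso
        -- A drop in length would come either from `x s`, which `s` lengthens, or from a reflection
        -- of the parabolic subgroup that shortens `d`.
        rcases length_mul_reflection_lt (u := d) (v := x * s) (isReflection_of_simple hs')
          (by omega) with h4 | h4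
        · rw [hxs] at h4; omega
        · have := hd (x * s * s * (x * s)⁻¹) (mul_mem (mul_mem hy hsm) (inv_mem hy))
          omega

theorem length_mul_of_shortest' (hI : I ⊆ simples r)
    (hd : ∀ y ∈ Subgroup.closure I, length d ≤ length (y * d)) (hx : x ∈ Subgroup.closure I) :
    length (x * d) = length x + length d := by
  have := length_mul_of_shortest (d := d⁻¹) hI (fun y hy => ?_) (inv_mem hx)
  · rw [← mul_inv_rev, length_inv, length_inv, length_inv] at this
    omega
  · have := hd y⁻¹ (inv_mem hy)
    rwa [← length_inv (y⁻¹ * d), mul_inv_rev, inv_inv, ← length_inv d] at this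

/-- Remove the letters of `x` from the left. A left descent `s` of `x` shortens `d y`; it cannot
shorten `d`, so it acts as a reflection that shortens `y` inside `W_J`, and the induction continues.
Once `x = 1`, comparing lengths gives `y = 1`. -/
theorem eq_of_shortest_aux (hI : I ⊆ simples r) (hJ : J ⊆ simples r)
    (hz : ∀ x ∈ Subgroup.closure I, length z ≤ length (x * z))
    (hd : ∀ x ∈ Subgroup.closure I, length d ≤ length (x * d))
    (hd' : ∀ y ∈ Subgroup.closure J, length d ≤ length (d * y))
    (hzd : length z = length d)
    (hx : x ∈ Subgroup.closure I) (hy : y ∈ Subgroup.closure J) (h : x * z = d * y) : z = d := by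
  induction hn : length x using Nat.strong_induction_on generalizing x y with
  | _ n ih =>
    have e1 := length_mul_of_shortest' hI hz hx
    have e2 := length_mul_of_shortest hJ hd' hy
    by_cases h1 : x = 1
    · subst h1
      have hy0 : y = 1 := by
        by_contra hc
        obtain ⟨s, -, hs⟩ := exists_descent_of_mem_closure hJ hy hc
        rw [h] at e1
        rw [length_one] at e1
        omega
      rw [hy0, one_mul, mul_one] at h
      exact h
    · obtain ⟨s, hs, hlt⟩ := exists_descent_of_mem_closure hI (inv_mem hx) (inv_ne_one.2 h1)
      have hs' := hI hs
      have hsm := Subgroup.subset_closure (k := I) hs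
      rw [length_inv, ← length_inv, mul_inv_rev, inv_inv, inv_of_simple hs'] at hlt
      have e3 := length_mul_of_shortest' hI hz (mul_mem hsm hx)
      -- the reflection `t` with `s x z = x z t`
      set t := (d * y)⁻¹ * s * (d * y) with ht
      have htr : IsReflection t := by
        have := (isReflection_of_simple hs').conj (d * y)⁻¹
        rwa [inv_inv] at this
      have e4 : d * y * t = s * (x * z) := by rw [ht, h]; group
      have e5 : d * (y * t * y⁻¹) = s * d := by rw [ht]; group
      rcases length_mul_reflection_lt (u := d) (v := y) htr
        (by rw [e4, ← h, ← mul_assoc]; omega) with h4 | h4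
      · refine ih (length (s * x)) (by omega) (mul_mem hsm hx)
          (mul_reflection_mem_closure hJ hy htr h4) ?_ rfl
        rw [← mul_assoc, e4, mul_assoc]
      · rw [e5] at h4
        have := hd s hsm
        omega

/-- A double coset of parabolic subgroups has only one element of minimal length. -/
theorem IsShortest.eq_of_doubleCoset (hI : I ⊆ simples r) (hJ : J ⊆ simples r)
    (hz : IsShortest (DoubleCoset.doubleCoset z (Subgroup.closure I) (Subgroup.closure J)) z)
    (hd : IsShortest (DoubleCoset.doubleCoset d (Subgroup.closure I) (Subgroup.closure J)) d)
    (h : z ∈ DoubleCoset.doubleCoset d (Subgroup.closure I) (Subgroup.closure J)) : z = d := by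
  have e := DoubleCoset.doubleCoset_eq_of_mem h
  have h1 := hd.2 z h
  have h2 := hz.2 d (by rw [e]; exact hd.1)
  have left : ∀ w x : W r, x ∈ Subgroup.closure I →
      x * w ∈ DoubleCoset.doubleCoset w (Subgroup.closure I) (Subgroup.closure J) :=
    fun w x hx => DoubleCoset.mem_doubleCoset.2 ⟨x, hx, 1, one_mem _, by simp⟩
  have right : ∀ w x : W r, x ∈ Subgroup.closure J →
      w * x ∈ DoubleCoset.doubleCoset w (Subgroup.closure I) (Subgroup.closure J) :=
    fun w x hx => DoubleCoset.mem_doubleCoset.2 ⟨1, one_mem _, x, hx, by simp⟩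
  obtain ⟨x, hx, y, hy, hxy⟩ := DoubleCoset.mem_doubleCoset.1 h
  refine eq_of_shortest_aux hI hJ (fun x hx => hz.2 _ (left z x hx))
    (fun x hx => hd.2 _ (left d x hx)) (fun y hy => hd.2 _ (right d y hy)) (by omega)
    (inv_mem hx) hy ?_
  rw [hxy]; group

end Parabolic

/-! ### The regular representation of the Hecke algebra -/

/-- The free `𝒜`-module on `W`. -/
abbrev FreeW (r : ℕ) : Type := W r →₀ A

/-- The standard basis vectors of the free module on `W`. -/
noncomputable abbrev stdVec (w : W r) : FreeW r := Finsupp.single w 1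

open Classical in
/-- The operator of left multiplication by `T_s`, `s ∈ S`, on the free module on `W`. -/
noncomputable def leftOp (s : W r) : FreeW r →ₗ[A] FreeW r :=
  Finsupp.linearCombination A fun w => if length w < length (s * w) then stdVec (s * w)
    else (q - 1) • stdVec w + q • stdVec (s * w)

open Classical in
/-- The operator of right multiplication by `T_s`, `s ∈ S`, on the free module on `W`. -/
noncomputable def rightOp (s : W r) : FreeW r →ₗ[A] FreeW r :=
  Finsupp.linearCombination A fun w => if length w < length (w * s) then stdVec (w * s)
    else (q - 1) • stdVec w + q • stdVec (w * s)

/-- The operator of left translation by `u`. -/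
noncomputable def leftShift (u : W r) : FreeW r →ₗ[A] FreeW r :=
  Finsupp.lmapDomain A A fun w => u * w

/-- The operator of right translation by `u`. -/
noncomputable def rightShift (u : W r) : FreeW r →ₗ[A] FreeW r :=
  Finsupp.lmapDomain A A fun w => w * u

section Operators

variable {s t u v w : W r}

theorem leftOp_of_lt (h : length w < length (s * w)) :
    leftOp s (stdVec w) = stdVec (s * w) := by
  rw [leftOp, Finsupp.linearCombination_single, one_smul, if_pos h]

theorem leftOp_of_not_lt (h : ¬ length w < length (s * w)) :
    leftOp s (stdVec w) = (q - 1) • stdVec w + q • stdVec (s * w) := by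
  rw [leftOp, Finsupp.linearCombination_single, one_smul, if_neg h]

theorem rightOp_of_lt (h : length w < length (w * s)) :
    rightOp s (stdVec w) = stdVec (w * s) := by
  rw [rightOp, Finsupp.linearCombination_single, one_smul, if_pos h]

theorem rightOp_of_not_lt (h : ¬ length w < length (w * s)) :
    rightOp s (stdVec w) = (q - 1) • stdVec w + q • stdVec (w * s) := by
  rw [rightOp, Finsupp.linearCombination_single, one_smul, if_neg h]

theorem leftShift_stdVec (u w : W r) : leftShift u (stdVec w) = stdVec (u * w) :=
  Finsupp.mapDomain_single

theorem rightShift_stdVec (u w : W r) : rightShift u (stdVec w) = stdVec (w * u) :=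
  Finsupp.mapDomain_single

theorem ext_stdVec {f g : FreeW r →ₗ[A] FreeW r} (h : ∀ w, f (stdVec w) = g (stdVec w)) : f = g :=
  Finsupp.lhom_ext' fun w => LinearMap.ext_ring (h w)

variable [NeZero r]

/-- If `s w ≠ w t`, the effects of `s` and `t` on the length are independent and each of the four
cases is direct. If `s w = w t`, both operators act in the same way on the vectors of `w` and `s w`.
-/
theorem leftOp_comp_rightOp (hs : s ∈ simples r) (ht : t ∈ simples r) :
    leftOp s ∘ₗ rightOp t = rightOp t ∘ₗ leftOp s := by
  apply ext_stdVec
  intro w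
  rw [LinearMap.comp_apply, LinearMap.comp_apply]
  have hs2 := simple_mul_self hs
  have ht2 := simple_mul_self ht
  by_cases hst : s * w = w * t
  · have e1 : s * (w * t) = w := by rw [← hst, ← mul_assoc, hs2, one_mul]
    have e2 : s * w * t = w := by rw [hst, mul_assoc, ht2, mul_one]
    by_cases h1 : length w < length (w * t)
    · have h3 : ¬ length (w * t) < length (s * (w * t)) := by rw [e1]; omega
      have h4 : ¬ length (s * w) < length (s * w * t) := by rw [e2, hst]; omega
      have h2 : length w < length (s * w) := by rwa [hst]
      rw [rightOp_of_lt h1, leftOp_of_lt h2, leftOp_of_not_lt h3, rightOp_of_not_lt h4,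
        e1, e2, hst]
    · have h1' := length_mul_lt_of_not_lt (isReflection_of_simple ht) h1
      have h3 : length (w * t) < length (s * (w * t)) := by rwa [e1]
      have h4 : length (s * w) < length (s * w * t) := by rwa [e2, hst]
      have h2 : ¬ length w < length (s * w) := by rwa [hst]
      rw [rightOp_of_not_lt h1, leftOp_of_not_lt h2, map_add, map_smul, map_smul, map_add,
        map_smul, map_smul, rightOp_of_not_lt h1, leftOp_of_not_lt h2, leftOp_of_lt h3,
        rightOp_of_lt h4, e1, e2, hst]
  · have h1 := length_simple_mul_mul_lt_iff hs ht hst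
    have h2 := length_mul_simple_mul_lt_iff hs ht hst
    rw [mul_assoc] at h2
    by_cases c1 : length w < length (w * t) <;> by_cases c2 : length w < length (s * w)
    · rw [rightOp_of_lt c1, leftOp_of_lt c2, leftOp_of_lt (h2.2 c2), rightOp_of_lt (h1.2 c1),
        mul_assoc]
    · simp only [rightOp_of_lt c1, leftOp_of_not_lt c2, map_add, map_smul,
        leftOp_of_not_lt (mt h2.1 c2), rightOp_of_lt (h1.2 c1), mul_assoc]
    · simp only [rightOp_of_not_lt c1, leftOp_of_lt c2, map_add, map_smul,
        leftOp_of_lt (h2.2 c2), rightOp_of_not_lt (mt h1.1 c1), mul_assoc]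
    · simp only [rightOp_of_not_lt c1, leftOp_of_not_lt c2, map_add, map_smul,
        leftOp_of_not_lt (mt h2.1 c2), rightOp_of_not_lt (mt h1.1 c1), mul_assoc, smul_add,
        smul_smul]
      rw [mul_comm q (q - 1)]
      abel

theorem leftOp_comp_rightShift (hu : length u = 0) (s : W r) :
    leftOp s ∘ₗ rightShift u = rightShift u ∘ₗ leftOp s := by
  apply ext_stdVec
  intro w
  rw [LinearMap.comp_apply, LinearMap.comp_apply, rightShift_stdVec]
  have e1 := length_mul_of_length_eq_zero_right hu w
  have e2 := length_mul_of_length_eq_zero_right hu (s * w)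
  by_cases h : length w < length (s * w)
  · rw [leftOp_of_lt h, leftOp_of_lt (by rwa [← mul_assoc, e1, e2]), rightShift_stdVec, mul_assoc]
  · rw [leftOp_of_not_lt h, leftOp_of_not_lt (by rwa [← mul_assoc, e1, e2]), map_add, map_smul,
      map_smul, rightShift_stdVec, rightShift_stdVec, mul_assoc]

theorem leftShift_comp_rightOp (hu : length u = 0) (t : W r) :
    leftShift u ∘ₗ rightOp t = rightOp t ∘ₗ leftShift u := by
  apply ext_stdVec
  intro w
  rw [LinearMap.comp_apply, LinearMap.comp_apply, leftShift_stdVec]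
  have e1 := length_mul_of_length_eq_zero_left hu w
  have e2 := length_mul_of_length_eq_zero_left hu (w * t)
  by_cases h : length w < length (w * t)
  · rw [rightOp_of_lt h, rightOp_of_lt (by rwa [mul_assoc, e1, e2]), leftShift_stdVec, mul_assoc]
  · rw [rightOp_of_not_lt h, rightOp_of_not_lt (by rwa [mul_assoc, e1, e2]), map_add, map_smul,
      map_smul, leftShift_stdVec, leftShift_stdVec, mul_assoc]

omit [NeZero r] in
theorem leftShift_comp_rightShift (u v : W r) :
    leftShift u ∘ₗ rightShift v = rightShift v ∘ₗ leftShift u := by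
  apply ext_stdVec
  intro w
  simp only [LinearMap.comp_apply, leftShift_stdVec, rightShift_stdVec, mul_assoc]

end Operators

/-- The algebra of the operators that commute with the right multiplications. -/
def CommutesRight (f : Module.End A (FreeW r)) : Prop :=
  (∀ t ∈ simples r, f ∘ₗ rightOp t = rightOp t ∘ₗ f) ∧
  ∀ u, length u = 0 → f ∘ₗ rightShift u = rightShift u ∘ₗ f

/-! ### Operators that commute with the right multiplications -/

section CommutesRight

variable {f g : Module.End A (FreeW r)} {s u v w : W r}

theorem CommutesRight.add (hf : CommutesRight f) (hg : CommutesRight g) :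
    CommutesRight (f + g) :=
  ⟨fun t ht => by rw [LinearMap.add_comp, LinearMap.comp_add, hf.1 t ht, hg.1 t ht],
    fun u hu => by rw [LinearMap.add_comp, LinearMap.comp_add, hf.2 u hu, hg.2 u hu]⟩

theorem CommutesRight.smul (hf : CommutesRight f) (a : A) : CommutesRight (a • f) :=
  ⟨fun t ht => by rw [LinearMap.smul_comp, LinearMap.comp_smul, hf.1 t ht],
    fun u hu => by rw [LinearMap.smul_comp, LinearMap.comp_smul, hf.2 u hu]⟩

theorem CommutesRight.neg (hf : CommutesRight f) : CommutesRight (-f) :=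
  ⟨fun t ht => by rw [LinearMap.neg_comp, LinearMap.comp_neg, hf.1 t ht],
    fun u hu => by rw [LinearMap.neg_comp, LinearMap.comp_neg, hf.2 u hu]⟩

theorem CommutesRight.one : CommutesRight (1 : Module.End A (FreeW r)) :=
  ⟨fun _ _ => rfl, fun _ _ => rfl⟩

theorem CommutesRight.mul (hf : CommutesRight f) (hg : CommutesRight g) : CommutesRight (f * g) :=
  ⟨fun t ht => by
      rw [Module.End.mul_eq_comp, LinearMap.comp_assoc, hg.1 t ht, ← LinearMap.comp_assoc,
        hf.1 t ht, LinearMap.comp_assoc],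
    fun u hu => by
      rw [Module.End.mul_eq_comp, LinearMap.comp_assoc, hg.2 u hu, ← LinearMap.comp_assoc,
        hf.2 u hu, LinearMap.comp_assoc]⟩

theorem exists_mul_simple (h : length w ≠ 0) :
    ∃ s ∈ simples r, ∃ v : W r, w = v * s ∧ length w = length v + 1 := by
  obtain ⟨s, hs, v, hv, hl⟩ := exists_simple_mul (w := w⁻¹) (by rwa [length_inv])
  refine ⟨s, hs, v⁻¹, ?_, ?_⟩
  · rw [← inv_inv w, hv, mul_inv_rev, inv_of_simple hs]
  · rw [length_inv, length_simple hs] at hl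
    rw [length_inv]; omega

/-- The right operators generate the whole free module from the vector of the identity. Operator
identities thus reduce to a check on one vector. -/
theorem CommutesRight.ext (hf : CommutesRight f) (hg : CommutesRight g)
    (h : f (stdVec 1) = g (stdVec 1)) : f = g := by
  apply ext_stdVec
  intro w
  induction hn : length w using Nat.strong_induction_on generalizing w with
  | _ n ih =>
    by_cases h0 : length w = 0
    · have e : stdVec w = rightShift w (stdVec 1) := by rw [rightShift_stdVec, one_mul]
      rw [e, ← LinearMap.comp_apply, hf.2 w h0, ← LinearMap.comp_apply, hg.2 w h0,
        LinearMap.comp_apply, LinearMap.comp_apply, h]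
    · obtain ⟨s, hs, v, rfl, hl⟩ := exists_mul_simple h0
      have e : stdVec (v * s) = rightOp s (stdVec v) := by rw [rightOp_of_lt (by omega)]
      rw [e, ← LinearMap.comp_apply, hf.1 s hs, ← LinearMap.comp_apply, hg.1 s hs,
        LinearMap.comp_apply, LinearMap.comp_apply, ih (length v) (by omega) v rfl]

variable [NeZero r]

theorem commutesRight_leftOp (hs : s ∈ simples r) : CommutesRight (leftOp s) :=
  ⟨fun _ ht => leftOp_comp_rightOp hs ht, fun _ hu => leftOp_comp_rightShift hu s⟩

theorem commutesRight_leftShift (hu : length u = 0) : CommutesRight (leftShift u) :=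
  ⟨fun t _ => leftShift_comp_rightOp hu t, fun v _ => leftShift_comp_rightShift u v⟩

/-- Compose left operators along a reduced expression. By `CommutesRight.ext` the result does not
depend on the expression, so braid relations are never needed. -/
theorem exists_commutesRight (w : W r) :
    ∃ f : Module.End A (FreeW r), CommutesRight f ∧ f (stdVec 1) = stdVec w := by
  induction hn : length w using Nat.strong_induction_on generalizing w with
  | _ n ih =>
    by_cases h0 : length w = 0
    · exact ⟨leftShift w, commutesRight_leftShift h0, by rw [leftShift_stdVec, mul_one]⟩
    · obtain ⟨s, hs, v, rfl, hl⟩ := exists_simple_mul h0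
      rw [length_simple hs] at hl
      obtain ⟨f, hf, hf1⟩ := ih (length v) (by omega) v rfl
      refine ⟨leftOp s * f, (commutesRight_leftOp hs).mul hf, ?_⟩
      rw [Module.End.mul_apply, hf1, leftOp_of_lt (by omega)]

/-- The action of `T_w` on the free module on `W`. -/
noncomputable def regOp (w : W r) : Module.End A (FreeW r) := (exists_commutesRight w).choose

theorem commutesRight_regOp (w : W r) : CommutesRight (regOp w) :=
  (exists_commutesRight w).choose_spec.1

theorem regOp_one_vec (w : W r) : regOp w (stdVec 1) = stdVec w :=
  (exists_commutesRight w).choose_spec.2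

theorem regOp_simple (hs : s ∈ simples r) : regOp s = leftOp s := by
  refine (commutesRight_regOp s).ext (commutesRight_leftOp hs) ?_
  rw [regOp_one_vec, leftOp_of_lt, mul_one]
  rw [mul_one, length_one, length_simple hs]; omega

theorem regOp_stdVec (h : length (w * v) = length w + length v) :
    regOp w (stdVec v) = stdVec (w * v) := by
  induction hn : length v using Nat.strong_induction_on generalizing v with
  | _ n ih =>
    by_cases h0 : length v = 0
    · have e : stdVec v = rightShift v (stdVec 1) := by rw [rightShift_stdVec, one_mul]
      rw [e, ← LinearMap.comp_apply, (commutesRight_regOp w).2 v h0, LinearMap.comp_apply,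
        regOp_one_vec, rightShift_stdVec]
    · obtain ⟨s, hs, v', rfl, hl⟩ := exists_mul_simple h0
      -- Additivity of lengths for `w` and `v' s` forces it for `w` and `v'`, and forces `s` to
      -- lengthen `w v'`.
      have h1 := length_mul_le w v'
      have h2 := length_mul_simple hs (w * v')
      rw [mul_assoc] at h2
      have e : stdVec (v' * s) = rightOp s (stdVec v') := by rw [rightOp_of_lt (by omega)]
      rw [e, ← LinearMap.comp_apply, (commutesRight_regOp w).1 s hs, LinearMap.comp_apply,
        ih (length v') (by omega) (by omega) rfl, rightOp_of_lt (by rw [mul_assoc]; omega),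
        mul_assoc]

end CommutesRight

/-! ### The standard basis of the Hecke algebra and its coefficient functionals -/

section Basis

variable [NeZero r]

/-- Both sides of each relation commute with the right operators, so it suffices to compare them on
the vector of the identity. -/
theorem regOp_rel {x y : FreeAlgebra A (W r)} (h : HeckeRel r x y) :
    FreeAlgebra.lift A regOp x = FreeAlgebra.lift A regOp y := by
  induction h with
  | one =>
    rw [FreeAlgebra.lift_ι_apply, map_one]
    exact (commutesRight_regOp 1).ext CommutesRight.one (regOp_one_vec 1)
  | mul w w' h =>
    rw [map_mul, FreeAlgebra.lift_ι_apply, FreeAlgebra.lift_ι_apply, FreeAlgebra.lift_ι_apply]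
    refine ((commutesRight_regOp w).mul (commutesRight_regOp w')).ext (commutesRight_regOp _) ?_
    rw [Module.End.mul_apply, regOp_one_vec, regOp_one_vec, regOp_stdVec h]
  | quad s hs =>
    have hq : CommutesRight (algebraMap A (Module.End A (FreeW r)) q) := by
      rw [Algebra.algebraMap_eq_smul_one]
      exact CommutesRight.one.smul q
    have hz : CommutesRight (0 : Module.End A (FreeW r)) := by
      simpa using (CommutesRight.one (r := r)).smul (0 : A)
    have hq' : CommutesRight (-algebraMap A (Module.End A (FreeW r)) q) := hq.neg
    rw [map_mul, map_add, map_sub, map_one, map_zero, AlgHom.commutes, FreeAlgebra.lift_ι_apply,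
      sub_eq_add_neg]
    refine CommutesRight.ext (((commutesRight_regOp s).add CommutesRight.one).mul
      ((commutesRight_regOp s).add hq')) hz ?_
    have h1 : length (1 : W r) < length (s * 1) := by
      rw [mul_one, length_one, length_simple hs]; omega
    have h2 : ¬ length s < length (s * s) := by
      rw [simple_mul_self hs, length_one]; omega
    rw [Module.End.mul_apply, LinearMap.add_apply, LinearMap.add_apply, LinearMap.neg_apply,
      Module.algebraMap_end_apply, regOp_simple hs, leftOp_of_lt h1, mul_one,
      Module.End.one_apply, map_add, map_neg, map_smul, leftOp_of_lt h1,
      leftOp_of_not_lt h2, simple_mul_self hs, mul_one, LinearMap.zero_apply]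
    module

/-- The left regular representation of the Hecke algebra, on the free module on `W`. -/
noncomputable def regRep (r : ℕ) [NeZero r] : Hecke r →ₐ[A] Module.End A (FreeW r) :=
  RingQuot.liftAlgHom A ⟨FreeAlgebra.lift A regOp, fun _ _ h => regOp_rel h⟩

theorem regRep_T (w : W r) : regRep r (T w) = regOp w := by
  have : regRep r (T w) = FreeAlgebra.lift A regOp (FreeAlgebra.ι A w) :=
    RingQuot.liftAlgHom_mkAlgHom_apply A _ _ _
  rw [this, FreeAlgebra.lift_ι_apply]

/-- Acting on the vector of the identity sends the `T_w` to the standard basis of the free module.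
-/
theorem linearIndependent_T : LinearIndependent A (T : W r → Hecke r) := by
  let ev : Hecke r →ₗ[A] FreeW r := (LinearMap.applyₗ (stdVec 1)) ∘ₗ (regRep r).toLinearMap
  refine LinearIndependent.of_comp ev ?_
  have : ev ∘ T = fun w : W r => Finsupp.single w (1 : A) := by
    funext w
    change regRep r (T w) (stdVec 1) = _
    rw [regRep_T, regOp_one_vec]
  rw [this]
  exact Finsupp.linearIndependent_single_one A (W r)

omit [NeZero r] in
theorem T_simple_sq {s : W r} (hs : s ∈ simples r) : T s * T s = (q - 1) • T s + q • 1 := by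
  have h := T_quad hs
  have e : (T s + 1) * (T s - algebraMap A (Hecke r) q) =
      T s * T s - ((q - 1) • T s + q • 1) := by
    rw [mul_sub, add_mul, add_mul, ← Algebra.commutes, Algebra.algebraMap_eq_smul_one,
      smul_one_mul, sub_smul, one_smul, one_mul, one_mul]
    abel
  rw [e] at h
  exact sub_eq_zero.1 h

omit [NeZero r] in
theorem T_simple_mul_of_lt {s w : W r} (hs : s ∈ simples r) (h : length (s * w) = length w + 1) :
    T s * T w = T (s * w) :=
  T_mul (by rw [h, length_simple hs, add_comm])

omit [NeZero r] in
theorem T_simple_mul_of_gt {s w : W r} (hs : s ∈ simples r) (h : length w = length (s * w) + 1) :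
    T s * T w = (q - 1) • T w + q • T (s * w) := by
  have e : s * (s * w) = w := by rw [← mul_assoc, simple_mul_self hs, one_mul]
  have h1 := T_simple_mul_of_lt (w := s * w) hs (by rw [e, h])
  rw [e] at h1
  conv_lhs => rw [← h1, ← mul_assoc, T_simple_sq hs, add_mul, smul_mul_assoc, smul_mul_assoc, h1,
    one_mul]

theorem T_mul_T_mem_span (w v : W r) : T w * T v ∈ Submodule.span A (Set.range (T (r := r))) := by
  have hm : ∀ v : W r, T v ∈ Submodule.span A (Set.range (T (r := r))) := fun v =>
    Submodule.subset_span ⟨v, rfl⟩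
  induction hn : length w using Nat.strong_induction_on generalizing w v with
  | _ n ih =>
    by_cases h0 : length w = 0
    · rw [T_mul (by rw [length_mul_of_length_eq_zero_left h0, h0, zero_add])]
      exact hm _
    · obtain ⟨s, hs, w', rfl, hl⟩ := exists_mul_simple h0
      rw [← T_mul (by rw [hl, length_simple hs]), mul_assoc]
      rcases length_simple_mul hs v with h | h
      · rw [T_simple_mul_of_lt hs h]
        exact ih _ (by omega) _ _ rfl
      · rw [T_simple_mul_of_gt hs h, mul_add, mul_smul_comm, mul_smul_comm]
        exact add_mem (Submodule.smul_mem _ _ (ih _ (by omega) _ _ rfl))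
          (Submodule.smul_mem _ _ (ih _ (by omega) _ _ rfl))

theorem span_T : Submodule.span A (Set.range (T : W r → Hecke r)) = ⊤ := by
  rw [eq_top_iff]
  rintro x -
  obtain ⟨x, rfl⟩ := RingQuot.mkAlgHom_surjective A (HeckeRel r) x
  change heckeMk r x ∈ _
  have h1 : (1 : Hecke r) ∈ Submodule.span A (Set.range (T (r := r))) :=
    Submodule.subset_span ⟨1, T_one⟩
  induction x using FreeAlgebra.induction with
  | grade0 a =>
    rw [AlgHom.commutes, Algebra.algebraMap_eq_smul_one]
    exact Submodule.smul_mem _ _ h1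
  | grade1 w => exact Submodule.subset_span ⟨w, rfl⟩
  | add x y hx hy => rw [map_add]; exact add_mem hx hy
  | mul x y hx hy =>
    rw [map_mul]
    have := Submodule.mul_mem_mul hx hy
    rw [Submodule.span_mul_span] at this
    refine Submodule.span_le.2 ?_ this
    rintro _ ⟨_, ⟨w, rfl⟩, _, ⟨v, rfl⟩, rfl⟩
    exact T_mul_T_mem_span w v

/-- The standard basis of the Hecke algebra. -/
noncomputable def heckeBasis (r : ℕ) [NeZero r] : Module.Basis (W r) A (Hecke r) :=
  Module.Basis.mk linearIndependent_T span_T.ge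

theorem heckeBasis_apply (w : W r) : heckeBasis r w = T w := Module.Basis.mk_apply _ _ w

/-- The coefficient of `T_y`. -/
noncomputable def coef (y : W r) : Hecke r →ₗ[A] A := (heckeBasis r).coord y

open Classical in
theorem coef_T (y w : W r) : coef y (T w) = if w = y then 1 else 0 := by
  rw [coef, Module.Basis.coord_apply, ← heckeBasis_apply, Module.Basis.repr_self,
    Finsupp.single_apply]

theorem coef_T_self (w : W r) : coef w (T w) = 1 := by rw [coef_T, if_pos rfl]

theorem coef_T_of_ne {y w : W r} (h : w ≠ y) : coef y (T w) = 0 := by rw [coef_T, if_neg h]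

theorem hecke_ext {x y : Hecke r} (h : ∀ w, coef w x = coef w y) : x = y :=
  (heckeBasis r).ext_elem h

/-- The support of an element of the Hecke algebra, in the standard basis. -/
noncomputable def supp (x : Hecke r) : Finset (W r) := ((heckeBasis r).repr x).support

theorem mem_supp {x : Hecke r} {y : W r} : y ∈ supp x ↔ coef y x ≠ 0 := Finsupp.mem_support_iff

theorem sum_coef_smul_T (x : Hecke r) : ∑ y ∈ supp x, coef y x • T y = x := by
  have := (heckeBasis r).linearCombination_repr x
  rw [Finsupp.linearCombination_apply, Finsupp.sum] at this
  simp only [heckeBasis_apply] at this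
  exact this

theorem hecke_linearMap_ext {M : Type*} [AddCommMonoid M] [Module A M] {f g : Hecke r →ₗ[A] M}
    (h : ∀ w, f (T w) = g (T w)) : f = g :=
  (heckeBasis r).ext fun w => by rw [heckeBasis_apply]; exact h w

theorem hecke_induction {p : Hecke r → Prop} (add : ∀ x y, p x → p y → p (x + y))
    (smul_T : ∀ (a : A) w, p (a • T w)) (x : Hecke r) : p x := by
  have h0 : p 0 := by simpa using smul_T 0 1
  rw [← sum_coef_smul_T x]
  exact Finset.sum_induction _ p add h0 fun y _ => smul_T _ _

/-! ### Multiplication by `T_s` and coefficients -/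

variable {s y : W r}

theorem coef_simple_mul_of_gt (hs : s ∈ simples r) (h : length (s * y) < length y) (x : Hecke r) :
    coef y (T s * x) = (q - 1) * coef y x + coef (s * y) x := by
  have e : s * (s * y) = y := by rw [← mul_assoc, simple_mul_self hs, one_mul]
  have hne : s * y ≠ y := fun h' => by rw [h'] at h; omega
  have key : coef y ∘ₗ LinearMap.mulLeft A (T s) = (q - 1) • coef y + coef (s * y) := by
    apply hecke_linearMap_ext
    intro w
    simp only [LinearMap.comp_apply, LinearMap.mulLeft_apply, LinearMap.add_apply,
      LinearMap.smul_apply, smul_eq_mul]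
    by_cases h1 : w = y
    · subst h1
      rw [T_simple_mul_of_gt hs (by have := length_simple_mul hs w; omega), map_add, map_smul,
        map_smul, coef_T_self, coef_T_of_ne hne, coef_T_of_ne hne.symm]
      simp
    by_cases h2 : w = s * y
    · subst h2
      rw [T_simple_mul_of_lt hs (by rw [e]; have := length_simple_mul hs y; omega), e,
        coef_T_self, coef_T_self, coef_T_of_ne hne]
      simp
    have h3 : s * w ≠ y := fun h' => h2 (by rw [← h', ← mul_assoc, simple_mul_self hs, one_mul])
    rw [coef_T_of_ne h1, coef_T_of_ne h2]
    rcases length_simple_mul hs w with h | h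
    · rw [T_simple_mul_of_lt hs h, coef_T_of_ne h3]; simp
    · rw [T_simple_mul_of_gt hs h, map_add, map_smul, map_smul, coef_T_of_ne h1, coef_T_of_ne h3]
      simp
  exact LinearMap.congr_fun key x

theorem coef_simple_mul_of_lt (hs : s ∈ simples r) (h : length y < length (s * y)) (x : Hecke r) :
    coef y (T s * x) = q * coef (s * y) x := by
  have e : s * (s * y) = y := by rw [← mul_assoc, simple_mul_self hs, one_mul]
  have hne : s * y ≠ y := fun h' => by rw [h'] at h; omega
  have key : coef y ∘ₗ LinearMap.mulLeft A (T s) = q • coef (s * y) := by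
    apply hecke_linearMap_ext
    intro w
    simp only [LinearMap.comp_apply, LinearMap.mulLeft_apply,
      LinearMap.smul_apply, smul_eq_mul]
    by_cases h1 : w = y
    · subst h1
      rw [T_simple_mul_of_lt hs (by have := length_simple_mul hs w; omega), coef_T_of_ne hne,
        coef_T_of_ne hne.symm]
      simp
    by_cases h2 : w = s * y
    · subst h2
      rw [T_simple_mul_of_gt hs (by rw [e]; have := length_simple_mul hs y; omega), e, map_add,
        map_smul, map_smul, coef_T_self, coef_T_self, coef_T_of_ne hne]
      simp
    have h3 : s * w ≠ y := fun h' => h2 (by rw [← h', ← mul_assoc, simple_mul_self hs, one_mul])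
    rw [coef_T_of_ne h2]
    rcases length_simple_mul hs w with h | h
    · rw [T_simple_mul_of_lt hs h, coef_T_of_ne h3]; simp
    · rw [T_simple_mul_of_gt hs h, map_add, map_smul, map_smul, coef_T_of_ne h1, coef_T_of_ne h3]
      simp
  exact LinearMap.congr_fun key x

/-- The elements with `T_s x = q x` are those with coefficients constant on the sets `{y, s y}`. -/
theorem simple_mul_eq_iff (hs : s ∈ simples r) (x : Hecke r) :
    T s * x = q • x ↔ ∀ y, coef (s * y) x = coef y x := by
  have inv : ∀ y : W r, s * (s * y) = y := fun y => by
    rw [← mul_assoc, simple_mul_self hs, one_mul]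
  constructor
  · intro h
    have main : ∀ y, length (s * y) < length y → coef (s * y) x = coef y x := by
      intro y hy
      have h1 := coef_simple_mul_of_gt hs hy x
      rw [h, map_smul, smul_eq_mul] at h1
      linear_combination -h1
    intro y
    rcases length_simple_mul hs y with h | h
    · have := main (s * y) (by rw [inv]; omega)
      rw [inv] at this
      exact this.symm
    · exact main y (by omega)
  · intro h
    apply hecke_ext
    intro y
    rw [map_smul, smul_eq_mul]
    rcases length_simple_mul hs y with h1 | h1
    · rw [coef_simple_mul_of_lt hs (by omega), h]
    · rw [coef_simple_mul_of_gt hs (by omega), h]; ring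

end Basis

/-! ### The anti-involution `T_w ↦ T_{w⁻¹}` -/

section Anti

theorem anti_rel {x y : FreeAlgebra A (W r)} (h : HeckeRel r x y) :
    FreeAlgebra.lift A (fun w : W r => MulOpposite.op (T w⁻¹)) x =
      FreeAlgebra.lift A (fun w : W r => MulOpposite.op (T w⁻¹)) y := by
  induction h with
  | one => rw [FreeAlgebra.lift_ι_apply, map_one, inv_one, T_one, MulOpposite.op_one]
  | mul w w' h =>
    rw [map_mul, FreeAlgebra.lift_ι_apply, FreeAlgebra.lift_ι_apply, FreeAlgebra.lift_ι_apply,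
      ← MulOpposite.op_mul, mul_inv_rev, T_mul]
    rw [← mul_inv_rev, length_inv, length_inv, length_inv, h, add_comm]
  | quad s hs =>
    rw [map_mul, map_add, map_sub, map_one, map_zero, AlgHom.commutes, FreeAlgebra.lift_ι_apply,
      inv_of_simple hs, MulOpposite.algebraMap_apply, ← MulOpposite.op_one, ← MulOpposite.op_sub,
      ← MulOpposite.op_add, ← MulOpposite.op_mul]
    have h := T_quad hs
    have hc : Commute (algebraMap A (Hecke r) q) (T s) := Algebra.commutes _ _
    have : (T s - algebraMap A (Hecke r) q) * (T s + 1) =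
        (T s + 1) * (T s - algebraMap A (Hecke r) q) := by
      rw [sub_mul, mul_add, mul_add, mul_sub, add_mul, add_mul, hc.eq]
      simp only [mul_one, one_mul]
    rw [this, h, MulOpposite.op_zero]

/-- The anti-involution `T_w ↦ T_{w⁻¹}`, as a homomorphism to the opposite algebra. -/
noncomputable def antiHom (r : ℕ) : Hecke r →ₐ[A] (Hecke r)ᵐᵒᵖ :=
  RingQuot.liftAlgHom A ⟨FreeAlgebra.lift A fun w => MulOpposite.op (T w⁻¹),
    fun _ _ h => anti_rel h⟩

/-- The anti-involution `T_w ↦ T_{w⁻¹}`. -/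
noncomputable def anti (r : ℕ) : Hecke r →ₗ[A] Hecke r :=
  (MulOpposite.opLinearEquiv A).symm.toLinearMap ∘ₗ (antiHom r).toLinearMap

theorem anti_T (w : W r) : anti r (T w) = T w⁻¹ := by
  have : antiHom r (T w) = FreeAlgebra.lift A (fun w : W r => MulOpposite.op (T w⁻¹))
      (FreeAlgebra.ι A w) := RingQuot.liftAlgHom_mkAlgHom_apply A _ _ _
  change (antiHom r (T w)).unop = _
  rw [this, FreeAlgebra.lift_ι_apply, MulOpposite.unop_op]

theorem anti_mul (x y : Hecke r) : anti r (x * y) = anti r y * anti r x := by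
  change (antiHom r (x * y)).unop = _
  rw [map_mul]; rfl

theorem anti_one : anti r 1 = 1 := by
  change (antiHom r 1).unop = _
  rw [map_one]; rfl

theorem anti_inverse {x : Hecke r} (h : IsUnit x) :
    anti r (Ring.inverse x) = Ring.inverse (anti r x) := by
  have h1 : anti r (Ring.inverse x) * anti r x = 1 := by
    rw [← anti_mul, Ring.mul_inverse_cancel _ h, anti_one]
  have h2 : anti r x * anti r (Ring.inverse x) = 1 := by
    rw [← anti_mul, Ring.inverse_mul_cancel _ h, anti_one]
  have hu : IsUnit (anti r x) := isUnit_iff_exists.2 ⟨_, h2, h1⟩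
  calc anti r (Ring.inverse x)
      = anti r (Ring.inverse x) * (anti r x * Ring.inverse (anti r x)) := by
        rw [Ring.mul_inverse_cancel _ hu, mul_one]
    _ = _ := by rw [← mul_assoc, h1, one_mul]

theorem heckeBar_smul (a : A) (x : Hecke r) :
    heckeBar r (a • x) = LaurentPolynomial.invert a • heckeBar r x := by
  rw [Algebra.smul_def, map_mul, heckeBar_algebraMap, ← Algebra.smul_def]

theorem heckeBar_inverse {x : Hecke r} (h : IsUnit x) :
    heckeBar r (Ring.inverse x) = Ring.inverse (heckeBar r x) := by
  have h1 : heckeBar r x * heckeBar r (Ring.inverse x) = 1 := by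
    rw [← map_mul, Ring.mul_inverse_cancel _ h, map_one]
  calc heckeBar r (Ring.inverse x)
      = Ring.inverse (heckeBar r x) * (heckeBar r x * heckeBar r (Ring.inverse x)) := by
        rw [Ring.inverse_mul_cancel_left _ _ (h.map _)]
    _ = _ := by rw [h1, mul_one]

variable [NeZero r]

theorem anti_anti (x : Hecke r) : anti r (anti r x) = x := by
  have : anti r ∘ₗ anti r = LinearMap.id := hecke_linearMap_ext fun w => by
    rw [LinearMap.comp_apply, anti_T, anti_T, inv_inv]; rfl
  exact LinearMap.congr_fun this x

theorem coef_anti (y : W r) (x : Hecke r) : coef y (anti r x) = coef y⁻¹ x := by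
  have : coef y ∘ₗ anti r = coef y⁻¹ := hecke_linearMap_ext fun w => by
    rw [LinearMap.comp_apply, anti_T, coef_T, coef_T]
    congr 1
    exact propext inv_eq_iff_eq_inv
  exact LinearMap.congr_fun this x

theorem heckeBar_anti (x : Hecke r) : heckeBar r (anti r x) = anti r (heckeBar r x) := by
  induction x using hecke_induction with
  | add x y hx hy => rw [map_add, map_add, map_add, map_add, hx, hy]
  | smul_T a w =>
    rw [map_smul, heckeBar_smul, heckeBar_smul, map_smul, anti_T, heckeBar_T, heckeBar_T,
      anti_inverse (isUnit_T _), anti_T]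

theorem heckeBar_heckeBar (x : Hecke r) : heckeBar r (heckeBar r x) = x := by
  induction x using hecke_induction with
  | add x y hx hy => rw [map_add, map_add, hx, hy]
  | smul_T a w =>
    rw [heckeBar_smul, heckeBar_smul, heckeBar_T, heckeBar_inverse (isUnit_T _), heckeBar_T,
      inv_inv, LaurentPolynomial.involutive_invert a]
    congr 1
    have hu := isUnit_T w
    have h2 : IsUnit (Ring.inverse (T w)) := IsUnit.ringInverse hu
    calc Ring.inverse (Ring.inverse (T w))
        = Ring.inverse (Ring.inverse (T w)) * (Ring.inverse (T w) * T w) := by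
          rw [Ring.inverse_mul_cancel _ hu, mul_one]
      _ = T w := Ring.inverse_mul_cancel_left _ _ h2

/-- The anti-involution carries the statement for left multiplication over to the right. -/
theorem mul_simple_eq_iff {s : W r} (hs : s ∈ simples r) (x : Hecke r) :
    x * T s = q • x ↔ ∀ y, coef (y * s) x = coef y x := by
  have h := simple_mul_eq_iff hs (anti r x)
  have e : T s * anti r x = anti r (x * T s) := by
    rw [anti_mul, anti_T, inv_of_simple hs]
  rw [e, ← map_smul] at h
  have inj : Function.Injective (anti r) := Function.LeftInverse.injective anti_anti
  rw [inj.eq_iff] at h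
  rw [h]
  simp only [coef_anti, mul_inv_rev, inv_of_simple hs]
  exact ⟨fun h y => by simpa using h y⁻¹, fun h y => h y⁻¹⟩

end Anti

/-! ### Laurent polynomials -/

theorem coeff_tpow_mul (p : A) (a k : ℤ) : (tpow a * p).coeff k = p.coeff (k - a) := by
  rw [tpow, LaurentPolynomial.T,
    AddMonoidAlgebra.coeff_single_mul_eq_mul_coeff (k - a) (fun _ _ => by omega), one_mul]

theorem coeff_zsmul (m : ℤ) (p : A) (k : ℤ) : (m • p).coeff k = m * p.coeff k := rfl

theorem coeff_finsetSum {ι : Type*} (s : Finset ι) (f : ι → A) (k : ℤ) :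
    (∑ i ∈ s, f i).coeff k = ∑ i ∈ s, (f i).coeff k := by
  rw [AddMonoidAlgebra.coeff_sum, Finsupp.finsetSum_apply]

theorem coeff_tpow (a k : ℤ) : (tpow a).coeff k = if a = k then 1 else 0 :=
  LaurentPolynomial.T_apply _ _

theorem coeff_one (k : ℤ) : (1 : A).coeff k = if 0 = k then 1 else 0 := by
  rw [← LaurentPolynomial.T_zero]; exact LaurentPolynomial.T_apply _ _

theorem sum_coeff_zsmul_tpow (p : A) : ∑ k ∈ p.coeff.support, p.coeff k • tpow k = p := by
  classical
  ext k
  rw [coeff_finsetSum]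
  simp only [coeff_zsmul, coeff_tpow, mul_ite, mul_one, mul_zero, Finset.sum_ite_eq']
  split_ifs with h
  · rfl
  · exact (Finsupp.notMem_support_iff.1 h).symm

theorem tpow_mul_tpow (a b : ℤ) : tpow a * tpow b = tpow (a + b) :=
  (LaurentPolynomial.T_add a b).symm

theorem tpow_zero : tpow 0 = 1 := LaurentPolynomial.T_zero

theorem tpow_mul_cancel (a : ℤ) (p : A) : tpow (-a) * (tpow a * p) = p := by
  rw [← mul_assoc, tpow_mul_tpow, neg_add_cancel, tpow_zero, one_mul]

theorem tpow_mul_cancel' (a : ℤ) (p : A) : tpow a * (tpow (-a) * p) = p := by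
  rw [← mul_assoc, tpow_mul_tpow, add_neg_cancel, tpow_zero, one_mul]

theorem tpow_mul_eq_zero {a : ℤ} {p : A} : tpow a * p = 0 ↔ p = 0 :=
  ⟨fun h => by rw [← tpow_mul_cancel a p, h, mul_zero], fun h => by rw [h, mul_zero]⟩

/-- Invariance makes the set of exponents symmetric about zero. -/
theorem eq_zero_of_invert_eq {p : A} (h : LaurentPolynomial.invert p = p)
    (hneg : ∀ k, p.coeff k ≠ 0 → k < 0) : p = 0 := by
  ext k
  change p.coeff k = 0
  by_contra hk
  have h1 := hneg k hk
  have h2 : p.coeff (-k) = p.coeff k := by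
    rw [← LaurentPolynomial.invert_apply, h]
  have := hneg (-k) (by rwa [h2])
  omega

theorem coeff_aeval_q {P : Polynomial ℤ} {k : ℤ} (h : (Polynomial.aeval q P).coeff k ≠ 0) :
    k ≤ 2 * P.natDegree := by
  rw [Polynomial.aeval_eq_sum_range, coeff_finsetSum] at h
  obtain ⟨i, hi, hne⟩ := Finset.exists_ne_zero_of_sum_ne_zero h
  rw [coeff_zsmul, LaurentPolynomial.T_pow, coeff_tpow] at hne
  have h1 := right_ne_zero_of_mul hne
  rw [ne_eq, ite_eq_right_iff, not_forall] at h1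
  obtain ⟨h2, -⟩ := h1
  rw [Finset.mem_range] at hi
  omega

/-- The polynomial `P` with `P(t ^ 2) = p`, when `p` is a combination of even powers of `t`. -/
noncomputable def halfPoly (p : A) : Polynomial ℤ :=
  ∑ k ∈ p.coeff.support, Polynomial.monomial (k / 2).toNat (p.coeff k)

theorem halfPoly_zero : halfPoly 0 = 0 := by
  simp [halfPoly]

theorem aeval_halfPoly {p : A} (h : ∀ k, p.coeff k ≠ 0 → 0 ≤ k ∧ k % 2 = 0) :
    Polynomial.aeval q (halfPoly p) = p := by
  rw [halfPoly, map_sum]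
  conv_rhs => rw [← sum_coeff_zsmul_tpow p]
  refine Finset.sum_congr rfl fun k hk => ?_
  obtain ⟨h1, h2⟩ := h k (Finsupp.mem_support_iff.1 hk)
  rw [Polynomial.aeval_monomial, LaurentPolynomial.T_pow, ← Algebra.smul_def]
  congr 2
  omega

theorem natDegree_halfPoly_le {p : A} {m : ℕ} (h : ∀ k, p.coeff k ≠ 0 → k ≤ 2 * m) :
    (halfPoly p).natDegree ≤ m := by
  refine Polynomial.natDegree_sum_le_of_forall_le _ _ fun k hk => ?_
  refine (Polynomial.natDegree_monomial_le _).trans ?_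
  have := h k (Finsupp.mem_support_iff.1 hk)
  omega

theorem halfPoly_one : halfPoly 1 = 1 := by
  have h : ∀ k, (1 : A).coeff k ≠ 0 → k = 0 := by
    intro k hk
    rw [coeff_one] at hk
    by_contra hc
    exact hk (if_neg (Ne.symm hc))
  have h2 : (halfPoly 1).natDegree ≤ 0 := natDegree_halfPoly_le fun k hk => by rw [h k hk]; simp
  have h3 := aeval_halfPoly (p := 1) fun k hk => by rw [h k hk]; simp
  obtain ⟨c, hc⟩ := Polynomial.natDegree_eq_zero.1 (Nat.le_zero.1 h2)
  rw [← hc, Polynomial.aeval_C] at h3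
  have h4 := congrArg (fun p : A => p.coeff 0) h3
  rw [← hc]
  rw [Algebra.algebraMap_eq_smul_one] at h4
  simp only [coeff_zsmul, coeff_one, if_pos, mul_one] at h4
  rw [h4, Polynomial.C_1]

/-! ### Normalized coefficients and the bar involution -/

section KL

variable [NeZero r] {s v w y z : W r}

/-- The coefficient of `t ^ {-l(y)} T_y`. -/
noncomputable def ncoef (y : W r) : Hecke r →ₗ[A] A := tpow (length y) • coef y

theorem ncoef_apply (y : W r) (x : Hecke r) : ncoef y x = tpow (length y) * coef y x := rfl

theorem ncoef_eq_zero {x : Hecke r} : ncoef y x = 0 ↔ coef y x = 0 := tpow_mul_eq_zero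

/-- The combinations of the `T_y` with `l(y) < k`. -/
def lowLen (r : ℕ) [NeZero r] (k : ℕ) : Submodule A (Hecke r) where
  carrier := {x | ∀ y, k ≤ length y → coef y x = 0}
  add_mem' := fun hx hy z hz => by rw [map_add, hx z hz, hy z hz, add_zero]
  zero_mem' := fun z _ => map_zero _
  smul_mem' := fun a x hx z hz => by rw [map_smul, hx z hz, smul_zero]

theorem T_mem_lowLen {k : ℕ} (h : length w < k) : T w ∈ lowLen r k :=
  fun y hy => coef_T_of_ne fun e => by rw [e] at h; omega

theorem lowLen_mono {k l : ℕ} (h : k ≤ l) : lowLen r k ≤ lowLen r l :=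
  fun _ hx y hy => hx y (h.trans hy)

theorem simple_mul_mem_lowLen (hs : s ∈ simples r) {k : ℕ} {x : Hecke r} (hx : x ∈ lowLen r k) :
    T s * x ∈ lowLen r (k + 1) := by
  intro y hy
  rcases length_simple_mul hs y with h | h
  · rw [coef_simple_mul_of_lt hs (by omega), hx _ (by omega), mul_zero]
  · rw [coef_simple_mul_of_gt hs (by omega), hx y (by omega), hx _ (by omega), mul_zero, add_zero]

omit [NeZero r] in
theorem heckeBar_T_simple (hs : s ∈ simples r) :
    heckeBar r (T s) = tpow (-2) • T s + (tpow (-2) - 1) • 1 := by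
  rw [heckeBar_T, inv_of_simple hs]
  have h : T s * (tpow (-2) • T s + (tpow (-2) - 1) • (1 : Hecke r)) = 1 := by
    rw [mul_add, mul_smul_comm, T_simple_sq hs, mul_smul_comm, mul_one, smul_add, smul_smul,
      smul_smul, add_right_comm, ← add_smul, mul_sub, mul_comm (tpow (-2)) q, q_mul_inv, mul_one,
      one_smul]
    simp
  rw [← Ring.inverse_mul_cancel_left (T s) (tpow (-2) • T s + (tpow (-2) - 1) • (1 : Hecke r))
    (isUnit_T_simple hs), h, mul_one]

/-- Write `w = s v` with lengths adding. The bar of `T_s` is `t^{-2} T_s` plus a scalar, and `T_s`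
raises the length by at most one. Triangularity for the length, rather than for the Bruhat order, is
enough for uniqueness. -/
theorem heckeBar_T_sub_mem (w : W r) :
    heckeBar r (T w) - tpow (-2 * length w) • T w ∈ lowLen r (length w) := by
  induction hn : length w using Nat.strong_induction_on generalizing w with
  | _ n ih =>
    by_cases h0 : length w = 0
    · have e : T w⁻¹ * T w = 1 := by
        rw [T_mul, inv_mul_cancel, T_one]
        rw [inv_mul_cancel, length_one, length_inv, h0]
      have : heckeBar r (T w) = T w := by
        rw [heckeBar_T]
        calc _ = Ring.inverse (T w⁻¹) * (T w⁻¹ * T w) := by rw [e, mul_one]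
          _ = _ := Ring.inverse_mul_cancel_left _ _ (isUnit_T _)
      rw [this, ← hn, h0]
      simp
    · obtain ⟨s, hs, v, rfl, hl⟩ := exists_simple_mul h0
      rw [length_simple hs] at hl
      subst hn
      have hv := ih (length v) (by omega) v rfl
      obtain ⟨x, hx, hx'⟩ : ∃ x ∈ lowLen r (length v),
          heckeBar r (T v) = tpow (-2 * length v) • T v + x := ⟨_, hv, by abel⟩
      have e : heckeBar r (T (s * v)) - tpow (-2 * length (s * v)) • T (s * v) =
          tpow (-2) • (T s * x) + (tpow (-2) - 1) • (tpow (-2 * length v) • T v) +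
            (tpow (-2) - 1) • x := by
        rw [← T_simple_mul_of_lt hs (by omega), map_mul, hx', heckeBar_T_simple hs, add_mul,
          smul_mul_assoc, smul_mul_assoc, one_mul, mul_add, mul_smul_comm, smul_add, smul_add,
          smul_smul, tpow_mul_tpow, hl,
          show -2 + -2 * (length v : ℤ) = -2 * ((1 + length v : ℕ) : ℤ) by push_cast; ring]
        abel
      rw [e, hl, add_comm 1]
      exact add_mem (add_mem (Submodule.smul_mem _ _ (simple_mul_mem_lowLen hs hx))
        (Submodule.smul_mem _ _ (Submodule.smul_mem _ _ (T_mem_lowLen (by omega)))))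
        (Submodule.smul_mem _ _ (lowLen_mono (by omega) hx))

theorem coef_heckeBar_T_of_ne (h : y ≠ w) (hl : length w ≤ length y) :
    coef y (heckeBar r (T w)) = 0 := by
  have := heckeBar_T_sub_mem w y hl
  rwa [map_sub, map_smul, coef_T_of_ne h.symm, smul_zero, sub_zero] at this

theorem coef_heckeBar_T_self (w : W r) :
    coef w (heckeBar r (T w)) = tpow (-2 * length w) := by
  have := heckeBar_T_sub_mem w w le_rfl
  rw [map_sub, map_smul, coef_T_self, smul_eq_mul, mul_one] at this
  exact sub_eq_zero.1 this

/-- A bar invariant element all of whose normalized coefficients are in `t⁻¹ ℤ[t⁻¹]` is zero. -/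
theorem eq_zero_of_heckeBar_eq {x : Hecke r} (hx : heckeBar r x = x)
    (hneg : ∀ y k, (ncoef y x).coeff k ≠ 0 → k < 0) : x = 0 := by
  by_contra h0
  have hne : (supp x).Nonempty := by
    by_contra hc
    rw [Finset.not_nonempty_iff_eq_empty] at hc
    rw [← sum_coef_smul_T x, hc, Finset.sum_empty] at h0
    exact h0 rfl
  -- At a longest `y` in the support, the bars of the other terms contribute nothing, so the
  -- normalized coefficient is itself invariant under `t ↦ t⁻¹`.
  obtain ⟨y, hy, hmax⟩ := Finset.exists_max_image (supp x) length hne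
  have h1 : coef y (heckeBar r x) =
      LaurentPolynomial.invert (coef y x) * tpow (-2 * length y) := by
    conv_lhs => rw [← sum_coef_smul_T x, map_sum, map_sum]
    rw [Finset.sum_eq_single y]
    · rw [heckeBar_smul, map_smul, coef_heckeBar_T_self, smul_eq_mul]
    · intro z hz hzy
      rw [heckeBar_smul, map_smul, coef_heckeBar_T_of_ne hzy.symm (hmax z hz), smul_zero]
    · intro h; exact absurd hy h
  rw [hx] at h1
  have h2 : LaurentPolynomial.invert (ncoef y x) = ncoef y x := by
    rw [ncoef_apply, map_mul, LaurentPolynomial.invert_T]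
    conv_rhs => rw [h1]
    rw [mul_left_comm, tpow_mul_tpow, mul_comm]
    congr 2
    ring
  exact mem_supp.1 hy (ncoef_eq_zero.1 (eq_zero_of_invert_eq h2 (hneg y)))

/-! ### Existence and uniqueness of the Kazhdan-Lusztig elements -/

/-- The exponents of the Laurent polynomial `p` are among `-d, -d + 2, …` and negative. -/
def DegOk (d : ℤ) (p : A) : Prop := ∀ k, p.coeff k ≠ 0 → -d ≤ k ∧ k < 0 ∧ (k + d) % 2 = 0

theorem DegOk.zero (d : ℤ) : DegOk d 0 := fun _ h => absurd rfl h

theorem DegOk.add {d : ℤ} {p p' : A} (h : DegOk d p) (h' : DegOk d p') : DegOk d (p + p') := by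
  intro k hk
  by_cases h1 : p.coeff k = 0
  · by_cases h2 : p'.coeff k = 0
    · refine absurd ?_ hk
      change p.coeff k + p'.coeff k = 0
      rw [h1, h2, add_zero]
    · exact h' k h2
  · exact h k h1

theorem DegOk.zsmul {d : ℤ} {p : A} (h : DegOk d p) (m : ℤ) : DegOk d (m • p) :=
  fun k hk => h k (right_ne_zero_of_mul hk)

theorem DegOk.sub {d : ℤ} {p p' : A} (h : DegOk d p) (h' : DegOk d p') : DegOk d (p - p') := by
  have := h.add (h'.zsmul (-1))
  rwa [neg_one_zsmul, ← sub_eq_add_neg] at this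

theorem DegOk.sum {ι : Type*} {d : ℤ} {t : Finset ι} {f : ι → A} (h : ∀ i ∈ t, DegOk d (f i)) :
    DegOk d (∑ i ∈ t, f i) :=
  Finset.sum_induction _ (DegOk d) (fun _ _ => DegOk.add) (DegOk.zero d) h

/-- A reformulation of `IsKL` in terms of normalized coefficients. -/
structure IsKLCoef (w : W r) (c : Hecke r) : Prop where
  bar : heckeBar r c = c
  bruhat : ∀ y, ncoef y c ≠ 0 → BruhatLE y w
  self : ncoef w c = 1
  deg : ∀ y, y ≠ w → DegOk (length w - length y) (ncoef y c)

/-- Multiplying the normalized coefficient at `y ≠ w` by `t^{l(w) - l(y)}` moves its exponents to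
even numbers from `0` to `l(w) - l(y) - 1`. This is a polynomial in `q` of the permitted degree. -/
theorem IsKLCoef.isKL {c : Hecke r} (h : IsKLCoef w c) : IsKL w c := by
  have e : ∀ y, tpow (length w) * coef y c = tpow (length w - length y) * ncoef y c := by
    intro y
    rw [ncoef_apply, ← mul_assoc, tpow_mul_tpow, sub_add_cancel]
  have hself : tpow (length w) * coef w c = 1 := by
    rw [e, h.self, mul_one, sub_self, tpow_zero]
  have hexp : ∀ y k, (tpow (length w) * coef y c).coeff k ≠ 0 →
      y ≠ w → 0 ≤ k ∧ k + 1 + length y ≤ length w ∧ k % 2 = 0 := by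
    intro y k hk hy
    rw [e, coeff_tpow_mul] at hk
    have := h.deg y hy _ hk
    omega
  let P : W r →₀ Polynomial ℤ := Finsupp.onFinset (supp c)
    (fun y => halfPoly (tpow (length w) * coef y c)) fun y hy => by
      rw [mem_supp]
      intro h0
      rw [h0, mul_zero] at hy
      exact hy halfPoly_zero
  refine ⟨h.bar, P, ?_, ?_, ?_, ?_⟩
  · intro y hy
    refine h.bruhat y fun h0 => Finsupp.mem_support_iff.1 hy ?_
    change halfPoly _ = 0
    rw [ncoef_eq_zero.1 h0, mul_zero, halfPoly_zero]
  · change halfPoly _ = 1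
    rw [hself, halfPoly_one]
  · intro y hy hyw
    have hlt := hy.eq_or_length_lt.resolve_left hyw
    -- The truncated subtraction is harmless since `y` is strictly shorter than `w`.
    have : (P y).natDegree ≤ (length w - length y - 1) / 2 := by
      refine natDegree_halfPoly_le fun k hk => ?_
      have := hexp y k hk hyw
      omega
    omega
  · rw [Finsupp.onFinset_sum _ (fun y => by rw [map_zero, zero_smul])]
    have : ∀ y ∈ supp c, Polynomial.aeval q (halfPoly (tpow (length w) * coef y c)) • T y =
        tpow (length w) • (coef y c • T y) := by
      intro y _
      rw [smul_smul]
      congr 1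
      refine aeval_halfPoly fun k hk => ?_
      by_cases hyw : y = w
      · rw [hyw, hself, coeff_one] at hk
        have : k = 0 := by
          by_contra hc
          exact hk (if_neg (Ne.symm hc))
        rw [this]; simp
      · have := hexp y k hk hyw
        omega
    rw [Finset.sum_congr rfl this, ← Finset.smul_sum, sum_coef_smul_T, smul_smul, tpow_mul_tpow,
      neg_add_cancel, tpow_zero, one_smul]

/-- Only the bound on exponents that uniqueness needs is retained; it is the degree bound on the
polynomials after normalization. -/
theorem IsKL.coef_eq {c : Hecke r} (h : IsKL w c) :
    ncoef w c = 1 ∧ ∀ y, y ≠ w → ∀ k, (ncoef y c).coeff k ≠ 0 → k < 0 := by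
  obtain ⟨-, P, hb, hw, hd, hc⟩ := h
  have e : ∀ y, coef y c = tpow (-(length w : ℤ)) * Polynomial.aeval q (P y) := by
    intro y
    rw [hc, map_smul, smul_eq_mul, Finsupp.sum, map_sum]
    congr 1
    rw [Finset.sum_eq_single y]
    · rw [map_smul, coef_T_self, smul_eq_mul, mul_one]
    · intro z _ hz
      rw [map_smul, coef_T_of_ne hz, smul_zero]
    · intro hy
      rw [Finsupp.notMem_support_iff.1 hy, map_zero, zero_smul, map_zero]
  constructor
  · rw [ncoef_apply, e, hw, tpow_mul_cancel', map_one]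
  · intro y hy k hk
    rw [ncoef_apply, e, coeff_tpow_mul, coeff_tpow_mul] at hk
    have h1 := coeff_aeval_q hk
    by_cases hyw : y ∈ P.support
    · have := hd y (hb y hyw) hy
      omega
    · rw [Finsupp.notMem_support_iff.1 hyw, map_zero] at hk
      exact absurd rfl hk

theorem IsKL.unique {c c' : Hecke r} (h : IsKL w c) (h' : IsKL w c') : c = c' := by
  refine sub_eq_zero.1 (eq_zero_of_heckeBar_eq (by rw [map_sub, h.1, h'.1]) fun y k hk => ?_)
  rw [map_sub] at hk
  by_cases hy : y = w
  · rw [hy, h.coef_eq.1, h'.coef_eq.1, sub_self] at hk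
    exact absurd rfl hk
  · by_cases h1 : (ncoef y c).coeff k = 0
    · refine h'.coef_eq.2 y hy k fun h2 => hk ?_
      change (ncoef y c).coeff k - (ncoef y c').coeff k = 0
      rw [h1, h2, sub_zero]
    · exact h.coef_eq.2 y hy k h1

/-- Multiplication by `C_s = t⁻¹ (T_s + 1)`. -/
noncomputable def klMul (s : W r) : Hecke r →ₗ[A] Hecke r :=
  tpow (-1) • (LinearMap.mulLeft A (T s) + LinearMap.id)

omit [NeZero r] in
theorem klMul_apply (s : W r) (x : Hecke r) : klMul s x = tpow (-1) • (T s * x + x) := rfl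

-- The element `C_s` is bar invariant: the bar of `T_s + 1` is `t^{-2} (T_s + 1)`, and the bar of
-- `t⁻¹` is `t`.
omit [NeZero r] in
theorem heckeBar_klMul (hs : s ∈ simples r) (x : Hecke r) :
    heckeBar r (klMul s x) = klMul s (heckeBar r x) := by
  rw [klMul_apply, klMul_apply, heckeBar_smul, map_add, map_mul, heckeBar_T_simple hs,
    LaurentPolynomial.invert_T, add_mul, smul_mul_assoc, smul_mul_assoc, one_mul, sub_smul,
    one_smul]
  have : tpow (-2) • (T s * heckeBar r x) + (tpow (-2) • heckeBar r x - heckeBar r x) +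
      heckeBar r x = tpow (-2) • (T s * heckeBar r x + heckeBar r x) := by
    rw [smul_add]; abel
  rw [this, smul_smul, tpow_mul_tpow]
  rfl

omit [NeZero r] in
theorem simple_mul_klMul (hs : s ∈ simples r) (x : Hecke r) :
    T s * klMul s x = q • klMul s x := by
  rw [klMul_apply, mul_smul_comm, smul_comm q, mul_add, ← mul_assoc, T_simple_sq hs, add_mul,
    smul_mul_assoc, smul_mul_assoc, one_mul]
  congr 1
  rw [sub_smul, one_smul, smul_add]
  abel

theorem ncoef_klMul_of_gt (hs : s ∈ simples r) (h : length (s * y) < length y) (x : Hecke r) :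
    ncoef y (klMul s x) = tpow 1 * ncoef y x + ncoef (s * y) x := by
  have hl : (length (s * y) : ℤ) = -1 + length y := by
    have := length_simple_mul hs y; omega
  have hq : q * tpow (-1) = tpow 1 := tpow_mul_tpow _ _
  rw [klMul_apply, map_smul, map_add, ncoef_apply, ncoef_apply, ncoef_apply,
    coef_simple_mul_of_gt hs h, smul_eq_mul, hl, ← tpow_mul_tpow, ← hq]
  ring

theorem ncoef_klMul_of_lt (hs : s ∈ simples r) (h : length y < length (s * y)) (x : Hecke r) :
    ncoef y (klMul s x) = tpow (-1) * ncoef y x + ncoef (s * y) x := by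
  have hl : (length (s * y) : ℤ) = 2 + -1 + length y := by
    have := length_simple_mul hs y; omega
  rw [klMul_apply, map_smul, map_add, ncoef_apply, ncoef_apply, ncoef_apply,
    coef_simple_mul_of_lt hs h, smul_eq_mul, hl, ← tpow_mul_tpow, ← tpow_mul_tpow]
  ring

open Classical in
/-- The inductive step in the construction of the Kazhdan-Lusztig elements. -/
theorem IsKLCoef.exists_simple_mul (hs : s ∈ simples r) (hv : length (s * v) = length v + 1)
    {c : Hecke r} (hc : IsKLCoef v c)
    (IH : ∀ z : W r, length z < length v → ∃ d, IsKLCoef z d ∧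
      (length (s * z) < length z → T s * d = q • d)) :
    ∃ c', IsKLCoef (s * v) c' ∧ T s * c' = q • c' := by
  choose! D hD hDs using IH
  have inv : ∀ y : W r, s * (s * y) = y := fun y => by
    rw [← mul_assoc, simple_mul_self hs, one_mul]
  -- At these `z`, multiplication by `C_s` raises exponents by one, and the `t⁻¹` term of the
  -- coefficient, recorded by `μ`, becomes a forbidden constant. Subtracting `μ z • D z` removes it.
  set Z := (supp c).filter fun z => length (s * z) < length z with hZ
  let μ : W r → ℤ := fun z => (ncoef z c).coeff (-1)
  have hZv : ∀ z ∈ Z, BruhatLE z v ∧ length z < length v ∧ length (s * z) < length z := by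
    intro z hz
    rw [hZ, Finset.mem_filter, mem_supp] at hz
    have h1 := hc.bruhat z (mt ncoef_eq_zero.1 hz.1)
    refine ⟨h1, h1.eq_or_length_lt.resolve_left ?_, hz.2⟩
    rintro rfl
    omega
  have hsv : BruhatLE v (s * v) := bruhatLE_simple_mul hs (by omega)
  have hn : ∀ y, ncoef y (klMul s c - ∑ z ∈ Z, μ z • D z) =
      ncoef y (klMul s c) - ∑ z ∈ Z, μ z • ncoef y (D z) := by
    intro y
    rw [map_sub, map_sum]
    simp only [map_zsmul]
  refine ⟨klMul s c - ∑ z ∈ Z, μ z • D z, ⟨?_, ?_, ?_, ?_⟩, ?_⟩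
  · rw [map_sub, heckeBar_klMul hs, hc.bar, map_sum]
    congr 1
    refine Finset.sum_congr rfl fun z hz => ?_
    rw [map_zsmul, (hD z (hZv z hz).2.1).bar]
  · intro y
    contrapose!
    intro hy
    have h1 : ncoef y c = 0 := by
      by_contra hne
      exact hy ((hc.bruhat y hne).trans hsv)
    have h2 : ncoef (s * y) c = 0 := by
      by_contra hne
      -- By the lifting property, `s y ≤ v` gives `y ≤ s v`.
      have := (hc.bruhat _ hne).simple_mul hs (by omega)
      rw [inv] at this
      exact hy this
    have h3 : ncoef y (klMul s c) = 0 := by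
      rcases length_simple_mul hs y with h | h
      · rw [ncoef_klMul_of_lt hs (by omega), h1, h2, mul_zero, add_zero]
      · rw [ncoef_klMul_of_gt hs (by omega), h1, h2, mul_zero, add_zero]
    rw [hn, h3, zero_sub, neg_eq_zero]
    refine Finset.sum_eq_zero fun z hz => ?_
    obtain ⟨hzv, hlt, -⟩ := hZv z hz
    have : ncoef y (D z) = 0 := by
      by_contra hne
      exact hy ((((hD z hlt).bruhat y hne).trans hzv).trans hsv)
    rw [this, smul_zero]
  · rw [hn, ncoef_klMul_of_gt hs (by rw [inv]; omega), inv, hc.self]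
    have h1 : ncoef (s * v) c = 0 := by
      by_contra hne
      rcases (hc.bruhat _ hne).eq_or_length_lt with h | h
      · rw [h] at hv; omega
      · omega
    rw [h1, mul_zero, zero_add, Finset.sum_eq_zero, sub_zero]
    intro z hz
    obtain ⟨-, hlt, -⟩ := hZv z hz
    have : ncoef (s * v) (D z) = 0 := by
      by_contra hne
      rcases ((hD z hlt).bruhat _ hne).eq_or_length_lt with h | h
      · rw [← h] at hlt; omega
      · omega
    rw [this, smul_zero]
  · intro y hy
    rw [hn, hv]
    -- The parity conditions for `(y, z)` and for `(z, v)` at the exponent `-1` add up. The case `z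
    -- = y` is excluded, since there the coefficient is `1`.
    have hterm : ∀ z ∈ Z, z ≠ y →
        DegOk (((length v + 1 : ℕ) : ℤ) - length y) (μ z • ncoef y (D z)) := by
      intro z hz hzy k hk
      obtain ⟨-, hlt, -⟩ := hZv z hz
      have h1 := (hD z hlt).deg y hzy.symm k (right_ne_zero_of_mul hk)
      have h2 := hc.deg z (fun h => by rw [h] at hlt; omega) (-1) (left_ne_zero_of_mul hk)
      push_cast
      omega
    rcases length_simple_mul hs y with h | h
    · rw [ncoef_klMul_of_lt hs (by omega)]
      refine DegOk.sub (DegOk.add ?_ ?_) (DegOk.sum fun z hz => hterm z hz ?_)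
      · intro k hk
        rw [coeff_tpow_mul] at hk
        by_cases hyv : y = v
        · rw [hyv, hc.self, coeff_one] at hk
          have : 0 = k - -1 := by
            by_contra hne
            exact hk (if_neg hne)
          subst hyv
          push_cast
          omega
        · have := hc.deg y hyv _ hk
          push_cast
          omega
      · intro k hk
        have := hc.deg (s * y) (fun e => hy (by rw [← e, inv])) k hk
        push_cast
        omega
      · rintro rfl
        have := (hZv z hz).2.2
        omega
    · have hyv : y ≠ v := by rintro rfl; omega
      rw [ncoef_klMul_of_gt hs (by omega)]
      have hrest : DegOk (((length v + 1 : ℕ) : ℤ) - length y)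
          (∑ z ∈ Z.erase y, μ z • ncoef y (D z)) :=
        DegOk.sum fun z hz => hterm z (Finset.mem_of_mem_erase hz) (Finset.ne_of_mem_erase hz)
      -- The factor `t` makes the exponents at most `0`, and `μ y` is precisely the constant term.
      have hlead : DegOk (((length v + 1 : ℕ) : ℤ) - length y)
          (tpow 1 * ncoef y c - μ y • (1 : A)) := by
        intro k hk
        have e : (tpow 1 * ncoef y c - μ y • (1 : A)).coeff k =
            (ncoef y c).coeff (k - 1) - μ y * (if 0 = k then 1 else 0) := by
          rw [← coeff_tpow_mul, ← coeff_one, ← coeff_zsmul]; rfl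
        rw [e] at hk
        have hk0 : 0 ≠ k := by
          rintro rfl
          exact hk (by simp [μ])
        rw [if_neg hk0, mul_zero, sub_zero] at hk
        have := hc.deg y hyv _ hk
        push_cast
        omega
      -- The term `z = y` is `μ y` itself; if `y` is not in `Z`, its coefficient in `c` vanishes and
      -- `μ y = 0`.
      have hsum : ∑ z ∈ Z, μ z • ncoef y (D z) =
          μ y • (1 : A) + ∑ z ∈ Z.erase y, μ z • ncoef y (D z) := by
        by_cases hyZ : y ∈ Z
        · rw [← Finset.add_sum_erase _ _ hyZ, (hD y (hZv y hyZ).2.1).self]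
        · have : μ y = 0 := by
            have h0 : coef y c = 0 := by
              by_contra hne
              exact hyZ (Finset.mem_filter.2 ⟨mem_supp.2 hne, by omega⟩)
            simp only [μ]
            rw [ncoef_eq_zero.2 h0]; rfl
          rw [this, zero_smul, zero_add, Finset.erase_eq_of_notMem hyZ]
      have e : tpow 1 * ncoef y c + ncoef (s * y) c - ∑ z ∈ Z, μ z • ncoef y (D z) =
          (tpow 1 * ncoef y c - μ y • (1 : A)) + ncoef (s * y) c -
            ∑ z ∈ Z.erase y, μ z • ncoef y (D z) := by
        rw [hsum]; abel
      rw [e]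
      refine (hlead.add ?_).sub hrest
      intro k hk
      have := hc.deg (s * y) (fun e => hy (by rw [← e, inv])) k hk
      push_cast
      omega
  · rw [mul_sub, smul_sub, simple_mul_klMul hs, Finset.mul_sum, Finset.smul_sum]
    congr 1
    refine Finset.sum_congr rfl fun z hz => ?_
    obtain ⟨-, hlt, hsz⟩ := hZv z hz
    rw [mul_smul_comm, hDs z hlt hsz, smul_comm]

/-- The eigenvector property at left descents belongs to the induction: the correction terms of the
next step need it for the result to be an eigenvector of `T_s`. -/
theorem exists_isKLCoef (w : W r) :
    ∃ c, IsKLCoef w c ∧ ∀ s ∈ simples r, length (s * w) < length w → T s * c = q • c := by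
  induction hn : length w using Nat.strong_induction_on generalizing w with
  | _ n ih =>
    have step : ∀ s ∈ simples r, length (s * w) < length w →
        ∃ c, IsKLCoef w c ∧ T s * c = q • c := by
      intro s hs hlt
      have e : s * (s * w) = w := by rw [← mul_assoc, simple_mul_self hs, one_mul]
      have hl := length_simple_mul hs w
      obtain ⟨c, hc, -⟩ := ih (length (s * w)) (by omega) (s * w) rfl
      have := hc.exists_simple_mul hs (by rw [e]; omega) fun z hz => by
        obtain ⟨d, hd, hd'⟩ := ih (length z) (by omega) z rfl
        exact ⟨d, hd, hd' s hs⟩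
      rwa [e] at this
    by_cases h0 : length w = 0
    · refine ⟨T w, ⟨?_, ?_, ?_, ?_⟩, fun s _ hs => by omega⟩
      -- No length is below zero, so the statement on the leading term is an equality here.
      · have := heckeBar_T_sub_mem w
        rw [h0] at this
        refine sub_eq_zero.1 (hecke_ext fun y => ?_)
        have h1 := this y (Nat.zero_le _)
        rw [map_zero]
        simpa [tpow_zero] using h1
      · intro y hy
        have : w = y := by
          by_contra hne
          exact hy (ncoef_eq_zero.2 (coef_T_of_ne hne))
        rw [this]
        exact BruhatLE.refl _
      · rw [ncoef_apply, coef_T_self, h0, mul_one]; exact tpow_zero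
      · intro y hy
        rw [ncoef_eq_zero.2 (coef_T_of_ne hy.symm)]
        exact DegOk.zero _
    · obtain ⟨s, hs, v, rfl, hl⟩ := exists_simple_mul h0
      have e : s * (s * v) = v := by rw [← mul_assoc, simple_mul_self hs, one_mul]
      obtain ⟨c, hc, -⟩ := step s hs (by rw [e, hl, length_simple hs]; omega)
      refine ⟨c, hc, fun s' hs' hlt => ?_⟩
      -- Each descent gives its own construction, and uniqueness identifies the results.
      obtain ⟨c', hc', h⟩ := step s' hs' (by omega)
      rwa [hc.isKL.unique hc'.isKL]

theorem existsUnique_isKL (w : W r) : ∃! c, IsKL w c := by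
  obtain ⟨c, hc, -⟩ := exists_isKLCoef w
  exact ⟨c, hc.isKL, fun c' hc' => hc'.unique hc.isKL⟩

theorem isKL_klC (w : W r) : IsKL w (klC w) :=
  Classical.epsilon_spec (existsUnique_isKL w).exists

theorem isKLCoef_klC (w : W r) : IsKLCoef w (klC w) := by
  obtain ⟨c, hc, -⟩ := exists_isKLCoef w
  rwa [(isKL_klC w).unique hc.isKL]

theorem heckeBar_klC (w : W r) : heckeBar r (klC w) = klC w := (isKL_klC w).1

theorem simple_mul_klC (hs : s ∈ simples r) (h : length (s * w) < length w) :
    T s * klC w = q • klC w := by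
  obtain ⟨c, hc, hc'⟩ := exists_isKLCoef w
  rw [(isKL_klC w).unique hc.isKL]
  exact hc' s hs h

/-- Lengths, the Bruhat order and the bar are all compatible with inversion, so the defining
conditions carry over. This gives the eigenvector property at right descents. -/
theorem anti_klC (w : W r) : anti r (klC w) = klC w⁻¹ := by
  have h := isKLCoef_klC w
  have e : ∀ y, ncoef y (anti r (klC w)) = ncoef y⁻¹ (klC w) := fun y => by
    rw [ncoef_apply, ncoef_apply, coef_anti, length_inv]
  refine IsKL.unique (IsKLCoef.isKL ⟨?_, ?_, ?_, ?_⟩) (isKL_klC w⁻¹)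
  · rw [heckeBar_anti, h.bar]
  · intro y hy
    rw [e] at hy
    simpa using (h.bruhat _ hy).inv
  · rw [e, inv_inv, h.self]
  · intro y hy
    rw [e, length_inv, ← length_inv y]
    exact h.deg _ fun h' => hy (by rw [← h', inv_inv])

theorem klC_mul_simple (hs : s ∈ simples r) (h : length (w * s) < length w) :
    klC w * T s = q • klC w := by
  have h1 := simple_mul_klC (w := w⁻¹) hs
    (by rwa [← length_inv, mul_inv_rev, inv_inv, inv_of_simple hs, length_inv])
  have h2 := congrArg (anti r) h1
  rwa [anti_mul, anti_klC, inv_inv, anti_T, inv_of_simple hs, map_smul, anti_klC, inv_inv] at h2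

end KL

/-! ### Sums over finite subsets of `W` -/

section SumT

variable {X : Set (W r)} {y z : W r}

theorem sumT_eq (hX : X.Finite) : sumT X = ∑ x ∈ hX.toFinset, T x :=
  finsum_mem_eq_finite_toFinset_sum _ hX

theorem sumT_singleton (w : W r) : sumT {w} = T w := by
  rw [sumT, finsum_mem_singleton]

variable [NeZero r]

open Classical in
theorem coef_sumT (hX : X.Finite) (y : W r) : coef y (sumT X) = if y ∈ X then 1 else 0 := by
  rw [sumT_eq hX, map_sum]
  simp only [coef_T, Finset.sum_ite_eq', Set.Finite.mem_toFinset]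

theorem coef_sumT_of_mem (hX : X.Finite) (h : y ∈ X) : coef y (sumT X) = 1 := by
  rw [coef_sumT hX, if_pos h]

theorem coef_sumT_of_notMem (hX : X.Finite) (h : y ∉ X) : coef y (sumT X) = 0 := by
  rw [coef_sumT hX, if_neg h]

theorem simple_mul_sumT {s : W r} (hs : s ∈ simples r) (hX : X.Finite)
    (h : ∀ y, s * y ∈ X ↔ y ∈ X) : T s * sumT X = q • sumT X := by
  rw [simple_mul_eq_iff hs]
  intro y
  rw [coef_sumT hX, coef_sumT hX]
  classical exact if_congr (h y) rfl rfl

theorem sumT_mul_simple {s : W r} (hs : s ∈ simples r) (hX : X.Finite)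
    (h : ∀ y, y * s ∈ X ↔ y ∈ X) : sumT X * T s = q • sumT X := by
  rw [mul_simple_eq_iff hs]
  intro y
  rw [coef_sumT hX, coef_sumT hX]
  classical exact if_congr (h y) rfl rfl

theorem anti_sumT (hX : X.Finite) (h : ∀ y, y⁻¹ ∈ X ↔ y ∈ X) : anti r (sumT X) = sumT X := by
  apply hecke_ext
  intro y
  rw [coef_anti, coef_sumT hX, coef_sumT hX]
  classical exact if_congr (h y) rfl rfl

end SumT

/-! ### Double cosets of parabolic subgroups -/

section Cosets

variable {I J : Set (W r)} {s v w y z : W r}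

/-- The double coset `W_I w W_J`. -/
def parCoset (I J : Set (W r)) (w : W r) : Set (W r) :=
  DoubleCoset.doubleCoset w (Subgroup.closure I) (Subgroup.closure J)

/-- The elements of minimal length of the double cosets in `W_I \ W / W_J`. -/
def parReps (I J : Set (W r)) : Set (W r) := {w | IsShortest (parCoset I J w) w}

theorem mem_parCoset : y ∈ parCoset I J w ↔
    ∃ a ∈ Subgroup.closure I, ∃ b ∈ Subgroup.closure J, y = a * w * b :=
  DoubleCoset.mem_doubleCoset

theorem self_mem_parCoset (w : W r) : w ∈ parCoset I J w :=
  mem_parCoset.2 ⟨1, one_mem _, 1, one_mem _, by simp⟩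

theorem parCoset_eq_of_mem (h : y ∈ parCoset I J w) : parCoset I J y = parCoset I J w :=
  DoubleCoset.doubleCoset_eq_of_mem h

theorem mul_mem_parCoset_iff {a : W r} (ha : a ∈ Subgroup.closure I) (y : W r) :
    a * y ∈ parCoset I J w ↔ y ∈ parCoset I J w := by
  have key : ∀ a ∈ Subgroup.closure I, ∀ y, y ∈ parCoset I J w → a * y ∈ parCoset I J w := by
    rintro a ha y hy
    obtain ⟨b, hb, c, hc, rfl⟩ := mem_parCoset.1 hy
    exact mem_parCoset.2 ⟨a * b, mul_mem ha hb, c, hc, by group⟩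
  refine ⟨fun h => ?_, key a ha y⟩
  simpa using key a⁻¹ (inv_mem ha) _ h

theorem mul_mem_parCoset_iff' {a : W r} (ha : a ∈ Subgroup.closure J) (y : W r) :
    y * a ∈ parCoset I J w ↔ y ∈ parCoset I J w := by
  have key : ∀ a ∈ Subgroup.closure J, ∀ y, y ∈ parCoset I J w → y * a ∈ parCoset I J w := by
    rintro a ha y hy
    obtain ⟨b, hb, c, hc, rfl⟩ := mem_parCoset.1 hy
    exact mem_parCoset.2 ⟨b, hb, c * a, mul_mem hc ha, by group⟩
  refine ⟨fun h => ?_, key a ha y⟩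
  simpa using key a⁻¹ (inv_mem ha) _ h

theorem parCoset_finite (hI : (Subgroup.closure I : Set (W r)).Finite)
    (hJ : (Subgroup.closure J : Set (W r)).Finite) (w : W r) : (parCoset I J w).Finite :=
  (hI.mul (Set.finite_singleton w)).mul hJ

theorem exists_parReps (y : W r) : ∃ z ∈ parReps I J, y ∈ parCoset I J z := by
  obtain ⟨z, hz⟩ := exists_isShortest ⟨y, self_mem_parCoset (I := I) (J := J) y⟩
  have e := parCoset_eq_of_mem hz.1
  refine ⟨z, ?_, ?_⟩
  · change IsShortest _ _
    rwa [e]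
  · rw [e]; exact self_mem_parCoset y

theorem closure_empty_finite : (Subgroup.closure (∅ : Set (W r)) : Set (W r)).Finite := by
  rw [Subgroup.closure_empty]
  simp

variable [NeZero r]

theorem parReps_eq (hI : I ⊆ simples r) (hJ : J ⊆ simples r) (hz : z ∈ parReps I J)
    (hw : w ∈ parReps I J) (h : y ∈ parCoset I J z) (h' : y ∈ parCoset I J w) : z = w := by
  have e : parCoset I J z = parCoset I J w := by
    rw [← parCoset_eq_of_mem h, parCoset_eq_of_mem h']
  have hm : z ∈ parCoset I J w := by rw [← e]; exact self_mem_parCoset z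
  exact IsShortest.eq_of_doubleCoset hI hJ hz hw hm

theorem coef_mul_of_invariant (hI : I ⊆ simples r) {x : Hecke r}
    (h : ∀ s ∈ I, T s * x = q • x) {a : W r} (ha : a ∈ Subgroup.closure I) (y : W r) :
    coef (a * y) x = coef y x := by
  induction ha using Subgroup.closure_induction generalizing y with
  | mem s hs => exact (simple_mul_eq_iff (hI hs) x).1 (h s hs) y
  | one => rw [one_mul]
  | mul a b _ _ iha ihb => rw [mul_assoc, iha, ihb]
  | inv a _ ih => rw [← ih (a⁻¹ * y), mul_inv_cancel_left]

theorem coef_mul_of_invariant' (hJ : J ⊆ simples r) {x : Hecke r}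
    (h : ∀ s ∈ J, x * T s = q • x) {a : W r} (ha : a ∈ Subgroup.closure J) (y : W r) :
    coef (y * a) x = coef y x := by
  induction ha using Subgroup.closure_induction generalizing y with
  | mem s hs => exact (mul_simple_eq_iff (hJ hs) x).1 (h s hs) y
  | one => rw [mul_one]
  | mul a b _ _ iha ihb => rw [← mul_assoc, ihb, iha]
  | inv a _ ih => rw [← ih (y * a⁻¹), inv_mul_cancel_right]

theorem coef_sum_sumT (hI : I ⊆ simples r) (hJ : J ⊆ simples r)
    (fI : (Subgroup.closure I : Set (W r)).Finite) (fJ : (Subgroup.closure J : Set (W r)).Finite)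
    (al : parReps I J →₀ A) (z : parReps I J) (hy : y ∈ parCoset I J z) :
    coef y (al.sum fun z a => a • sumT (parCoset I J z)) = al z := by
  rw [Finsupp.sum, map_sum, Finset.sum_eq_single z]
  · rw [map_smul, coef_sumT_of_mem (parCoset_finite fI fJ _) hy, smul_eq_mul, mul_one]
  · intro z' _ hne
    rw [map_smul, coef_sumT_of_notMem (parCoset_finite fI fJ _), smul_zero]
    exact fun h => hne (Subtype.ext (parReps_eq hI hJ z'.2 z.2 h hy))
  · intro h
    rw [Finsupp.notMem_support_iff.1 h, zero_smul, map_zero]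

/-- The elements `x` of the Hecke algebra with `T_s x = q x` for `s ∈ I` and `x T_s = q x` for
`s ∈ J` are the combinations of the sums over double cosets, in a unique way. -/
theorem existsUnique_eq_sum_sumT (hI : I ⊆ simples r) (hJ : J ⊆ simples r)
    (fI : (Subgroup.closure I : Set (W r)).Finite) (fJ : (Subgroup.closure J : Set (W r)).Finite)
    {x : Hecke r} (hl : ∀ s ∈ I, T s * x = q • x) (hr : ∀ s ∈ J, x * T s = q • x) :
    ∃! al : parReps I J →₀ A, x = al.sum fun z a => a • sumT (parCoset I J z) := by
  -- The coefficients are read off at the shortest representatives, since those of `x` are constant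
  -- on each double coset.
  refine ⟨((heckeBasis r).repr x).comapDomain Subtype.val Subtype.val_injective.injOn, ?_, ?_⟩
  · apply hecke_ext
    intro y
    obtain ⟨z, hz, hy⟩ := exists_parReps (I := I) (J := J) y
    rw [coef_sum_sumT hI hJ fI fJ _ ⟨z, hz⟩ hy]
    obtain ⟨a, ha, b, hb, rfl⟩ := mem_parCoset.1 hy
    rw [coef_mul_of_invariant' hJ hr hb, coef_mul_of_invariant hI hl ha]
    rfl
  · intro al hal
    ext1 z
    rw [← coef_sum_sumT hI hJ fI fJ al z (self_mem_parCoset _), ← hal]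
    rfl

/-- With `I` empty a double coset is a coset `z W_J`, and lengths add when its shortest element is
multiplied by `W_J`. -/
theorem sumT_parCoset_empty (hJ : J ⊆ simples r)
    (fJ : (Subgroup.closure J : Set (W r)).Finite) (hz : z ∈ parReps ∅ J) :
    sumT (parCoset ∅ J z) = T z * sumT (Subgroup.closure J : Set (W r)) := by
  have e : parCoset ∅ J z = (fun x => z * x) '' (Subgroup.closure J : Set (W r)) := by
    ext y
    rw [mem_parCoset, Set.mem_image]
    constructor
    · rintro ⟨a, ha, b, hb, rfl⟩
      rw [Subgroup.closure_empty, Subgroup.mem_bot] at ha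
      exact ⟨b, hb, by rw [ha, one_mul]⟩
    · rintro ⟨b, hb, rfl⟩
      exact ⟨1, one_mem _, b, hb, by rw [one_mul]⟩
  have hd : ∀ y ∈ Subgroup.closure J, length z ≤ length (z * y) := fun y hy =>
    hz.2 _ ((mul_mem_parCoset_iff' hy z).2 (self_mem_parCoset z))
  rw [e, sumT, finsum_mem_image (mul_right_injective z).injOn,
    finsum_mem_eq_finite_toFinset_sum _ fJ, sumT_eq fJ, Finset.mul_sum]
  refine Finset.sum_congr rfl fun x hx => ?_
  rw [T_mul]
  exact length_mul_of_shortest hJ hd (fJ.mem_toFinset.1 hx)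

/-- The decomposition into double coset sums with `I` empty shows every summand to be a left
multiple of the sum over `W_J`. -/
theorem exists_eq_mul_sumT (hJ : J ⊆ simples r)
    (fJ : (Subgroup.closure J : Set (W r)).Finite) {x : Hecke r}
    (h : ∀ s ∈ J, x * T s = q • x) :
    ∃ c, x = c * sumT (Subgroup.closure J : Set (W r)) := by
  obtain ⟨al, hal, -⟩ := existsUnique_eq_sum_sumT (I := ∅) (Set.empty_subset _) hJ
    closure_empty_finite fJ (x := x) (fun s hs => hs.elim) h
  refine ⟨al.sum fun z a => a • T z.1, ?_⟩
  rw [hal, Finsupp.sum_mul]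
  refine Finset.sum_congr rfl fun z _ => ?_
  beta_reduce
  rw [smul_mul_assoc, sumT_parCoset_empty hJ fJ z.2]

theorem exists_eq_sumT_mul (hI : I ⊆ simples r)
    (fI : (Subgroup.closure I : Set (W r)).Finite) {x : Hecke r}
    (h : ∀ s ∈ I, T s * x = q • x) :
    ∃ c, x = sumT (Subgroup.closure I : Set (W r)) * c := by
  obtain ⟨c, hc⟩ := exists_eq_mul_sumT (x := anti r x) hI fI fun s hs => by
    have := congrArg (anti r) (h s hs)
    rwa [anti_mul, anti_T, inv_of_simple (hI hs), map_smul] at this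
  refine ⟨anti r c, ?_⟩
  have := congrArg (anti r) hc
  rwa [anti_anti, anti_mul, anti_sumT fI fun y => inv_mem_iff] at this

end Cosets

/-! ### Young subgroups -/

section Young

variable {n : ℕ} {lam mu : Lam n r} {s w : W r}

theorem youngSimples_subset (lam : Lam n r) : youngSimples lam ⊆ simples r := by
  rintro s ⟨i, -, -, hi, -⟩
  exact ⟨i, hi⟩

variable [NeZero r]

-- The generators of `W_λ` are among `s_1, …, s_{r-1}`, which permute the window `1, …, r`; only
-- `s_0` would cross its border.
omit [NeZero r] in
theorem mem_Icc_of_mem_young {x : W r} (hx : x ∈ young lam) (j : ℤ) :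
    x.1 j ∈ Set.Icc (1 : ℤ) r ↔ j ∈ Set.Icc (1 : ℤ) r := by
  have key : ∀ s ∈ youngSimples lam, ∀ j ∈ Set.Icc (1 : ℤ) r, s.1 j ∈ Set.Icc (1 : ℤ) r := by
    rintro s ⟨i, h1, h2, hi, -⟩ j ⟨hj1, hj2⟩
    have small : ∀ d : ℤ, (r : ℤ) ∣ d → -(r : ℤ) < d → d < r → d = 0 := by
      rintro d hd h3 h4
      exact Int.eq_zero_of_abs_lt_dvd hd (abs_lt.2 ⟨h3, h4⟩)
    by_cases c1 : j ≡ i [ZMOD r]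
    · have := small _ c1.dvd (by omega) (by omega)
      rw [hi.1 j c1]
      constructor <;> omega
    by_cases c2 : j ≡ i + 1 [ZMOD r]
    · have := small _ c2.dvd (by omega) (by omega)
      rw [hi.2.1 j c2]
      constructor <;> omega
    rw [hi.2.2 j c1 c2]
    exact ⟨hj1, hj2⟩
  induction hx using Subgroup.closure_induction generalizing j with
  | mem s hs =>
    refine ⟨fun h => ?_, key s hs j⟩
    have := key s hs _ h
    rwa [← mul_apply, simple_mul_self (youngSimples_subset lam hs)] at this
  | one => rfl
  | mul x y _ _ hx hy => exact (hx _).trans (hy _)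
  | inv x _ hx =>
    have := hx ((x⁻¹).1 j)
    rw [apply_inv_self] at this
    exact this.symm

/-- An element is determined by its values on the window, and these stay in the window. -/
theorem young_finite (lam : Lam n r) : (young lam : Set (W r)).Finite := by
  have hr : (0 : ℤ) < r := by exact_mod_cast NeZero.pos r
  let f : W r → (Set.Icc (1 : ℤ) r → ℤ) := fun x j => x.1 j
  refine Set.Finite.of_injOn (f := f) (t := Set.pi Set.univ fun _ => Set.Icc (1 : ℤ) r) ?_ ?_
    (Set.Finite.pi fun _ => Set.finite_Icc _ _)
  · intro x hx j _
    exact (mem_Icc_of_mem_young hx j).2 j.2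
  · intro x _ y _ hxy
    apply W_ext
    intro j
    have h1 := Int.emod_nonneg (j - 1) hr.ne'
    have h2 := Int.emod_lt_of_pos (j - 1) hr
    have h3 := Int.emod_add_mul_ediv (j - 1) r
    have e : j = ((j - 1) % r + 1) + ((j - 1) / r) * r := by linarith
    have h4 := congrFun hxy ⟨(j - 1) % r + 1, by constructor <;> omega⟩
    rw [e, apply_add_mul, apply_add_mul]
    exact congrArg (· + _) h4

theorem dcoset_finite (lam mu : Lam n r) (w : W r) : (dcoset lam mu w).Finite :=
  parCoset_finite (young_finite lam) (young_finite mu) w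

theorem simple_mul_sumT_dcoset (hs : s ∈ youngSimples lam) (w : W r) :
    T s * sumT (dcoset lam mu w) = q • sumT (dcoset lam mu w) :=
  simple_mul_sumT (youngSimples_subset lam hs) (dcoset_finite lam mu w) fun y =>
    mul_mem_parCoset_iff (Subgroup.subset_closure hs) y

theorem sumT_dcoset_mul_simple (hs : s ∈ youngSimples mu) (w : W r) :
    sumT (dcoset lam mu w) * T s = q • sumT (dcoset lam mu w) :=
  sumT_mul_simple (youngSimples_subset mu hs) (dcoset_finite lam mu w) fun y =>
    mul_mem_parCoset_iff' (Subgroup.subset_closure hs) y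

theorem simple_mul_xElt (hs : s ∈ youngSimples lam) : T s * xElt lam = q • xElt lam :=
  simple_mul_sumT (youngSimples_subset lam hs) (young_finite lam) fun _ =>
    Subgroup.mul_mem_cancel_left _ (Subgroup.subset_closure hs)

theorem xElt_mul_simple (hs : s ∈ youngSimples lam) : xElt lam * T s = q • xElt lam :=
  sumT_mul_simple (youngSimples_subset lam hs) (young_finite lam) fun _ =>
    Subgroup.mul_mem_cancel_right _ (Subgroup.subset_closure hs)

omit [NeZero r] in
theorem mem_xH_iff_exists {m : Hecke r} : m ∈ xH lam ↔ ∃ h, m = xElt lam * h := by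
  rw [xH, Submodule.mem_span_singleton]
  constructor
  · rintro ⟨a, rfl⟩
    exact ⟨a.unop, rfl⟩
  · rintro ⟨h, rfl⟩
    exact ⟨MulOpposite.op h, rfl⟩

/-- Membership in the right ideal becomes a system of eigenvector equations, which can be compared
with coefficients. -/
theorem mem_xH_iff {m : Hecke r} : m ∈ xH lam ↔ ∀ s ∈ youngSimples lam, T s * m = q • m := by
  rw [mem_xH_iff_exists]
  constructor
  · rintro ⟨h, rfl⟩ s hs
    rw [← mul_assoc, simple_mul_xElt hs, smul_mul_assoc]
  · exact exists_eq_sumT_mul (youngSimples_subset lam) (young_finite lam)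

theorem exists_eq_mul_xElt {m : Hecke r} (h : ∀ s ∈ youngSimples mu, m * T s = q • m) :
    ∃ c, m = c * xElt mu :=
  exists_eq_mul_sumT (youngSimples_subset mu) (young_finite mu) h

/-- The elements of `x_λ H ∩ H x_μ` are the combinations of the sums over double cosets. -/
theorem existsUnique_eq_sum_dcoset {m : Hecke r} (hl : ∀ s ∈ youngSimples lam, T s * m = q • m)
    (hr : ∀ s ∈ youngSimples mu, m * T s = q • m) :
    ∃! al : minReps lam mu →₀ A, m = al.sum fun z a => a • sumT (dcoset lam mu z) :=
  existsUnique_eq_sum_sumT (youngSimples_subset lam) (youngSimples_subset mu) (young_finite lam)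
    (young_finite mu) hl hr

omit [NeZero r] in
theorem isLongest_longest {X : Set (W r)} (hX : X.Nonempty) (hf : X.Finite) :
    IsLongest X (longest X) :=
  Classical.epsilon_spec (exists_isLongest hX hf)

theorem wZero_isLongest (mu : Lam n r) : IsLongest (young mu : Set (W r)) (wZero mu) :=
  isLongest_longest ⟨1, one_mem _⟩ (young_finite mu)

theorem wPlus_isLongest (lam mu : Lam n r) (w : W r) :
    IsLongest (dcoset lam mu w) (wPlus lam mu w) :=
  isLongest_longest ⟨w, self_mem_parCoset w⟩ (dcoset_finite lam mu w)

theorem simple_mul_lt_of_isLongest {X : Set (W r)} (h : IsLongest X w) (hs : s ∈ simples r)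
    (hX : s * w ∈ X) : length (s * w) < length w := by
  have h1 := h.2 _ hX
  have h2 := length_simple_mul hs w
  omega

theorem mul_simple_lt_of_isLongest {X : Set (W r)} (h : IsLongest X w) (hs : s ∈ simples r)
    (hX : w * s ∈ X) : length (w * s) < length w := by
  have h1 := h.2 _ hX
  have h2 := length_mul_simple hs w
  omega

/-- `C_{w_{0,μ}} = t^{-l(w_{0,μ})} x_μ`. -/
theorem klC_wZero (mu : Lam n r) :
    klC (wZero mu) = tpow (-(length (wZero mu) : ℤ)) • xElt mu := by
  have hL := wZero_isLongest mu
  have hk := isKLCoef_klC (wZero mu)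
  have h1 : ∀ s ∈ youngSimples mu, T s * klC (wZero mu) = q • klC (wZero mu) := fun s hs =>
    simple_mul_klC (youngSimples_subset mu hs) (simple_mul_lt_of_isLongest hL
      (youngSimples_subset mu hs) (mul_mem (Subgroup.subset_closure hs) hL.1))
  apply hecke_ext
  intro y
  rw [map_smul, smul_eq_mul]
  by_cases hy : y ∈ young mu
  -- On `W_μ` the coefficients are constant, with the value found at the longest element; outside
  -- they vanish, as the support lies below that element.
  · have h2 := coef_mul_of_invariant (youngSimples_subset mu) h1
      (mul_mem hy (inv_mem hL.1)) (wZero mu)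
    rw [inv_mul_cancel_right] at h2
    rw [h2, xElt, coef_sumT_of_mem (young_finite mu) hy, ← hk.self, ncoef_apply, tpow_mul_cancel]
  · rw [xElt, coef_sumT_of_notMem (young_finite mu) hy, mul_zero]
    by_contra hne
    exact hy ((hk.bruhat y (mt ncoef_eq_zero.1 hne)).mem_closure (youngSimples_subset mu) hL.1)

/-- As `w⁺` is longest, all simple reflections in `W_λ` and `W_μ` are left and right descents, so
`C_{w⁺}` is an eigenvector on both sides. -/
theorem existsUnique_isAlpha (lam mu : Lam n r) (w : W r) : ∃! al, IsAlpha lam mu w al := by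
  have hL := wPlus_isLongest lam mu w
  refine existsUnique_eq_sum_dcoset (fun s hs => ?_) (fun s hs => ?_)
  · have hs' := youngSimples_subset lam hs
    exact simple_mul_klC hs' (simple_mul_lt_of_isLongest hL hs'
      ((mul_mem_parCoset_iff (Subgroup.subset_closure hs) _).2 hL.1))
  · have hs' := youngSimples_subset mu hs
    exact klC_mul_simple hs' (mul_simple_lt_of_isLongest hL hs'
      ((mul_mem_parCoset_iff' (Subgroup.subset_closure hs) _).2 hL.1))

theorem isAlpha_alpha (lam mu : Lam n r) (w : W r) : IsAlpha lam mu w (alpha lam mu w) :=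
  Classical.epsilon_spec (existsUnique_isAlpha lam mu w).exists

theorem heckeBar_xElt (lam : Lam n r) :
    heckeBar r (xElt lam) = tpow (-2 * length (wZero lam)) • xElt lam := by
  have e : xElt lam = tpow (length (wZero lam)) • klC (wZero lam) := by
    rw [klC_wZero, smul_smul, tpow_mul_tpow, add_neg_cancel, tpow_zero, one_smul]
  conv_lhs => rw [e, heckeBar_smul, heckeBar_klC, klC_wZero, LaurentPolynomial.invert_T, smul_smul,
    tpow_mul_tpow]
  congr 2
  ring

/-- The generator `x_λ` is only rescaled by the bar. This is what makes a bar on `⨁ x_λ H` possible.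
-/
theorem heckeBar_mem_xH {m : Hecke r} (h : m ∈ xH lam) : heckeBar r m ∈ xH lam := by
  obtain ⟨x, rfl⟩ := mem_xH_iff_exists.1 h
  refine mem_xH_iff_exists.2 ⟨tpow (-2 * length (wZero lam)) • heckeBar r x, ?_⟩
  rw [map_mul, heckeBar_xElt, smul_mul_assoc, mul_smul_comm]

end Young

variable {n : ℕ}

/-! ### Matrix units of the affine `q`-Schur algebra -/

/-- `f` sends `x_ν h` to `δ_{μν} d h` in the summand `x_λ H`. -/
def IsBlock (lam mu : Lam n r) (d : Hecke r) (f : Schur n r) : Prop :=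
  ∀ (nu : Lam n r) (h : Hecke r) (kappa : Lam n r),
    ((f (incl nu (MulOpposite.op h • xGen nu)) kappa : xH kappa) : Hecke r) =
      if nu = mu ∧ kappa = lam then d * h else 0

theorem eq_op_smul_xGen {lam : Lam n r} (m : xH lam) :
    ∃ h : Hecke r, m = MulOpposite.op h • xGen lam := by
  obtain ⟨h, hh⟩ := mem_xH_iff_exists.1 m.2
  exact ⟨h, Subtype.ext hh⟩

theorem schur_ext {f g : Schur n r}
    (H : ∀ (nu : Lam n r) (h : Hecke r) (kappa : Lam n r),
      ((f (incl nu (MulOpposite.op h • xGen nu)) kappa : xH kappa) : Hecke r) =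
        g (incl nu (MulOpposite.op h • xGen nu)) kappa) : f = g := by
  refine DirectSum.linearMap_ext _ fun nu => LinearMap.ext fun m => ?_
  obtain ⟨h, rfl⟩ := eq_op_smul_xGen m
  exact DFinsupp.ext fun kappa => Subtype.ext (H nu h kappa)

theorem incl_op_smul (nu : Lam n r) (h : Hecke r) (m : xH nu) :
    incl nu (MulOpposite.op h • m) = MulOpposite.op h • incl nu m :=
  (DirectSum.lof (Hecke r)ᵐᵒᵖ (Lam n r) (fun lam => xH lam) nu).map_smul _ _

theorem incl_apply_self (nu : Lam n r) (m : xH nu) : incl nu m nu = m :=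
  DirectSum.of_eq_same _ _

theorem incl_apply_of_ne {nu kappa : Lam n r} (h : kappa ≠ nu) (m : xH nu) :
    incl nu m kappa = 0 :=
  DirectSum.of_eq_of_ne _ _ _ h

theorem smul_apply_coe (a : A) (f : Schur n r) (v : TensorSpace n r) (kappa : Lam n r) :
    (((a • f) v kappa : xH kappa) : Hecke r) = a • ((f v kappa : xH kappa) : Hecke r) := rfl

theorem add_apply_coe (f g : Schur n r) (v : TensorSpace n r) (kappa : Lam n r) :
    (((f + g) v kappa : xH kappa) : Hecke r) =
      ((f v kappa : xH kappa) : Hecke r) + ((g v kappa : xH kappa) : Hecke r) := rfl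

namespace IsBlock

variable {lam mu : Lam n r} {d d' : Hecke r} {f g : Schur n r}

theorem unique (hf : IsBlock lam mu d f) (hg : IsBlock lam mu d g) : f = g :=
  schur_ext fun nu h kappa => by rw [hf, hg]

theorem add (hf : IsBlock lam mu d f) (hg : IsBlock lam mu d' g) :
    IsBlock lam mu (d + d') (f + g) := by
  intro nu h kappa
  rw [add_apply_coe, hf, hg]
  split_ifs
  · rw [add_mul]
  · rw [add_zero]

theorem zero : IsBlock lam mu 0 (0 : Schur n r) := by
  intro nu h kappa
  rw [zero_mul, ite_self]
  rfl

theorem smul (hf : IsBlock lam mu d f) (a : A) : IsBlock lam mu (a • d) (a • f) := by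
  intro nu h kappa
  rw [smul_apply_coe, hf]
  split_ifs
  · rw [smul_mul_assoc]
  · rw [smul_zero]

theorem sum {ι : Type*} {s : Finset ι} {d : ι → Hecke r} {f : ι → Schur n r}
    (h : ∀ i ∈ s, IsBlock lam mu (d i) (f i)) :
    IsBlock lam mu (∑ i ∈ s, d i) (∑ i ∈ s, f i) := by
  classical
  induction s using Finset.induction_on with
  | empty => exact zero
  | insert i s hi ih =>
    rw [Finset.sum_insert hi, Finset.sum_insert hi]
    exact (h i (Finset.mem_insert_self i s)).add (ih fun j hj => h j (Finset.mem_insert_of_mem hj))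

end IsBlock

/-- Left multiplication by `c`, as a map from `x_μ H` to `x_λ H`. -/
noncomputable def mulLeftXH (lam mu : Lam n r) (c : Hecke r) (hc : ∀ m ∈ xH mu, c * m ∈ xH lam) :
    xH mu →ₗ[(Hecke r)ᵐᵒᵖ] xH lam where
  toFun m := ⟨c * m, hc m m.2⟩
  map_add' _ _ := Subtype.ext (mul_add _ _ _)
  map_smul' _ _ := Subtype.ext (mul_assoc _ _ _).symm

/-- Left multiplication by `c`, as a map from the summand `x_μ H` to the summand `x_λ H`. -/
noncomputable def block (lam mu : Lam n r) (c : Hecke r) (hc : ∀ m ∈ xH mu, c * m ∈ xH lam) :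
    Schur n r :=
  DirectSum.lof (Hecke r)ᵐᵒᵖ (Lam n r) (fun lam => xH lam) lam ∘ₗ mulLeftXH lam mu c hc ∘ₗ
    DirectSum.component (Hecke r)ᵐᵒᵖ (Lam n r) (fun lam => xH lam) mu

theorem block_apply (lam mu : Lam n r) (c : Hecke r) (hc : ∀ m ∈ xH mu, c * m ∈ xH lam)
    (v : TensorSpace n r) : block lam mu c hc v = incl lam (mulLeftXH lam mu c hc (v mu)) := rfl

theorem isBlock_block (lam mu : Lam n r) (c : Hecke r) (hc : ∀ m ∈ xH mu, c * m ∈ xH lam) :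
    IsBlock lam mu (c * xElt mu) (block lam mu c hc) := by
  intro nu h kappa
  rw [block_apply]
  by_cases h1 : kappa = lam
  · subst h1
    rw [incl_apply_self]
    by_cases h2 : nu = mu
    · subst h2
      rw [incl_apply_self, if_pos ⟨rfl, rfl⟩, mul_assoc]
      rfl
    · rw [incl_apply_of_ne (Ne.symm h2), map_zero, if_neg (fun h => h2 h.1)]
      rfl
  · rw [incl_apply_of_ne h1, if_neg (fun h => h1 h.2)]
    rfl

section

variable [NeZero r]

/-- The right condition gives `d = c x_μ`, so that left multiplication by `c` realizes `x_μ h ↦ d h`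
and no question of well-definedness arises. The left condition puts the values in `x_λ H`. -/
theorem existsUnique_isBlock {lam mu : Lam n r} {d : Hecke r}
    (hl : ∀ s ∈ youngSimples lam, T s * d = q • d)
    (hr : ∀ s ∈ youngSimples mu, d * T s = q • d) : ∃! f, IsBlock lam mu d f := by
  obtain ⟨c, rfl⟩ := exists_eq_mul_xElt hr
  refine ⟨block lam mu c fun m hm => ?_, isBlock_block _ _ _ _, fun f hf =>
    hf.unique (isBlock_block _ _ _ _)⟩
  obtain ⟨h, rfl⟩ := mem_xH_iff_exists.1 hm
  rw [mem_xH_iff]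
  intro s hs
  rw [← mul_assoc c, ← mul_assoc, hl s hs, smul_mul_assoc]

theorem existsUnique_isPhi (lam mu : Lam n r) (w : W r) : ∃! f, IsPhi lam mu w f :=
  existsUnique_isBlock (fun _ hs => simple_mul_sumT_dcoset hs w)
    (fun _ hs => sumT_dcoset_mul_simple hs w)

theorem isBlock_phi (lam mu : Lam n r) (w : W r) :
    IsBlock lam mu (sumT (dcoset lam mu w)) (phi lam mu w) :=
  Classical.epsilon_spec (p := IsPhi lam mu w) (existsUnique_isPhi lam mu w).exists

theorem isBlock_sum_phi (lam mu : Lam n r) (al : minReps lam mu →₀ A) :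
    IsBlock lam mu (al.sum fun z a => a • sumT (dcoset lam mu z))
      (al.sum fun z a => a • phi lam mu z) :=
  IsBlock.sum fun z _ => (isBlock_phi lam mu z).smul _

theorem isBlock_theta (lam mu : Lam n r) (w : W r) :
    IsBlock lam mu (tpow (length (wZero mu)) • klC (wPlus lam mu w)) (theta lam mu w) := by
  have h : klC (wPlus lam mu w) = _ := isAlpha_alpha lam mu w
  rw [h]
  exact (isBlock_sum_phi lam mu _).smul _

end

/-! ### The standard basis spans the affine `q`-Schur algebra -/

theorem lam_eq_of_eqOn [NeZero n] {lam mu : Lam n r}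
    (h : ∀ i ∈ Finset.Icc (1 : ℤ) n, lam.1 i = mu.1 i) : lam = mu := by
  have hn : (0 : ℤ) < n := by exact_mod_cast NeZero.pos n
  have per : ∀ (lam : Lam n r) (i k : ℤ), lam.1 (i + k * n) = lam.1 i := by
    intro lam i k
    induction k using Int.induction_on with
    | zero => simp
    | succ k ih =>
      have := lam.2.1 (i + k * n)
      rw [ih] at this
      rwa [show i + ((k : ℤ) + 1) * n = i + k * n + n by ring]
    | pred k ih =>
      have := lam.2.1 (i + (-(k : ℤ) - 1) * n)
      rw [show i + (-(k : ℤ) - 1) * n + n = i + -(k : ℤ) * n by ring, ih] at this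
      exact this.symm
  refine Subtype.ext (funext fun i => ?_)
  have h1 := Int.emod_nonneg (i - 1) hn.ne'
  have h2 := Int.emod_lt_of_pos (i - 1) hn
  have h3 := Int.emod_add_mul_ediv (i - 1) n
  have e : i = ((i - 1) % n + 1) + ((i - 1) / n) * n := by linarith
  rw [e, per, per]
  exact h _ (Finset.mem_Icc.2 ⟨by omega, by omega⟩)

/-- Finiteness makes an endomorphism of the direct sum a finite sum of blocks. -/
theorem finite_lam (n r : ℕ) [NeZero n] : Finite (Lam n r) := by
  let f : Lam n r → (Finset.Icc (1 : ℤ) n → Finset.range (r + 1)) := fun lam i =>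
    ⟨lam.1 i, Finset.mem_range_succ_iff.2 <|
      (Finset.single_le_sum (f := lam.1) (fun _ _ => Nat.zero_le _) i.2).trans_eq lam.2.2⟩
  refine Finite.of_injective f fun lam mu h => lam_eq_of_eqOn fun i hi => ?_
  exact congrArg Subtype.val (congrFun h ⟨i, hi⟩)

theorem sum_apply_coe {ι : Type*} (s : Finset ι) (f : ι → Schur n r) (v : TensorSpace n r)
    (kappa : Lam n r) : (((∑ i ∈ s, f i) v kappa : xH kappa) : Hecke r) =
      ∑ i ∈ s, ((f i v kappa : xH kappa) : Hecke r) := by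
  classical
  induction s using Finset.induction_on with
  | empty => rfl
  | insert i s hi ih => rw [Finset.sum_insert hi, Finset.sum_insert hi, add_apply_coe, ih]

/-- The set of the standard basis elements `φ_B`. -/
def phiSet (n r : ℕ) : Set (Schur n r) :=
  {f | ∃ lam mu : Lam n r, ∃ w ∈ minReps lam mu, f = phi lam mu w}

/-- A matrix coefficient of `f` is a left eigenvector because it lies in `x_λ H`, and a right
eigenvector because it is an image of `x_μ`. It is therefore a combination of double coset sums,
which are the matrix coefficients of the `φ_B`. -/
theorem mem_span_phiSet [NeZero n] [NeZero r] (f : Schur n r) :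
    f ∈ Submodule.span A (phiSet n r) := by
  classical
  have := finite_lam n r
  let := Fintype.ofFinite (Lam n r)
  -- the matrix coefficients of `f`
  let d : Lam n r → Lam n r → Hecke r := fun lam mu => (f (incl mu (xGen mu)) lam : xH lam)
  have hf : ∀ nu h kappa,
      ((f (incl nu (MulOpposite.op h • xGen nu)) kappa : xH kappa) : Hecke r) =
        d kappa nu * h := by
    intro nu h kappa
    rw [incl_op_smul, map_smul]
    rfl
  have hal : ∀ lam mu, ∃ al : minReps lam mu →₀ A,
      d lam mu = al.sum fun z a => a • sumT (dcoset lam mu z) := by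
    intro lam mu
    refine (existsUnique_eq_sum_dcoset (fun s hs => ?_) fun s hs => ?_).exists
    · exact mem_xH_iff.1 (f (incl mu (xGen mu)) lam : xH lam).2 s hs
    · rw [← hf]
      -- The scalar `q` is written as a right multiplication by a central element, so that the
      -- linearity of `f` over the opposite of `H` applies.
      have e : MulOpposite.op (T s) • xGen mu = MulOpposite.op (algebraMap A (Hecke r) q) •
          xGen mu := by
        apply Subtype.ext
        change xElt mu * T s = xElt mu * algebraMap A (Hecke r) q
        rw [xElt_mul_simple hs, ← Algebra.commutes, ← Algebra.smul_def]
      rw [e, hf, ← Algebra.commutes, ← Algebra.smul_def]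
  choose al hal using hal
  have key : f = ∑ lam : Lam n r, ∑ mu : Lam n r,
      (al lam mu).sum fun z a => a • phi lam mu z := by
    refine schur_ext fun nu h kappa => ?_
    rw [hf, sum_apply_coe]
    simp only [sum_apply_coe]
    have hb : ∀ lam mu, (((((al lam mu).sum fun z a => a • phi lam mu z) : Schur n r)
        (incl nu (MulOpposite.op h • xGen nu)) kappa : xH kappa) : Hecke r) =
          if nu = mu ∧ kappa = lam then d lam mu * h else 0 := fun lam mu => by
      rw [hal lam mu]
      exact isBlock_sum_phi lam mu (al lam mu) nu h kappa
    simp only [hb, ite_and, Finset.sum_ite_eq, Finset.mem_univ, if_true]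
  rw [key]
  refine Submodule.sum_mem _ fun lam _ => Submodule.sum_mem _ fun mu _ =>
    Submodule.sum_mem _ fun z _ => Submodule.smul_mem _ _ (Submodule.subset_span ?_)
  exact ⟨lam, mu, z, z.2, rfl⟩

/-! ### The bar involution of the affine `q`-Schur algebra -/

section Bar

variable [NeZero r]

/-- The bar involution on `x_λ H`. -/
noncomputable def xHBar (lam : Lam n r) : xH lam →+ xH lam where
  toFun m := ⟨heckeBar r m, heckeBar_mem_xH m.2⟩
  map_zero' := Subtype.ext (map_zero _)
  map_add' _ _ := Subtype.ext (map_add _ _ _)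

/-- The bar involution on `⨁_λ x_λ H`. -/
noncomputable def tensorBar (n r : ℕ) [NeZero r] : TensorSpace n r →+ TensorSpace n r :=
  DirectSum.map xHBar

theorem tensorBar_apply_coe (v : TensorSpace n r) (kappa : Lam n r) :
    ((tensorBar n r v kappa : xH kappa) : Hecke r) = heckeBar r (v kappa : xH kappa) := by
  rw [tensorBar, DirectSum.map_apply]
  rfl

omit [NeZero r] in
theorem tensorSpace_ext {v w : TensorSpace n r}
    (h : ∀ kappa, ((v kappa : xH kappa) : Hecke r) = (w kappa : xH kappa)) : v = w :=
  DFinsupp.ext fun kappa => Subtype.ext (h kappa)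

theorem tensorBar_tensorBar (v : TensorSpace n r) : tensorBar n r (tensorBar n r v) = v :=
  tensorSpace_ext fun kappa => by
    rw [tensorBar_apply_coe, tensorBar_apply_coe, heckeBar_heckeBar]

theorem tensorBar_op_smul (h : Hecke r) (v : TensorSpace n r) :
    tensorBar n r (MulOpposite.op h • v) = MulOpposite.op (heckeBar r h) • tensorBar n r v :=
  tensorSpace_ext fun kappa => by
    rw [tensorBar_apply_coe]
    change heckeBar r ((v kappa : xH kappa) * h) =
      ((tensorBar n r v kappa : xH kappa) : Hecke r) * heckeBar r h
    rw [tensorBar_apply_coe, map_mul]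

theorem tensorBar_smul (a : A) (v : TensorSpace n r) :
    tensorBar n r (a • v) = LaurentPolynomial.invert a • tensorBar n r v :=
  tensorSpace_ext fun kappa => by
    rw [tensorBar_apply_coe]
    change heckeBar r (a • ((v kappa : xH kappa) : Hecke r)) =
      LaurentPolynomial.invert a • ((tensorBar n r v kappa : xH kappa) : Hecke r)
    rw [tensorBar_apply_coe, heckeBar_smul]

theorem tensorBar_incl (nu : Lam n r) (m : xH nu) :
    tensorBar n r (incl nu m) = incl nu (xHBar nu m) :=
  DirectSum.map_of _ _ _

/-- The bar involution of the affine `q`-Schur algebra: conjugation by the bar involution of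
`⨁_λ x_λ H`. -/
noncomputable def schurBar (f : Schur n r) : Schur n r where
  toFun v := tensorBar n r (f (tensorBar n r v))
  map_add' v w := by rw [map_add, map_add, map_add]
  map_smul' h v := by
    -- The two bars twist the right factor twice, so the conjugate is linear rather than semilinear.
    have := tensorBar_op_smul h.unop v
    rw [MulOpposite.op_unop] at this
    rw [this, map_smul, tensorBar_op_smul, heckeBar_heckeBar]
    rfl

theorem schurBar_apply (f : Schur n r) (v : TensorSpace n r) :
    schurBar f v = tensorBar n r (f (tensorBar n r v)) := rfl

theorem schurBar_add (f g : Schur n r) : schurBar (f + g) = schurBar f + schurBar g :=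
  LinearMap.ext fun v => by
    rw [LinearMap.add_apply, schurBar_apply, LinearMap.add_apply, map_add]; rfl

theorem schurBar_mul (f g : Schur n r) : schurBar (f * g) = schurBar f * schurBar g :=
  LinearMap.ext fun v => by
    rw [Module.End.mul_apply, schurBar_apply, schurBar_apply, schurBar_apply, tensorBar_tensorBar,
      Module.End.mul_apply]

theorem schurBar_one : schurBar (1 : Schur n r) = 1 :=
  LinearMap.ext fun v => by
    rw [schurBar_apply, Module.End.one_apply, tensorBar_tensorBar, Module.End.one_apply]

theorem schurBar_smul (a : A) (f : Schur n r) :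
    schurBar (a • f) = LaurentPolynomial.invert a • schurBar f :=
  LinearMap.ext fun v => by
    rw [LinearMap.smul_apply, schurBar_apply, LinearMap.smul_apply, tensorBar_smul]; rfl

theorem schurBar_schurBar (f : Schur n r) : schurBar (schurBar f) = f :=
  LinearMap.ext fun v => by
    rw [schurBar_apply, schurBar_apply, tensorBar_tensorBar, tensorBar_tensorBar]

theorem xHBar_op_smul_xGen (nu : Lam n r) (h : Hecke r) :
    xHBar nu (MulOpposite.op h • xGen nu) =
      MulOpposite.op (tpow (-2 * length (wZero nu)) • heckeBar r h) • xGen nu := by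
  apply Subtype.ext
  change heckeBar r (xElt nu * h) = xElt nu * (tpow (-2 * length (wZero nu)) • heckeBar r h)
  rw [map_mul, heckeBar_xElt, mul_smul_comm, smul_mul_assoc]

/-- The inner bar turns `x_μ` into `t^{-2 l(w_{0,μ})} x_μ`, and the outer bar inverts this power. -/
theorem IsBlock.schurBar {lam mu : Lam n r} {d : Hecke r} {f : Schur n r}
    (hf : IsBlock lam mu d f) :
    IsBlock lam mu (tpow (2 * length (wZero mu)) • heckeBar r d) (schurBar f) := by
  intro nu h kappa
  rw [schurBar_apply, tensorBar_incl, xHBar_op_smul_xGen, tensorBar_apply_coe, hf]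
  split_ifs with hc
  · rw [map_mul, heckeBar_smul, heckeBar_heckeBar, LaurentPolynomial.invert_T, hc.1,
      mul_smul_comm, smul_mul_assoc, neg_mul, neg_neg]
  · exact map_zero _

theorem op_smul_klC_wZero {mu : Lam n r} {c : xH mu} (hc : (c : Hecke r) = klC (wZero mu))
    (h : Hecke r) : MulOpposite.op h • c =
      MulOpposite.op (tpow (-(length (wZero mu) : ℤ)) • h) • xGen mu := by
  apply Subtype.ext
  change (c : Hecke r) * h = xElt mu * (tpow (-(length (wZero mu) : ℤ)) • h)
  rw [hc, klC_wZero, smul_mul_assoc, mul_smul_comm]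

theorem isSchurBar_schurBar : IsSchurBar (schurBar (n := n) (r := r)) where
  map_add := schurBar_add
  map_smul := schurBar_smul
  map_phi := by
    intro lam mu w _ c hc h kappa
    have hc1 : c = MulOpposite.op (1 : Hecke r) • c := by rw [MulOpposite.op_one, one_smul]
    rw [op_smul_klC_wZero hc, (isBlock_phi lam mu w).schurBar]
    simp only [true_and]
    split_ifs
    · rw [hc1, op_smul_klC_wZero hc, isBlock_phi lam mu w, if_pos ⟨rfl, rfl⟩, mul_smul_comm,
        mul_smul_comm, smul_mul_assoc, smul_smul, tpow_mul_tpow, heckeBar_smul, mul_one,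
        LaurentPolynomial.invert_T, smul_mul_assoc]
      -- With `l = l(w_{0,μ})`, both sides carry `t^l`: once as `t^{2l} t^{-l}`, once as the bar of
      -- `t^{-l}`.
      congr 2
      ring
    · rfl
  map_phi_of_ne := by
    intro lam mu w _ nu hne m
    obtain ⟨h, rfl⟩ := eq_op_smul_xGen m
    refine tensorSpace_ext fun kappa => ?_
    rw [(isBlock_phi lam mu w).schurBar, if_neg fun h => hne h.1]
    rfl

/-- A semilinear map is determined on the spanning set of the `φ_B`. There the prescribed values
suffice because `C_{w_{0,μ}}` differs from `x_μ` by a unit and so generates `x_μ H`. -/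
theorem IsSchurBar.eq_schurBar [NeZero n] {β : Schur n r → Schur n r} (hβ : IsSchurBar β) :
    β = schurBar := by
  funext f
  have h0 : β 0 = 0 := by
    have := hβ.map_smul 0 0
    rwa [zero_smul, map_zero, zero_smul] at this
  induction mem_span_phiSet f using Submodule.span_induction with
  | mem f hf =>
    obtain ⟨lam, mu, w, hw, rfl⟩ := hf
    let c : xH mu := ⟨klC (wZero mu), by
      rw [klC_wZero]
      exact mem_xH_iff_exists.2 ⟨tpow (-(length (wZero mu) : ℤ)) • 1, by
        rw [mul_smul_comm, mul_one]⟩⟩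
    refine schur_ext fun nu h kappa => ?_
    by_cases hne : nu = mu
    · subst hne
      have e : MulOpposite.op h • xGen nu =
          MulOpposite.op (tpow (length (wZero nu)) • h) • c := by
        rw [op_smul_klC_wZero (c := c) rfl, smul_smul, tpow_mul_tpow, neg_add_cancel, tpow_zero, one_smul]
      rw [e, hβ.map_phi _ _ w hw c rfl, isSchurBar_schurBar.map_phi _ _ w hw c rfl]
    · rw [hβ.map_phi_of_ne _ _ w hw nu hne, isSchurBar_schurBar.map_phi_of_ne _ _ w hw nu hne]
  | zero =>
    have := schurBar_smul (0 : A) (0 : Schur n r)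
    rw [zero_smul, map_zero, zero_smul] at this
    rw [h0, this]
  | add f g _ _ hf hg => rw [hβ.map_add, hf, hg, schurBar_add]
  | smul a f _ hf => rw [hβ.map_smul, hf, schurBar_smul]

/-- The normalizing factor `t^{l(w_{0,μ})}` of `θ_B` is inverted by the bar and restored by the
twist `t^{2 l(w_{0,μ})}`. -/
theorem schurBar_theta (lam mu : Lam n r) (w : W r) :
    schurBar (theta lam mu w) = theta lam mu w := by
  have h := (isBlock_theta lam mu w).schurBar
  rw [heckeBar_smul, heckeBar_klC, LaurentPolynomial.invert_T, smul_smul, tpow_mul_tpow,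
    show 2 * (length (wZero mu) : ℤ) + -length (wZero mu) = length (wZero mu) by ring] at h
  exact h.unique (isBlock_theta lam mu w)

end Bar

/-! ### The embedding of the Hecke algebra -/

section Embedding

theorem young_omega (h : r ≤ n) : young (omega h) = ⊥ := by
  have : youngSimples (omega h) = ∅ := by
    refine Set.eq_empty_of_forall_notMem ?_
    rintro s ⟨i, h1, h2, -, hi⟩
    -- Every `i < r` is the partial sum of the first `i` entries of `ω`, so no simple reflection
    -- survives.
    refine hi i (by omega) (by omega) ?_
    have e : ∀ j ∈ Finset.Icc 1 i, (omega h).1 j = 1 := by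
      intro j hj
      rw [Finset.mem_Icc] at hj
      change (if (j - 1) % (n : ℤ) < (r : ℤ) then 1 else 0) = 1
      rw [Int.emod_eq_of_lt (by omega) (by omega), if_pos (by omega)]
    rw [Finset.sum_congr rfl e, Finset.sum_const, Int.card_Icc, smul_eq_mul, mul_one]
    omega
  rw [young, this, Subgroup.closure_empty]

theorem xElt_omega (h : r ≤ n) : xElt (omega h) = 1 := by
  rw [xElt, young_omega, Subgroup.coe_bot, sumT_singleton, T_one]

theorem mem_xH_omega (h : r ≤ n) (m : Hecke r) : m ∈ xH (omega h) :=
  mem_xH_iff_exists.2 ⟨m, by rw [xElt_omega, one_mul]⟩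

theorem dcoset_omega (h : r ≤ n) (w : W r) : dcoset (omega h) (omega h) w = {w} := by
  rw [dcoset, young_omega, DoubleCoset.doubleCoset, Subgroup.coe_bot]
  simp

/-- The embedding of the Hecke algebra in the affine `q`-Schur algebra: `h` acts by left
multiplication on `x_ω H = H`. -/
noncomputable def heckeToSchur (h : r ≤ n) : Hecke r →ₗ[A] Schur n r where
  toFun x := block (omega h) (omega h) x fun _ _ => mem_xH_omega h _
  map_add' x y := by
    refine (isBlock_block _ _ _ _).unique ?_
    rw [add_mul]
    exact (isBlock_block _ _ _ _).add (isBlock_block _ _ _ _)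
  map_smul' a x := by
    refine (isBlock_block _ _ _ _).unique ?_
    rw [smul_mul_assoc]
    exact (isBlock_block _ _ _ _).smul a

theorem heckeToSchur_apply (h : r ≤ n) (x : Hecke r) (v : TensorSpace n r) :
    heckeToSchur h x v = incl (omega h)
      (mulLeftXH (omega h) (omega h) x (fun _ _ => mem_xH_omega h _) (v (omega h))) := rfl

theorem isBlock_heckeToSchur (h : r ≤ n) (x : Hecke r) :
    IsBlock (omega h) (omega h) x (heckeToSchur h x) := by
  have := isBlock_block (omega h) (omega h) x fun _ _ => mem_xH_omega h _
  rwa [xElt_omega, mul_one] at this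

theorem heckeToSchur_injective (h : r ≤ n) : Function.Injective (heckeToSchur h) := by
  intro x y hxy
  have h1 := isBlock_heckeToSchur h x (omega h) 1 (omega h)
  rw [hxy, isBlock_heckeToSchur h y, if_pos ⟨rfl, rfl⟩, if_pos ⟨rfl, rfl⟩, mul_one, mul_one] at h1
  exact h1.symm

theorem heckeToSchur_mul (h : r ≤ n) (x y : Hecke r) :
    heckeToSchur h (x * y) = heckeToSchur h x * heckeToSchur h y := by
  refine LinearMap.ext fun v => ?_
  rw [Module.End.mul_apply, heckeToSchur_apply, heckeToSchur_apply, heckeToSchur_apply,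
    incl_apply_self]
  congr 1
  exact Subtype.ext (mul_assoc _ _ _)

variable [NeZero r]

theorem heckeToSchur_T (h : r ≤ n) (w : W r) :
    heckeToSchur h (T w) = phi (omega h) (omega h) w := by
  have := isBlock_phi (omega h) (omega h) w
  rw [dcoset_omega, sumT_singleton] at this
  exact (isBlock_heckeToSchur h _).unique this

/-- Since `W_ω` is trivial, the twist by a power of `t` disappears. -/
theorem schurBar_heckeToSchur (h : r ≤ n) (x : Hecke r) :
    schurBar (heckeToSchur h x) = heckeToSchur h (heckeBar r x) := by
  have h1 := (isBlock_heckeToSchur h x).schurBar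
  have h2 : wZero (omega h) = 1 := by
    have := (wZero_isLongest (omega h)).1
    rw [young_omega] at this
    exact this
  rw [h2, length_one, Nat.cast_zero, mul_zero, tpow_zero, one_smul] at h1
  exact h1.unique (isBlock_heckeToSchur h _)

end Embedding

end AffineSchur

/-! ### The proposition -/

theorem proposition3p1 (n r : ℕ) (hn : 1 ≤ n) (hr : 1 ≤ r) :
    -- the objects in the statement are well defined
    (LinearIndependent A (T : W r → Hecke r) ∧
      Submodule.span A (Set.range (T : W r → Hecke r)) = ⊤) ∧
    (∀ w : W r, ∃! c, IsKL w c) ∧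
    (∀ lam mu : Lam n r, ∀ w ∈ minReps lam mu, ∃! f, IsPhi lam mu w f) ∧
    (∀ lam mu : Lam n r, ∀ w ∈ minReps lam mu, ∃! al, IsAlpha lam mu w al) ∧
    -- there is exactly one bar map `β`
    (∃! β : Schur n r → Schur n r, IsSchurBar β) ∧
    ∀ β : Schur n r → Schur n r, IsSchurBar β →
      -- it is a semilinear ring automorphism of order two
      ((∀ f g, β (f + g) = β f + β g) ∧
        (∀ f g, β (f * g) = β f * β g) ∧
        β 1 = 1 ∧
        (∀ (a : A) f, β (a • f) = LaurentPolynomial.invert a • β f) ∧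
        (∀ f, β (β f) = f)) ∧
      -- it restricts to the bar involution of the embedded affine Hecke algebra
      (∀ h : r ≤ n, ∃ ι : Hecke r →ₗ[A] Schur n r,
        Function.Injective ι ∧
        (∀ x y, ι (x * y) = ι x * ι y) ∧
        (∀ w : W r, ι (T w) = phi (omega h) (omega h) w) ∧
        ∀ x, β (ι x) = ι (heckeBar r x)) ∧
      -- it fixes the elements `θ_B`
      (∀ lam mu : Lam n r, ∀ w ∈ minReps lam mu, β (theta lam mu w) = theta lam mu w) := by
  have : NeZero n := ⟨by omega⟩
  have : NeZero r := ⟨by omega⟩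
  refine ⟨⟨linearIndependent_T, span_T⟩, existsUnique_isKL,
    fun lam mu w _ => existsUnique_isPhi lam mu w, fun lam mu w _ => existsUnique_isAlpha lam mu w,
    ⟨schurBar, isSchurBar_schurBar, fun β hβ => hβ.eq_schurBar⟩, ?_⟩
  intro β hβ
  rw [hβ.eq_schurBar]
  exact ⟨⟨schurBar_add, schurBar_mul, schurBar_one, schurBar_smul, schurBar_schurBar⟩,
    fun h => ⟨heckeToSchur h, heckeToSchur_injective h, heckeToSchur_mul h, heckeToSchur_T h,
      schurBar_heckeToSchur h⟩,
    fun lam mu w _ => schurBar_theta lam mu w⟩
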